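/- Let $d \ge 1$ and let $\pi$ be a probability density on $\mathbb{R}^d$ (w.r.t. Lebesgue measure) which is positive, bounded and differentiable, and such that, $|\cdot|$ denoting the Euclidean norm, $$\lim_{r\to\infty}\ \sup_{|x|\ge r} \frac{x}{|x|^{\rho}}\cdot\nabla\log\pi(x) = -\infty \ \text{ for some } \rho>1, \qquad \sup_{|x|\ge R} \frac{x}{|x|}\cdot\frac{\nabla\pi(x)}{|\nabla\pi(x)|} < 0 \ \text{ for some } R>0$$ (in particular $\nabla\pi(x)\neq 0$ for $|x|\ge R$). Fix $\kappa>0$ and $s\in(0,1)$, and set $W(x) = \pi(x)^{-s}\,\sup_{y}\pi(y)^{s}$. For a symmetric positive semidefinite $d\times d$ matrix $\Gamma$ and $x\in\mathbb{R}^d$ let $Q_{\Gamma}(x,\cdot)$ be the Gaussian law with mean $x$ and covariance matrix $(2.38)^2 d^{-1}\Gamma$, and define the random-walk Metropolis kernel $$P_{\Gamma}(x,A) = \int_A \Bigl(1\wedge\frac{\pi(y)}{\pi(x)}\Bigr) Q_{\Gamma}(x,dy) + \mathbf 1_A(x)\Bigl[1-\int \Bigl(1\wedge\frac{\pi(y)}{\pi(x)}\Bigr)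 Q_{\Gamma}(x,dy)\Bigr].$$ Let $(X_n,\mu_n,\Gamma_n)_{n\ge0}$ be an adaptive Metropolis process on a filtered probability space $(\Omega,\mathcal A,(\mathcal F_n)_{n\ge 0},\mathbb P)$: it is $(\mathcal F_n)$-adapted, $X_n$ and $\mu_n$ take values in $\mathbb R^d$, $\mu_0=0$, $\Gamma_0$ is symmetric positive semidefinite, for all $n\ge 0$ $$\mu_{n+1} = \mu_n + \tfrac{1}{n+1}(X_{n+1}-\mu_n), \qquad \Gamma_{n+1} = \tfrac{n}{n+1}\Gamma_n + \tfrac{1}{n+1}\bigl\{(X_{n+1}-\mu_n)(X_{n+1}-\mu_n)^T + \kappa I_d\bigr\},$$ and, for every bounded measurable $g:\mathbb R^d\to\mathbb R$ and all $n\ge0$, $\mathbb E[g(X_{n+1})\mid\mathcal F_n] = \int g(y)\,P_{\Gamma_n}(X_n,dy)$ $\mathbb P$-a.s. If $\mathbb E[W(X_0)]<\infty$, then for every bounded measurable function $f:\mathbb R^d\to\mathbb R$, $$\lim_{n\to\infty}\mathbb E[f(X_n)] = \int_{\mathbb R^d} f(x)\,\pi(x)\,dx.$$ -/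

import Mathlib

open MeasureTheory ProbabilityTheory Filter Topology

namespace AdaptiveMetropolis

noncomputable section

/-- Assumption on the target density `π` on `ℝ^d`: positive, bounded, differentiable,
super-exponential, with regular contours. Suprema are taken in the extended reals.
(Since `0⁻¹ = 0`, the last field also says that the gradient does not vanish for `R ≤ ‖x‖`.) -/
structure SuperExponentialRegular {d : ℕ} (π : EuclideanSpace ℝ (Fin d) → ℝ) : Prop where
  pos : ∀ x, 0 < π x
  bounded : ∃ M : ℝ, ∀ x, π x ≤ M
  differentiable : Differentiable ℝ π
  superExponential : ∃ ρ : ℝ, 1 < ρ ∧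
    Tendsto (fun r : ℝ => ⨆ (x : EuclideanSpace ℝ (Fin d)) (_ : r ≤ ‖x‖),
      ((inner ℝ ((‖x‖ ^ ρ)⁻¹ • x) (gradient (fun y => Real.log (π y)) x) : ℝ) : EReal))
      atTop (𝓝 ⊥)
  regularContours : ∃ R : ℝ, 0 < R ∧
    (⨆ (x : EuclideanSpace ℝ (Fin d)) (_ : R ≤ ‖x‖),
      ((inner ℝ (‖x‖⁻¹ • x) (‖gradient π x‖⁻¹ • gradient π x) : ℝ) : EReal)) < 0

/-- The function `W = π ^ (-s) * ‖π ^ s‖_∞`. -/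
def W {d : ℕ} (π : EuclideanSpace ℝ (Fin d) → ℝ) (s : ℝ) (x : EuclideanSpace ℝ (Fin d)) : ℝ :=
  π x ^ (-s) * ⨆ y, |π y ^ s|

/-- Acceptance probability `1 ∧ π(y) / π(x)`. -/
def accept {d : ℕ} (π : EuclideanSpace ℝ (Fin d) → ℝ) (x y : EuclideanSpace ℝ (Fin d)) : ℝ :=
  min 1 (π y / π x)

/-- Law of the random-walk proposal from `x`: Gaussian with mean `x` and covariance matrix
`(2.38)^2 d⁻¹ Γ`. -/
def proposal {d : ℕ} (Γ : Matrix (Fin d) (Fin d) ℝ) (x : EuclideanSpace ℝ (Fin d)) :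
    Measure (EuclideanSpace ℝ (Fin d)) :=
  multivariateGaussian x (((2.38 : ℝ) ^ 2 / (d : ℝ)) • Γ)

/-- The random-walk Metropolis transition `P_Γ(x, ·)` with target density `π`: the accepted
part of the proposal, plus the rejection probability times the Dirac mass at `x`. -/
def metropolis {d : ℕ} (π : EuclideanSpace ℝ (Fin d) → ℝ) (Γ : Matrix (Fin d) (Fin d) ℝ)
    (x : EuclideanSpace ℝ (Fin d)) : Measure (EuclideanSpace ℝ (Fin d)) :=
  (proposal Γ x).withDensity (fun y => ENNReal.ofReal (accept π x y)) +
    ENNReal.ofReal (1 - ∫ y, accept π x y ∂(proposal Γ x)) • Measure.dirac x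

/-- `(X, m, Γ)` is an adaptive Metropolis process for the target density `π` with
regularization `κ`, on the filtered probability space `(Ω, ℱ, P)`: `X n` is the state, `m n`
the running mean and `Γ n` the running (regularized) covariance matrix. -/
structure IsAdaptiveMetropolis {d : ℕ} {Ω : Type*} [mΩ : MeasurableSpace Ω]
    (P : Measure Ω) (ℱ : Filtration ℕ mΩ) (π : EuclideanSpace ℝ (Fin d) → ℝ) (κ : ℝ)
    (X m : ℕ → Ω → EuclideanSpace ℝ (Fin d)) (Γ : ℕ → Ω → Matrix (Fin d) (Fin d) ℝ) :
    Prop where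
  adapted_state : ∀ n, Measurable[ℱ n] (X n)
  adapted_mean : ∀ n, Measurable[ℱ n] (m n)
  adapted_cov : ∀ n i j, Measurable[ℱ n] (fun ω => Γ n ω i j)
  mean_zero : ∀ ω, m 0 ω = 0
  cov_zero : ∀ ω, (Γ 0 ω).PosSemidef
  mean_succ : ∀ n ω, m (n + 1) ω = m n ω + (1 / ((n : ℝ) + 1)) • (X (n + 1) ω - m n ω)
  cov_succ : ∀ n ω, Γ (n + 1) ω = ((n : ℝ) / ((n : ℝ) + 1)) • Γ n ω +
    (1 / ((n : ℝ) + 1)) •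
      (Matrix.vecMulVec (X (n + 1) ω - m n ω).ofLp (X (n + 1) ω - m n ω).ofLp +
        κ • (1 : Matrix (Fin d) (Fin d) ℝ))
  transition : ∀ (n : ℕ) (f : EuclideanSpace ℝ (Fin d) → ℝ), Measurable f →
    (∃ C : ℝ, ∀ x, |f x| ≤ C) →
      P[fun ω => f (X (n + 1) ω) | ℱ n] =ᵐ[P]
        fun ω => ∫ y, f y ∂(metropolis π (Γ n ω) (X n ω))

end

end AdaptiveMetropolis

/-! The covariance moves by relative steps of order 1/n (up to logarithms), so over a window much
shorter than n the process is close, in total variation, to a Metropolis chain with frozen proposal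
covariance. It remains to see that the frozen chain mixes within the window. The covariances are
bounded below by κ from time 1 on but have no uniform upper bound, so the mixing rate has to be
explicit in an upper bound L.

Drift (`IsTarget.exists_drift`). Split the moves y from x at π(y) = 2π(x). Moves above this level
shrink the Lyapunov function by the factor 2^(-s); the other moves cost at most `lossWeight`, that
is (π(y)/π(x))^(1-s). The gain region contains a unit ball at bounded distance from x, hence has
proposal mass at least a constant times the normalization N of the Gaussian density. The loss is
negligible against this: along rays π decays so fast that `lossWeight` lives on thin shells, and
many small dilations of a shell have comparable Gaussian mass and mostly fall into the gain region
(`mul_setIntegral_le_of_dilation`). The shell argument needs contours of π to be comparable in all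
directions, which uses connectedness of the sphere; dimension one is done directly on half-lines.
The outcome is PW ≤ (1 - cN)W + b with c, b depending on the covariance only through κ.

Rate (`IsTarget.exists_rate`). If the covariance is at most L then N is at least of order L^(-d).
Since π has exponential tails, ‖x‖ is O(1 + log W(x)), so the sublevel set relevant to the drift has
radius O(1 + log L), and the transition density from it to the unit ball is at least exp(-A(1 + log
L)²). Drift and this minorization contract a weighted oscillation seminorm (`mhOp_contraction`, an
argument of Hairer–Mattingly type), giving geometric ergodicity with rate 1 - exp(-A(1 + log L)²).

Trajectory. Dropping the negative drift term, E W(X_n) grows at most linearly. With probability 1 -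
O(n^(-2)) therefore W(X_k) ≤ n⁴ for all k ≤ n; on this event ‖X_k‖ = O(log n), all covariances up to
time n are polylogarithmic in n, and exp(-A(1 + log L)²) is eventually at least n^(-1/8).

Conclusion (`IsAdaptiveMetropolis.abs_integral_sub_le`, `tendsto_window_bound`). Freeze the
covariance at time n - r with r = ⌊n^(1/4)⌋. Replacing true by frozen kernels costs r² polylog(n)/n,
the exceptional event costs O(r n^(-2)), and the frozen chain is within a constant times n⁴ (1 -
n^(-1/8))^r of equilibrium, which is of order n⁴ exp(-n^(1/8)). All three vanish. -/

namespace AdaptiveMetropolis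

/-! ### Geometry of the level sets of the target -/

section Geometry

variable {E : Type*} [NormedAddCommGroup E] [InnerProductSpace ℝ E]

/-- The log-derivative of `π` along rays from the origin is super-linear. -/
def RadialDecay (π : E → ℝ) (ρ : ℝ) : Prop :=
  ∀ M : ℝ, ∃ R : ℝ, 1 ≤ R ∧ ∀ z : E, R ≤ ‖z‖ → fderiv ℝ π z z ≤ -M * ‖z‖ ^ ρ * π z

/-- `π` decreases in a cone of directions around the outward radial direction. -/
def ConeDecay (π : E → ℝ) (β R : ℝ) : Prop :=
  ∀ z : E, R ≤ ‖z‖ → ∀ v : E, ∀ c : ℝ, 0 ≤ c → ‖v - c • z‖ ≤ β * c * ‖z‖ → fderiv ℝ π z v ≤ 0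

/-- The function t ↦ log π(tz) + M‖z‖^ρ t is nonincreasing on [1, ∞): the radial hypothesis at tz
bounds its derivative, with t ≤ t^ρ absorbing the factor t between the vectors z and tz. -/
theorem log_le_of_radialDecay {π : E → ℝ} (hpos : ∀ x, 0 < π x) (hd : Differentiable ℝ π)
    {ρ : ℝ} (hρ : 1 < ρ) (h : RadialDecay π ρ) (M : ℝ) (hM : 0 ≤ M) :
    ∃ R : ℝ, 1 ≤ R ∧ ∀ z : E, R ≤ ‖z‖ → ∀ t : ℝ, 1 ≤ t →
      Real.log (π (t • z)) ≤ Real.log (π z) - M * ‖z‖ ^ ρ * (t - 1) := by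
  obtain ⟨R, hR1, hR⟩ := h M
  refine ⟨R, hR1, fun z hz t ht => ?_⟩
  have hz0 : 0 < ‖z‖ := by linarith
  let g : ℝ → ℝ := fun t => Real.log (π (t • z)) + M * ‖z‖ ^ ρ * t
  have hg : ∀ t, HasDerivAt g ((fderiv ℝ π (t • z) z) / π (t • z) + M * ‖z‖ ^ ρ) t := by
    intro t
    have h1 : HasDerivAt (fun t : ℝ => t • z) z t := by
      simpa using (hasDerivAt_id t).smul_const z
    have h2 : HasDerivAt (fun t : ℝ => π (t • z)) (fderiv ℝ π (t • z) z) t :=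
      (hd (t • z)).hasFDerivAt.comp_hasDerivAt t h1
    have h3 := h2.log (hpos _).ne'
    have h4 := h3.add ((hasDerivAt_id t).const_mul (M * ‖z‖ ^ ρ))
    rw [mul_one] at h4
    exact h4
  have hanti : AntitoneOn g (Set.Ici 1) := by
    apply antitoneOn_of_deriv_nonpos (convex_Ici 1)
    · exact fun t _ => (hg t).continuousAt.continuousWithinAt
    · exact fun t _ => (hg t).differentiableAt.differentiableWithinAt
    · intro t ht
      rw [interior_Ici] at ht
      have ht1 : 1 < t := ht
      rw [(hg t).deriv]
      have hn : ‖t • z‖ = t * ‖z‖ := by rw [norm_smul, Real.norm_of_nonneg (by linarith)]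
      have h1 := hR (t • z) (by rw [hn]; nlinarith)
      rw [map_smul, hn, Real.mul_rpow (by linarith) hz0.le, smul_eq_mul] at h1
      have h2 : fderiv ℝ π (t • z) z ≤ -(M * ‖z‖ ^ ρ) * π (t • z) := by
        have h3 : t ≤ t ^ ρ := by
          simpa using Real.rpow_le_rpow_of_exponent_le ht1.le hρ.le
        have h4 : 0 ≤ M * ‖z‖ ^ ρ * π (t • z) :=
          mul_nonneg (mul_nonneg hM (Real.rpow_nonneg hz0.le _)) (hpos _).le
        have h5 : t * fderiv ℝ π (t • z) z ≤ t * (-(M * ‖z‖ ^ ρ) * π (t • z)) := by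
          nlinarith
        exact le_of_mul_le_mul_left h5 (by linarith)
      have h6 : fderiv ℝ π (t • z) z / π (t • z) ≤ -(M * ‖z‖ ^ ρ) := by
        rwa [div_le_iff₀ (hpos _)]
      linarith
  have h7 := hanti (Set.mem_Ici.2 le_rfl) (Set.mem_Ici.2 ht) ht
  simp only [g, one_smul] at h7
  linarith

/-- The direction v = y - x stays in the decreasing cone along the whole ray from x: at x + tv it is
close to (c/(1+tc))(x + tv) with c = l - 1, and the norm never drops below ‖x‖ because β ≤ 1. So π
decreases along the segment. -/
theorem le_of_coneDecay {π : E → ℝ} (hd : Differentiable ℝ π) {β R : ℝ} (hβ0 : 0 ≤ β)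
    (hβ : β ≤ 1) (h : ConeDecay π β R) {x y : E} (hx : R ≤ ‖x‖) {l : ℝ} (hl : 1 ≤ l)
    (hy : ‖y - l • x‖ ≤ β * (l - 1) * ‖x‖) : π y ≤ π x := by
  set v := y - x with hv
  set c := l - 1 with hc
  have hc0 : 0 ≤ c := by linarith
  have hvc : ‖v - c • x‖ ≤ β * c * ‖x‖ := by
    convert hy using 2
    rw [hv, hc, sub_smul, one_smul]; abel
  let g : ℝ → ℝ := fun t => π (x + t • v)
  have hg : ∀ t, HasDerivAt g (fderiv ℝ π (x + t • v) v) t := by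
    intro t
    have h1 : HasDerivAt (fun t : ℝ => x + t • v) v t := by
      simpa using ((hasDerivAt_id t).smul_const v).const_add x
    exact (hd (x + t • v)).hasFDerivAt.comp_hasDerivAt t h1
  have hanti : AntitoneOn g (Set.Ici 0) := by
    apply antitoneOn_of_deriv_nonpos (convex_Ici 0)
    · exact fun t _ => (hg t).continuousAt.continuousWithinAt
    · exact fun t _ => (hg t).differentiableAt.differentiableWithinAt
    · intro t ht
      rw [interior_Ici] at ht
      have ht0 : 0 < t := ht
      rw [(hg t).deriv]
      have htc : 0 < 1 + t * c := by positivity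
      have hnorm : ‖x‖ ≤ ‖x + t • v‖ := by
        have h1 : x + t • v = (1 + t * c) • x + t • (v - c • x) := by
          module
        have h2 : ‖(1 + t * c) • x‖ - ‖t • (v - c • x)‖ ≤ ‖x + t • v‖ := by
          rw [h1]
          have := norm_sub_norm_le ((1 + t * c) • x) (-(t • (v - c • x)))
          rwa [norm_neg, sub_neg_eq_add] at this
        rw [norm_smul, norm_smul, Real.norm_of_nonneg htc.le, Real.norm_of_nonneg ht0.le] at h2
        have h3 : t * ‖v - c • x‖ ≤ t * (c * ‖x‖) := by
          apply mul_le_mul_of_nonneg_left _ ht0.le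
          refine hvc.trans ?_
          rw [mul_assoc]
          exact mul_le_of_le_one_left (by positivity) hβ
        nlinarith
      apply h _ (hx.trans hnorm) v (c / (1 + t * c)) (by positivity)
      have h4 : v - (c / (1 + t * c)) • (x + t • v) = (1 / (1 + t * c)) • (v - c • x) := by
        match_scalars <;> field_simp <;> ring
      rw [h4, norm_smul, Real.norm_of_nonneg (by positivity)]
      calc 1 / (1 + t * c) * ‖v - c • x‖ ≤ 1 / (1 + t * c) * (β * c * ‖x + t • v‖) := by
            gcongr; exact hvc.trans (by gcongr)
        _ = _ := by ring
  have h7 := hanti (Set.mem_Ici.2 le_rfl) (Set.mem_Ici.2 zero_le_one) zero_le_one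
  simpa [g, hv] using h7

variable [FiniteDimensional ℝ E]

/-- Contours of `π` are comparable in all directions. -/
theorem exists_contour_ratio (hdim : 1 < Module.rank ℝ E) {π : E → ℝ} (hd : Differentiable ℝ π)
    {β R : ℝ} (hβ0 : 0 < β) (hβ : β ≤ 1) (hR : 0 < R) (h : ConeDecay π β R) :
    ∃ B : ℝ, 1 ≤ B ∧ ∀ x y : E, R ≤ ‖x‖ → B * ‖x‖ ≤ ‖y‖ → π y ≤ π x := by
  -- S is transitive and holds both ways between nearby directions (`step`, with B = 2).
  -- Connectedness of the sphere, which is where rank > 1 enters, then gives S everywhere; a finite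
  -- cover makes the constant uniform.
  let S : E → E → Prop := fun a b => ∃ B : ℝ, 1 ≤ B ∧ ∀ r : ℝ, R ≤ r → ∀ t : ℝ, B * r ≤ t →
    π (t • b) ≤ π (r • a)
  have step : ∀ a b : E, ‖a‖ = 1 → ‖b - a‖ ≤ β / 2 → ∀ r : ℝ, R ≤ r → ∀ t : ℝ, 2 * r ≤ t →
      π (t • b) ≤ π (r • a) := by
    intro a b ha hab r hr t ht
    have hr0 : 0 < r := by linarith
    refine le_of_coneDecay hd hβ0.le hβ h (x := r • a) (l := t / r) ?_ ?_ ?_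
    · rwa [norm_smul, ha, mul_one, Real.norm_of_nonneg hr0.le]
    · rw [le_div_iff₀ hr0]; linarith
    · rw [smul_smul, div_mul_cancel₀ _ hr0.ne', ← smul_sub, norm_smul, norm_smul, ha, mul_one,
        Real.norm_of_nonneg hr0.le, Real.norm_of_nonneg (by linarith), mul_assoc,
        sub_mul, div_mul_cancel₀ _ hr0.ne']
      calc t * ‖b - a‖ ≤ t * (β / 2) := by gcongr; linarith
        _ ≤ _ := by nlinarith
  have htrans : ∀ a b c : E, S a b → S b c → S a c := by
    rintro a b c ⟨B, hB, hab⟩ ⟨B', hB', hbc⟩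
    refine ⟨B * B', by nlinarith, fun r hr t ht => ?_⟩
    refine (hbc (B * r) (by nlinarith) t (by nlinarith)).trans (hab r hr _ le_rfl)
  have hall : ∀ a ∈ Metric.sphere (0 : E) 1, ∀ b ∈ Metric.sphere (0 : E) 1, S a b := by
    have hc := isPreconnected_sphere hdim (0 : E) 1
    intro a ha b hb
    refine hc.induction₂' S (fun x hx => ?_) (fun x y z _ _ _ => htrans x y z) ha hb
    have hx1 : ‖x‖ = 1 := by simpa using hx
    have hball : Metric.ball x (β / 2) ∈ 𝓝 x := Metric.ball_mem_nhds _ (by linarith)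
    filter_upwards [mem_nhdsWithin_of_mem_nhds hball, self_mem_nhdsWithin] with y hy hys
    have hy1 : ‖y‖ = 1 := by simpa using hys
    rw [Metric.mem_ball, dist_eq_norm] at hy
    exact ⟨⟨2, by norm_num, step x y hx1 hy.le⟩,
      ⟨2, by norm_num, step y x hy1 (by rw [norm_sub_rev]; exact hy.le)⟩⟩
  obtain ⟨T, hTs, hTf, hTc⟩ := (isCompact_sphere (0 : E) 1).finite_cover_balls
    (show 0 < β / 2 by linarith)
  choose! Bf hB1 hB2 using hall
  obtain ⟨B0, hB0⟩ := ((hTf.prod hTf).image (fun p : E × E => Bf p.1 p.2)).bddAbove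
  -- One factor 2 to pass from the direction of x to a centre a of the cover, `max B0 1` from a to
  -- another centre b, and one more factor 2 from b to the direction of y.
  refine ⟨4 * max B0 1, by linarith [le_max_right B0 1], fun x y hx hy => ?_⟩
  have hx0 : 0 < ‖x‖ := by linarith
  have hm1 := le_max_right B0 1
  have hy0 : 0 < ‖y‖ := by nlinarith
  have hnx : ‖‖x‖⁻¹ • x‖ = 1 := by
    rw [norm_smul, norm_inv, norm_norm, inv_mul_cancel₀ hx0.ne']
  have hny : ‖‖y‖⁻¹ • y‖ = 1 := by
    rw [norm_smul, norm_inv, norm_norm, inv_mul_cancel₀ hy0.ne']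
  have hcov : ∀ u : E, ‖u‖ = 1 → ∃ a ∈ T, ‖u - a‖ ≤ β / 2 := by
    intro u hu
    have := hTc (show u ∈ Metric.sphere (0 : E) 1 by simpa using hu)
    simp only [Set.mem_iUnion, Metric.mem_ball, dist_eq_norm] at this
    obtain ⟨a, ha, h⟩ := this
    exact ⟨a, ha, h.le⟩
  obtain ⟨a, haT, ha⟩ := hcov _ hnx
  obtain ⟨b, hbT, hb⟩ := hcov _ hny
  have hb1 : ‖b‖ = 1 := by simpa using hTs hbT
  have h1 := step _ a hnx (by rw [norm_sub_rev]; exact ha) ‖x‖ hx (2 * ‖x‖) le_rfl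
  have hBab : Bf a b ≤ max B0 1 :=
    (hB0 ⟨(a, b), ⟨haT, hbT⟩, rfl⟩).trans (le_max_left _ _)
  have h2 := hB2 a (hTs haT) b (hTs hbT) (2 * ‖x‖) (by linarith) (max B0 1 * (2 * ‖x‖))
    (by gcongr)
  have h3 := step b _ hb1 hb (max B0 1 * (2 * ‖x‖)) (by nlinarith) ‖y‖ (by linarith)
  rw [smul_smul, mul_inv_cancel₀ hx0.ne', one_smul] at h1
  rw [smul_smul, mul_inv_cancel₀ hy0.ne', one_smul] at h3
  linarith

end Geometry

/-! ### Consequences for the target: tails, contours, gain region -/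

section Target

variable {E : Type*} [NormedAddCommGroup E] [InnerProductSpace ℝ E]

/-- A positive differentiable target with super-exponential radial decay and regular contours. -/
structure IsTarget (π : E → ℝ) (ρ β R : ℝ) : Prop where
  pos : ∀ x, 0 < π x
  diff : Differentiable ℝ π
  one_lt : 1 < ρ
  radial : RadialDecay π ρ
  beta_pos : 0 < β
  beta_le : β ≤ 1
  radius_pos : 0 < R
  cone : ConeDecay π β R

variable {π : E → ℝ} {ρ β R : ℝ}

theorem IsTarget.exists_exp_decay (h : IsTarget π ρ β R) (M : ℝ) (hM : 0 ≤ M) :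
    ∃ R : ℝ, 1 ≤ R ∧ ∀ z : E, R ≤ ‖z‖ → ∀ t : ℝ, 1 ≤ t →
      π (t • z) ≤ π z * Real.exp (-(M * ‖z‖ ^ ρ * (t - 1))) := by
  obtain ⟨R, hR1, hR⟩ := log_le_of_radialDecay h.pos h.diff h.one_lt h.radial M hM
  refine ⟨R, hR1, fun z hz t ht => ?_⟩
  have := Real.exp_le_exp.2 (hR z hz t ht)
  rwa [Real.exp_log (h.pos _), sub_eq_add_neg, Real.exp_add, Real.exp_log (h.pos _)] at this

variable [FiniteDimensional ℝ E]

/-- Compare x with the point of norm R on its ray: as R ≥ 1, R ≤ R^ρ, so the radial decay with M = 1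
gains at least ‖x‖ - R in the exponent. -/
theorem IsTarget.exists_le_exp_neg_norm (h : IsTarget π ρ β R) :
    ∃ C : ℝ, 0 < C ∧ ∀ x : E, π x ≤ C * Real.exp (-‖x‖) := by
  obtain ⟨R, hR1, hR⟩ := h.exists_exp_decay 1 zero_le_one
  obtain ⟨C, hC⟩ := ((isCompact_closedBall (0 : E) R).image h.diff.continuous).bddAbove
  have hC' : ∀ x : E, ‖x‖ ≤ R → π x ≤ C := fun x hx =>
    hC ⟨x, by simpa using hx, rfl⟩
  have hC0 : 0 < C := (h.pos 0).trans_le (hC' 0 (by simpa using by linarith))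
  refine ⟨C * Real.exp R, by positivity, fun x => ?_⟩
  rw [mul_assoc, ← Real.exp_add]
  by_cases hx : ‖x‖ ≤ R
  · have : 1 ≤ Real.exp (R + -‖x‖) := Real.one_le_exp (by linarith)
    nlinarith [hC' x hx]
  · push Not at hx
    have hx0 : 0 < ‖x‖ := by linarith
    have hzn : ‖(R / ‖x‖) • x‖ = R := by
      rw [norm_smul, Real.norm_of_nonneg (by positivity), div_mul_cancel₀ _ hx0.ne']
    have h1 := hR ((R / ‖x‖) • x) hzn.ge (‖x‖ / R) (by rw [le_div_iff₀ (by linarith)]; linarith)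
    rw [smul_smul, show ‖x‖ / R * (R / ‖x‖) = 1 by field_simp, one_smul, hzn, one_mul] at h1
    refine h1.trans ?_
    gcongr
    · exact hC' _ hzn.le
    · have h2 : R ≤ R ^ ρ := by
        simpa using Real.rpow_le_rpow_of_exponent_le hR1 h.one_lt.le
      have h3 : 0 ≤ ‖x‖ / R - 1 := by
        rw [sub_nonneg, le_div_iff₀ (by linarith)]; linarith
      have h4 : R * (‖x‖ / R - 1) = ‖x‖ - R := by field_simp
      nlinarith

theorem IsTarget.exists_two_mul_le_of_norm_le (h : IsTarget π ρ β R) (r : ℝ) :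
    ∃ R' : ℝ, 1 ≤ R' ∧ ∀ x : E, R' ≤ ‖x‖ → ∀ y : E, ‖y‖ ≤ r → 2 * π x ≤ π y := by
  obtain ⟨C, hC0, hC⟩ := h.exists_le_exp_neg_norm
  by_cases hr : 0 ≤ r
  · obtain ⟨y0, -, hy0⟩ := (isCompact_closedBall (0 : E) r).exists_isMinOn
      ⟨0, by simpa using hr⟩ h.diff.continuous.continuousOn
    have hlim : Tendsto (fun t : ℝ => 2 * (C * Real.exp (-t))) atTop (𝓝 0) := by
      have := (Real.tendsto_exp_neg_atTop_nhds_zero.const_mul C).const_mul 2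
      simpa using this
    obtain ⟨R', hR'⟩ := eventually_atTop.1 (hlim.eventually (gt_mem_nhds (h.pos y0)))
    refine ⟨max R' 1, le_max_right _ _, fun x hx y hy => ?_⟩
    have h1 := hR' ‖x‖ ((le_max_left _ _).trans hx)
    have h2 : π y0 ≤ π y := hy0 (by simpa using hy)
    linarith [hC x]
  · exact ⟨1, le_rfl, fun x _ y hy => absurd ((norm_nonneg y).trans hy) hr⟩

/-- The factor 2 on the inner side is bought by going from x to x/2, where the radial decay
multiplies π by at least e > 2; this is why 2B replaces the contour ratio B. Points y near the
origin are treated by `exists_two_mul_le_of_norm_le`. -/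
theorem IsTarget.exists_contour (h : IsTarget π ρ β R) (hdim : 1 < Module.rank ℝ E) :
    ∃ B R' : ℝ, 1 ≤ B ∧ 1 ≤ R' ∧ ∀ x : E, R' ≤ ‖x‖ →
      (∀ y : E, ‖y‖ ≤ ‖x‖ / B → 2 * π x ≤ π y) ∧ (∀ y : E, B * ‖x‖ ≤ ‖y‖ → π y ≤ π x) := by
  obtain ⟨B, hB1, hB⟩ := exists_contour_ratio hdim h.diff h.beta_pos h.beta_le h.radius_pos h.cone
  obtain ⟨R1, hR1, hdec⟩ := h.exists_exp_decay 1 zero_le_one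
  obtain ⟨R2, hR2, hcen⟩ := h.exists_two_mul_le_of_norm_le (max R R1)
  refine ⟨2 * B, max R2 (max R R1), by linarith, hR2.trans (le_max_left _ _), fun x hx => ?_⟩
  have hxR : max R R1 ≤ ‖x‖ := (le_max_right _ _).trans hx
  have hx2 : R2 ≤ ‖x‖ := (le_max_left _ _).trans hx
  have hx1 : R1 ≤ ‖x‖ := (le_max_right _ _).trans hxR
  have hB0 : 0 < B := by linarith
  constructor
  · intro y hy
    by_cases hyR : ‖y‖ ≤ max R R1
    · exact hcen x hx2 y hyR
    · push Not at hyR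
      have hyR0 : R ≤ ‖y‖ := (le_max_left _ _).trans hyR.le
      have hyR1 : R1 ≤ ‖y‖ := (le_max_right _ _).trans hyR.le
      have hxy : 2 * (B * ‖y‖) ≤ ‖x‖ := by
        rw [le_div_iff₀ (by linarith)] at hy; linarith
      have h1 : π ((1 / 2 : ℝ) • x) ≤ π y := hB y _ hyR0 (by
        rw [norm_smul, Real.norm_of_nonneg (by norm_num)]; linarith)
      have hn : ‖(1 / 2 : ℝ) • x‖ = ‖x‖ / 2 := by
        rw [norm_smul, Real.norm_of_nonneg (by norm_num)]; ring
      have hlarge : R1 ≤ ‖x‖ / 2 := by nlinarith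
      have h2 := hdec ((1 / 2 : ℝ) • x) (by rwa [hn]) 2 (by norm_num)
      rw [smul_smul, hn] at h2
      norm_num at h2
      have h3 : Real.exp (-(‖x‖ / 2) ^ ρ) ≤ 1 / 2 := by
        have h4 : 1 ≤ (‖x‖ / 2) ^ ρ := Real.one_le_rpow (by linarith) (by linarith [h.one_lt])
        have h5 : Real.exp (-(‖x‖ / 2) ^ ρ) ≤ Real.exp (-1) := Real.exp_le_exp.2 (by linarith)
        have h6 : Real.exp (-1) ≤ 1 / 2 := by
          have := Real.exp_neg_one_lt_half
          linarith
        linarith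
      have h7 := h.pos ((1 / 2 : ℝ) • x)
      norm_num at h7 h1
      nlinarith
  · intro y hy
    exact hB x y ((le_max_left _ _).trans hxR) (by nlinarith [norm_nonneg x])

/-- Step back from x along its ray by a bounded length t0. A point y within distance 1 of the new
centre, dilated by 1 + 1/‖x‖, loses a factor at least e by radial decay, and the dilated point y'
still has x in its cone of decrease. Hence π(x) ≤ π(y') ≤ π(y)/2. -/
theorem IsTarget.exists_inner_ball (h : IsTarget π ρ β R) :
    ∃ D R' : ℝ, 0 ≤ D ∧ 1 ≤ R' ∧ ∀ x : E, R' ≤ ‖x‖ →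
      ∃ p : E, ‖p - x‖ ≤ D ∧ ∀ y ∈ Metric.ball p 1, 2 * π x ≤ π y := by
  obtain ⟨R1, hR1, hdec⟩ := h.exists_exp_decay 2 zero_le_two
  have hβ0 := h.beta_pos
  -- With 1 - μ ≥ (t0 - 1)/n = 8/(βn) and ‖y'‖ ≥ n/4, the cone at y' has width at least 2 at x,
  -- which covers the displacement (1 + 1/n)e.
  set t0 := 1 + 8 / β with ht0
  have ht0p : 0 < t0 := by positivity
  refine ⟨t0, 2 * R1 + 2 * R + 4 * t0 + 8, ht0p.le, by linarith [h.radius_pos], fun x hx => ?_⟩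
  have hRp := h.radius_pos
  have hx0 : 0 < ‖x‖ := by linarith
  set n := ‖x‖ with hn
  refine ⟨(1 - t0 / n) • x, ?_, fun y hy => ?_⟩
  · rw [sub_smul, one_smul, sub_sub_cancel_left, norm_neg, norm_smul,
      Real.norm_of_nonneg (by positivity), ← hn, div_mul_cancel₀ _ hx0.ne']
  rw [Metric.mem_ball, dist_eq_norm] at hy
  set e := y - (1 - t0 / n) • x with he
  have hye : y = (1 - t0 / n) • x + e := by rw [he]; abel
  have hpn : ‖(1 - t0 / n) • x‖ = n - t0 := by
    have : 0 ≤ 1 - t0 / n := by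
      rw [sub_nonneg, div_le_one hx0]; linarith
    rw [norm_smul, Real.norm_of_nonneg this, ← hn]; field_simp
  have hyn : n - t0 - 1 ≤ ‖y‖ := by
    have := norm_sub_norm_le ((1 - t0 / n) • x) (-e)
    rw [norm_neg, sub_neg_eq_add, ← hye, hpn] at this
    linarith
  set y' := (1 + 1 / n) • y with hy'
  have h1 := hdec y (by linarith) (1 + 1 / n) (by
    have : 0 < 1 / n := by positivity
    linarith)
  have h2 : Real.exp (-(2 * ‖y‖ ^ ρ * (1 + 1 / n - 1))) ≤ 1 / 2 := by
    have h3 : 1 ≤ 2 * ‖y‖ ^ ρ * (1 + 1 / n - 1) := by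
      have h4 : ‖y‖ ≤ ‖y‖ ^ ρ := by
        simpa using Real.rpow_le_rpow_of_exponent_le (show 1 ≤ ‖y‖ by linarith) h.one_lt.le
      have h5 : 2 * ‖y‖ ^ ρ * (1 + 1 / n - 1) = 2 * ‖y‖ ^ ρ / n := by ring
      rw [h5, le_div_iff₀ hx0]
      linarith
    have h5 : Real.exp (-(2 * ‖y‖ ^ ρ * (1 + 1 / n - 1))) ≤ Real.exp (-1) :=
      Real.exp_le_exp.2 (by linarith)
    linarith [Real.exp_neg_one_lt_half]
  have h3 : π x ≤ π y' := by
    set μ := (1 + 1 / n) * (1 - t0 / n) with hμ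
    have hμ1 : 1 - μ ≥ (t0 - 1) / n := by
      have : 1 - μ = (t0 - 1) / n + t0 / n ^ 2 := by rw [hμ]; field_simp; ring
      rw [this]
      have : 0 ≤ t0 / n ^ 2 := by positivity
      linarith
    have ht1 : 0 < t0 - 1 := by rw [ht0]; simp; positivity
    have hμ2 : 1 / 2 ≤ μ := by
      have h6 : 1 / 2 ≤ 1 - t0 / n := by
        have : t0 / n ≤ 1 / 2 := by rw [div_le_iff₀ hx0]; linarith
        linarith
      have h7 : 1 ≤ 1 + 1 / n := by
        have : 0 < 1 / n := by positivity
        linarith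
      rw [hμ]; nlinarith
    have hμ3 : μ ≤ 1 := by
      have : 0 < (t0 - 1) / n := by positivity
      linarith
    have hμ0 : 0 < μ := by linarith
    have hy'e : y' = μ • x + (1 + 1 / n) • e := by
      rw [hy', hye, hμ, smul_add, smul_smul]
    have hinv : 1 / n ≤ 1 := by rw [div_le_one hx0]; linarith
    have hen : ‖(1 + 1 / n) • e‖ ≤ 2 := by
      rw [norm_smul, Real.norm_of_nonneg (by positivity)]
      nlinarith [norm_nonneg e]
    have hy'n : μ * n - 2 ≤ ‖y'‖ := by
      have := norm_sub_norm_le (μ • x) (-((1 + 1 / n) • e))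
      rw [norm_neg, sub_neg_eq_add, ← hy'e, norm_smul, Real.norm_of_nonneg hμ0.le, ← hn] at this
      linarith
    have hq : n / 4 ≤ ‖y'‖ := by nlinarith
    have hyy : ‖y‖ ≤ ‖y'‖ := by
      have : 0 < 1 / n := by positivity
      rw [hy', norm_smul, Real.norm_of_nonneg (by positivity)]
      nlinarith [norm_nonneg y]
    refine le_of_coneDecay h.diff hβ0.le h.beta_le h.cone (x := y') (l := 1 / μ)
      (by linarith) (by rw [le_div_iff₀ hμ0]; linarith) ?_
    have h8 : x - (1 / μ) • y' = -((1 / μ) • ((1 + 1 / n) • e)) := by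
      rw [hy'e, smul_add, smul_smul, one_div_mul_cancel hμ0.ne', one_smul]; abel
    rw [h8, norm_neg, norm_smul, Real.norm_of_nonneg (by positivity)]
    have h9 : 2 ≤ β * (1 - μ) * ‖y'‖ := by
      have : β * ((t0 - 1) / n) * (n / 4) ≤ β * (1 - μ) * ‖y'‖ := by gcongr
      refine le_trans ?_ this
      rw [ht0]; field_simp; norm_num
    calc 1 / μ * ‖(1 + 1 / n) • e‖ ≤ 1 / μ * (β * (1 - μ) * ‖y'‖) := by gcongr; linarith
      _ = β * (1 / μ - 1) * ‖y'‖ := by field_simp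
  have := h.pos y
  nlinarith

end Target

/-! ### From the limit hypotheses to pointwise geometric ones -/

section Hypotheses

variable {d : ℕ} {π : EuclideanSpace ℝ (Fin d) → ℝ}

theorem SuperExponentialRegular.exists_isTarget (h : SuperExponentialRegular π) :
    ∃ ρ β R, IsTarget π ρ β R := by
  obtain ⟨ρ, hρ, hlim⟩ := h.superExponential
  obtain ⟨R, hR, hreg⟩ := h.regularContours
  have hgrad : ∀ z v, inner ℝ (gradient π z) v = fderiv ℝ π z v := fun z v => by
    rw [gradient, InnerProductSpace.toDual_symm_apply]
  have hrad : RadialDecay π ρ := by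
    intro M
    have h1 := hlim.eventually (gt_mem_nhds (EReal.bot_lt_coe (-M)))
    obtain ⟨r, hr⟩ := eventually_atTop.1 h1
    refine ⟨max r 1, le_max_right _ _, fun z hz => ?_⟩
    have h2 := hr r le_rfl
    have hz0 : 0 < ‖z‖ := by linarith [le_max_right r 1]
    have h3 : ((inner ℝ ((‖z‖ ^ ρ)⁻¹ • z) (gradient (fun y => Real.log (π y)) z) : ℝ) : EReal)
        < ((-M : ℝ) : EReal) :=
      lt_of_le_of_lt (le_iSup₂ (f := fun (x : EuclideanSpace ℝ (Fin d)) (_ : r ≤ ‖x‖) =>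
        ((inner ℝ ((‖x‖ ^ ρ)⁻¹ • x) (gradient (fun y => Real.log (π y)) x) : ℝ) : EReal)) z
        ((le_max_left _ _).trans hz)) h2
    rw [EReal.coe_lt_coe_iff, real_inner_smul_left, real_inner_comm, gradient,
      InnerProductSpace.toDual_symm_apply, fderiv.log (h.differentiable z) (h.pos z).ne'] at h3
    have hp : 0 < ‖z‖ ^ ρ := Real.rpow_pos_of_pos hz0 _
    rw [smul_apply, smul_eq_mul, ← mul_assoc, ← mul_inv, ← div_eq_inv_mul,
      div_lt_iff₀ (mul_pos hp (h.pos z))] at h3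
    linarith
  -- A real q < 0 above the supremum gives the cone opening min(-q, 1): writing v = cz + (v - cz),
  -- the first part contributes at most cq‖z‖‖∇π‖ and the second at most -qc‖z‖‖∇π‖, so the sum is
  -- nonpositive.
  obtain ⟨q, hq1, hq2⟩ := EReal.lt_iff_exists_real_btwn.1 hreg
  have hq0 : q < 0 := by exact_mod_cast hq2
  refine ⟨ρ, min (-q) 1, R, h.pos, h.differentiable, hρ, hrad, lt_min (by linarith) one_pos,
    min_le_right _ _, hR, ?_⟩
  intro z hz v c hc hv
  have hz0 : 0 < ‖z‖ := by linarith
  have h3 : ((inner ℝ (‖z‖⁻¹ • z) (‖gradient π z‖⁻¹ • gradient π z) : ℝ) : EReal) < (q : EReal) :=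
    lt_of_le_of_lt (le_iSup₂ (f := fun (x : EuclideanSpace ℝ (Fin d)) (_ : R ≤ ‖x‖) =>
        ((inner ℝ (‖x‖⁻¹ • x) (‖gradient π x‖⁻¹ • gradient π x) : ℝ) : EReal)) z hz) hq1
  rw [EReal.coe_lt_coe_iff, real_inner_smul_left, real_inner_smul_right] at h3
  -- At a zero gradient the convention 0⁻¹ = 0 makes the inner product 0, which is not below q < 0.
  have hg0 : 0 < ‖gradient π z‖ := by
    rcases (norm_nonneg (gradient π z)).eq_or_lt with h0 | h0
    · rw [← h0] at h3; simp at h3; linarith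
    · exact h0
  rw [← mul_assoc, ← mul_inv, ← div_eq_inv_mul, div_lt_iff₀ (mul_pos hz0 hg0)] at h3
  rw [← hgrad]
  have h4 : inner ℝ (gradient π z) v
      = c * inner ℝ z (gradient π z) + inner ℝ (gradient π z) (v - c • z) := by
    rw [inner_sub_right, real_inner_smul_right, real_inner_comm z]; ring
  have h5 := real_inner_le_norm (gradient π z) (v - c • z)
  have h6 : ‖gradient π z‖ * ‖v - c • z‖ ≤ ‖gradient π z‖ * (-q * c * ‖z‖) := by
    gcongr
    exact hv.trans (by gcongr; exact min_le_left _ _)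
  have h7 : c * inner ℝ z (gradient π z) ≤ c * (q * (‖z‖ * ‖gradient π z‖)) := by gcongr
  rw [h4]
  nlinarith

end Hypotheses

/-! ### Dilation argument: thin shells carry little mass -/

/-- Zeros before the first positive term contribute nothing; that term is at most c, and from then
on the sequence decays geometrically. The term -f n is kept in the bound so that the induction
telescopes. -/
theorem one_sub_mul_sum_le_of_decay {f : ℕ → ℝ} {θ c : ℝ} (hf0 : ∀ k, 0 ≤ f k)
    (hfc : ∀ k, f k ≤ c) {K : ℕ} (hstep : ∀ k < K, 0 < f k → 0 < f (k + 1) ∧ f (k + 1) ≤ θ * f k)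
    (n : ℕ) (hn : n ≤ K) :
    (f n = 0 ∧ ∑ k ∈ Finset.range n, f k = 0) ∨
      (0 < f n ∧ (1 - θ) * ∑ k ∈ Finset.range n, f k ≤ c - f n) := by
  induction n with
  | zero =>
    rcases (hf0 0).eq_or_lt with h | h
    · exact Or.inl ⟨h.symm, by simp⟩
    · exact Or.inr ⟨h, by simpa using hfc 0⟩
  | succ n ih =>
    rw [Finset.sum_range_succ]
    rcases ih (by omega) with ⟨h0, hs⟩ | ⟨h0, hs⟩
    · rw [h0, hs]
      rcases (hf0 (n + 1)).eq_or_lt with h | h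
      · exact Or.inl ⟨h.symm, by simp⟩
      · exact Or.inr ⟨h, by simpa using hfc (n + 1)⟩
    · obtain ⟨h1, h2⟩ := hstep n (by omega) h0
      exact Or.inr ⟨h1, by nlinarith⟩

theorem one_sub_mul_sum_le_of_decay_of_pos {f : ℕ → ℝ} {θ : ℝ} {K : ℕ}
    (hstep : ∀ k < K, 0 < f k → 0 < f (k + 1) ∧ f (k + 1) ≤ θ * f k) (h0 : 0 < f 0)
    (n : ℕ) (hn : n ≤ K) :
    0 < f n ∧ (1 - θ) * ∑ k ∈ Finset.range n, f k ≤ f 0 - f n := by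
  induction n with
  | zero => simpa using h0
  | succ n ih =>
    obtain ⟨h1, h2⟩ := ih (by omega)
    obtain ⟨h3, h4⟩ := hstep n (by omega) h1
    rw [Finset.sum_range_succ]
    exact ⟨h3, by nlinarith⟩

section Dilation

variable {E : Type*} [NormedAddCommGroup E] [InnerProductSpace ℝ E] [FiniteDimensional ℝ E]
  [MeasurableSpace E] [BorelSpace E]

/-- The mass that a density gives to a thin shell is small compared with the mass it gives to the
dilations of the shell. -/
theorem mul_setIntegral_le_of_dilation {w p : E → ℝ} {G : Set E} (hG : MeasurableSet G)
    (hw : Measurable w) (hw0 : ∀ y, 0 ≤ w y) (hw2 : ∀ y, w y ≤ 2)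
    (hp0 : ∀ y, 0 ≤ p y) (hp : Integrable p) {θ η c : ℝ} {K : ℕ}
    (hθ : θ < 1) (hη : 0 ≤ η) (hK : K * η ≤ 1) (hc : 0 ≤ c)
    (hstep : ∀ z : E, ∀ k < K, 0 < w ((1 + k * η : ℝ) • z) →
      0 < w ((1 + (k + 1 : ℕ) * η : ℝ) • z) ∧
        w ((1 + (k + 1 : ℕ) * η : ℝ) • z) ≤ θ * w ((1 + k * η : ℝ) • z))
    (hnear : ∀ z : E, ∀ k < K, (1 + k * η : ℝ) • z ∈ G → 0 < w ((1 + k * η : ℝ) • z) →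
      p ((1 + k * η : ℝ) • z) ≤ c * p z) :
    K * ∫ y in G, w y * p y ≤ 2 ^ Module.finrank ℝ E * c / (1 - θ) *
      (2 * (∫ y in {y | w y = 0}, p y) + ∫ y, w y * p y) := by
  have hA : MeasurableSet {y | w y = 0} := hw (measurableSet_singleton 0)
  have hwp : Integrable (fun y => w y * p y) := by
    refine hp.bdd_mul (c := 2) hw.aestronglyMeasurable (Eventually.of_forall fun y => ?_)
    rw [Real.norm_of_nonneg (hw0 y)]; exact hw2 y
  have hwk : ∀ k : ℕ, Integrable (fun z => w ((1 + k * η : ℝ) • z) * p z) := by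
    intro k
    refine hp.bdd_mul (c := 2) ?_ (Eventually.of_forall fun y => ?_)
    · exact (hw.comp (measurable_const_smul _)).aestronglyMeasurable
    · rw [Real.norm_of_nonneg (hw0 _)]; exact hw2 _
  -- Along the dilations of z the weights form a geometric series. It starts from w z when w z > 0;
  -- otherwise its first positive value is at most 2, and z itself lies in the zero set of w.
  have hsum : ∀ z, ∑ k ∈ Finset.range K, w ((1 + k * η : ℝ) • z)
      ≤ (1 - θ)⁻¹ * (2 * Set.indicator {y | w y = 0} 1 z + w z) := by
    intro z
    rw [← div_eq_inv_mul, le_div_iff₀ (by linarith), mul_comm]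
    by_cases hz : w z = 0
    · rw [Set.indicator_of_mem (by simpa using hz), hz]
      rcases one_sub_mul_sum_le_of_decay (f := fun k : ℕ => w ((1 + k * η : ℝ) • z))
        (fun k => hw0 _) (fun k => hw2 _) (hstep z) K le_rfl with ⟨h1, h2⟩ | ⟨h1, h2⟩
      · rw [h2]; simp
      · simp only [Pi.one_apply]; linarith
    · rw [Set.indicator_of_notMem (by simpa using hz)]
      have hz0 : 0 < w z := lt_of_le_of_ne (hw0 z) (Ne.symm hz)
      have := one_sub_mul_sum_le_of_decay_of_pos (f := fun k : ℕ => w ((1 + k * η : ℝ) • z))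
        (hstep z) (by simpa using hz0) K le_rfl
      have h2 := this.2
      have h1 := this.1
      simp only [Nat.cast_zero, zero_mul, add_zero, one_smul] at h2
      linarith
  -- Change of variables y = (1 + kη)z; the Jacobian is at most 2^dim because Kη ≤ 1, and p at the
  -- dilated point is compared with p z by `hnear`. Summing over k lets the left side be counted K
  -- times.
  have hk : ∀ k ∈ Finset.range K, ∫ y in G, w y * p y ≤
      2 ^ Module.finrank ℝ E * c * ∫ z, w ((1 + k * η : ℝ) • z) * p z := by
    intro k hk
    rw [Finset.mem_range] at hk
    have hl1 : 1 ≤ 1 + k * η := by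
      have : (0 : ℝ) ≤ k * η := by positivity
      linarith
    have hl2 : 1 + k * η ≤ 2 := by
      have : (k : ℝ) * η ≤ K * η := by gcongr
      linarith
    have h1 := Measure.integral_comp_smul (volume : Measure E)
      (fun y => G.indicator (fun y => w y * p y) y) (1 + k * η)
    rw [integral_indicator hG, abs_of_pos (by positivity), smul_eq_mul, eq_comm,
      inv_mul_eq_iff_eq_mul₀ (by positivity)] at h1
    rw [h1]
    have h2 : ∫ z, G.indicator (fun y => w y * p y) ((1 + k * η : ℝ) • z)
        ≤ c * ∫ z, w ((1 + k * η : ℝ) • z) * p z := by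
      rw [← integral_const_mul]
      refine integral_mono_of_nonneg (Eventually.of_forall fun z => ?_) ((hwk k).const_mul c)
        (Eventually.of_forall fun z => ?_)
      · exact Set.indicator_nonneg (fun y _ => mul_nonneg (hw0 y) (hp0 y)) _
      · by_cases hz : (1 + k * η : ℝ) • z ∈ G
        · simp only [Set.indicator_of_mem hz]
          rcases (hw0 ((1 + k * η : ℝ) • z)).eq_or_lt with h0 | h0
          · simp [← h0]
          · have := hnear z k hk hz h0
            nlinarith
        · simp only [Set.indicator_of_notMem hz]
          exact mul_nonneg hc (mul_nonneg (hw0 _) (hp0 _))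
    have h3 : 0 ≤ c * ∫ z, w ((1 + k * η : ℝ) • z) * p z :=
      mul_nonneg hc (integral_nonneg fun z => mul_nonneg (hw0 _) (hp0 _))
    calc (1 + k * η) ^ Module.finrank ℝ E * ∫ z, G.indicator (fun y => w y * p y) ((1 + k * η : ℝ) • z)
        ≤ (1 + k * η) ^ Module.finrank ℝ E * (c * ∫ z, w ((1 + k * η : ℝ) • z) * p z) := by gcongr
      _ ≤ 2 ^ Module.finrank ℝ E * (c * ∫ z, w ((1 + k * η : ℝ) • z) * p z) := by gcongr
      _ = _ := by ring
  have hS := Finset.sum_le_sum hk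
  rw [Finset.sum_const, Finset.card_range, nsmul_eq_mul, ← Finset.mul_sum,
    ← integral_finsetSum _ (fun k _ => hwk k)] at hS
  refine hS.trans ?_
  rw [div_eq_mul_inv, mul_assoc (2 ^ Module.finrank ℝ E * c)]
  refine mul_le_mul_of_nonneg_left ?_ (by positivity)
  rw [← integral_indicator hA, ← integral_const_mul 2, ← integral_add ?_ hwp, ← integral_const_mul]
  · refine integral_mono (integrable_finsetSum _ fun k _ => hwk k) ?_ fun z => ?_
    · exact (((hp.indicator hA).const_mul 2).add hwp).const_mul _
    · simp only
      rw [← Finset.sum_mul]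
      have := mul_le_mul_of_nonneg_right (hsum z) (hp0 z)
      refine this.trans (le_of_eq ?_)
      by_cases hz : w z = 0
      · rw [Set.indicator_of_mem (by simpa using hz), Set.indicator_of_mem (by simpa using hz)]
        simp; ring
      · rw [Set.indicator_of_notMem (by simpa using hz), Set.indicator_of_notMem (by simpa using hz)]
        simp; ring
  · exact (hp.indicator hA).const_mul 2

end Dilation

/-! ### The loss weight -/

/-- Weight of the moves which may increase the Lyapunov function. -/
noncomputable def lossWeight {E : Type*} (π : E → ℝ) (s : ℝ) (x y : E) : ℝ :=
  if π y < 2 * π x then (π y / π x) ^ (1 - s) else 0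

section LossWeight

variable {E : Type*} {π : E → ℝ} {s : ℝ}

theorem lossWeight_nonneg (hpos : ∀ x, 0 < π x) (x y : E) : 0 ≤ lossWeight π s x y := by
  unfold lossWeight
  split_ifs
  · exact Real.rpow_nonneg (div_pos (hpos y) (hpos x)).le _
  · exact le_rfl

theorem lossWeight_pos_iff (hpos : ∀ x, 0 < π x) {x y : E} :
    0 < lossWeight π s x y ↔ π y < 2 * π x := by
  unfold lossWeight
  split_ifs with h
  · simpa [h] using Real.rpow_pos_of_pos (div_pos (hpos y) (hpos x)) _
  · simpa using h

theorem lossWeight_eq_zero_iff (hpos : ∀ x, 0 < π x) {x y : E} :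
    lossWeight π s x y = 0 ↔ 2 * π x ≤ π y := by
  rw [← not_lt, ← lossWeight_pos_iff (s := s) hpos, not_lt]
  exact ⟨fun h => h.le, fun h => le_antisymm h (lossWeight_nonneg hpos x y)⟩

theorem lossWeight_le_two (hpos : ∀ x, 0 < π x) (hs0 : 0 < s) (hs1 : s < 1) (x y : E) :
    lossWeight π s x y ≤ 2 := by
  unfold lossWeight
  split_ifs with h
  · calc (π y / π x) ^ (1 - s) ≤ (2 : ℝ) ^ (1 - s) := by
          apply Real.rpow_le_rpow (div_pos (hpos y) (hpos x)).le _ (by linarith)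
          rw [div_le_iff₀ (hpos x)]; exact h.le
      _ ≤ 2 ^ (1 : ℝ) := Real.rpow_le_rpow_of_exponent_le one_le_two (by linarith)
      _ = 2 := by simp
  · norm_num

/-- A drop a of log π scales the weight by exp(-(1-s)a); since the level can only go down, y stays
on the side π(y) < 2π(x) where the weight is positive. -/
theorem lossWeight_le_of_le (hpos : ∀ x, 0 < π x) (hs1 : s < 1) {x y y' : E} {a : ℝ}
    (hy : 0 < lossWeight π s x y') (h : π y ≤ π y' * Real.exp (-a)) (ha : 0 ≤ a) :
    0 < lossWeight π s x y ∧
      lossWeight π s x y ≤ Real.exp (-((1 - s) * a)) * lossWeight π s x y' := by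
  rw [lossWeight_pos_iff hpos] at hy
  have h1 : π y ≤ π y' := h.trans (mul_le_of_le_one_right (hpos _).le
    (Real.exp_le_one_iff.2 (by linarith)))
  have hy2 : π y < 2 * π x := h1.trans_lt hy
  refine ⟨(lossWeight_pos_iff hpos).2 hy2, ?_⟩
  unfold lossWeight
  rw [if_pos hy, if_pos hy2]
  calc (π y / π x) ^ (1 - s) ≤ (Real.exp (-a) * (π y' / π x)) ^ (1 - s) := by
        apply Real.rpow_le_rpow (div_pos (hpos y) (hpos x)).le _ (by linarith)
        rw [← mul_div_assoc, mul_comm (Real.exp _)]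
        exact div_le_div_of_nonneg_right h (hpos x).le
    _ = _ := by
        rw [Real.mul_rpow (Real.exp_pos _).le (div_pos (hpos y') (hpos x)).le, ← Real.exp_mul]
        congr 2; ring

theorem measurable_lossWeight [MeasurableSpace E] (hm : Measurable π) (x : E) :
    Measurable (lossWeight π s x) := by
  unfold lossWeight
  refine Measurable.ite (measurableSet_lt hm measurable_const) ?_ measurable_const
  fun_prop

end LossWeight

/-- Moving by δ in the metric of T changes the squared norm by at most 2Dδ + δ² ≤ 2, hence the
Gaussian exponent by at most 1. -/
theorem exp_neg_sq_norm_le {E : Type*} [NormedAddCommGroup E] [NormedSpace ℝ E]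
    (T : E →L[ℝ] E) {x y z : E} {N D δ : ℝ} (hN : 0 ≤ N)
    (hδ0 : 0 ≤ δ) (hD : 1 ≤ D) (hDδ : D * δ ≤ 1 / 2) (hy : ‖T (y - x)‖ ≤ D)
    (hz : ‖T (z - y)‖ ≤ δ) :
    N * Real.exp (-‖T (y - x)‖ ^ 2 / 2) ≤
      Real.exp 1 * (N * Real.exp (-‖T (z - x)‖ ^ 2 / 2)) := by
  have hδ1 : δ ≤ 1 / 2 := by nlinarith
  have h6 : ‖T (z - x)‖ ≤ ‖T (y - x)‖ + δ := by
    have : z - x = (y - x) + (z - y) := by abel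
    rw [this, map_add]
    exact (norm_add_le _ _).trans (by gcongr)
  have h7 : ‖T (z - x)‖ ^ 2 ≤ ‖T (y - x)‖ ^ 2 + 2 := by
    have h9 := norm_nonneg (T (y - x))
    have h10 : ‖T (y - x)‖ * δ ≤ D * δ := by gcongr
    have h11 : ‖T (z - x)‖ ^ 2 ≤ (‖T (y - x)‖ + δ) ^ 2 := by gcongr
    nlinarith
  calc N * Real.exp (-‖T (y - x)‖ ^ 2 / 2) ≤ N * Real.exp (1 + -‖T (z - x)‖ ^ 2 / 2) := by
        gcongr
        linarith
    _ = _ := by rw [Real.exp_add]; ring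

/-! ### The expected loss is negligible, dimension at least two -/

section Loss

variable {E : Type*} [NormedAddCommGroup E] [InnerProductSpace ℝ E] [FiniteDimensional ℝ E]
  [MeasurableSpace E] [BorelSpace E]

theorem integrable_exp_neg_mul_norm {b : ℝ} (hb : 0 < b) :
    Integrable (fun y : E => Real.exp (-(b * ‖y‖))) := by
  set r : ℝ := Module.finrank ℝ E + 1 with hr
  have hlim : Tendsto (fun t : ℝ => t ^ r * Real.exp (-b * t)) atTop (𝓝 0) :=
    tendsto_rpow_mul_exp_neg_mul_atTop_nhds_zero r b hb
  obtain ⟨t0, ht0⟩ := eventually_atTop.1 (hlim.eventually (gt_mem_nhds one_pos))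
  set t1 := max t0 1
  have hle : ∀ t : ℝ, 0 ≤ t → Real.exp (-(b * t)) ≤
      (Real.exp b + (1 + t1) ^ r) * (1 + t) ^ (-r) := by
    intro t ht
    have h1 : 0 < (1 + t) ^ r := by positivity
    rw [Real.rpow_neg (by linarith), ← div_eq_mul_inv, le_div_iff₀ h1]
    rcases le_total t1 (1 + t) with h2 | h2
    · have h3 := ht0 (1 + t) ((le_max_left _ _).trans h2)
      have h4 : Real.exp (-(b * t)) = Real.exp b * Real.exp (-b * (1 + t)) := by
        rw [← Real.exp_add]; ring_nf
      have h5 : 0 ≤ (1 + t1) ^ r := by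
        have : 0 ≤ t1 := by linarith [le_max_right t0 1]
        positivity
      rw [h4]
      nlinarith [Real.exp_pos b]
    · have h3 : Real.exp (-(b * t)) ≤ 1 := Real.exp_le_one_iff.2 (by
        have := mul_nonneg hb.le ht; linarith)
      have h4 : (1 + t) ^ r ≤ (1 + t1) ^ r :=
        Real.rpow_le_rpow (by linarith) (by linarith) (by positivity)
      nlinarith [Real.exp_pos b]
  refine ((integrable_one_add_norm (μ := (volume : Measure E)) (r := r) (by rw [hr]; linarith)).const_mul
    (Real.exp b + (1 + t1) ^ r)).mono' (by fun_prop) (Eventually.of_forall fun y => ?_)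
  rw [Real.norm_of_nonneg (Real.exp_pos _).le]
  exact hle _ (norm_nonneg y)

theorem measurableSet_near (T : E →L[ℝ] E) (x : E) (D a : ℝ) :
    MeasurableSet {y : E | ‖T (y - x)‖ ≤ D ∧ ‖y‖ ≤ a} := by
  have h1 : Measurable fun y => ‖T (y - x)‖ := by fun_prop
  exact (measurableSet_le h1 measurable_const).inter
    (measurableSet_le measurable_norm measurable_const)

/-- First term: the Gaussian factor at T-distance r^((ρ-1)/2) against the volume of a ball of radius
of order r. Second term: the exponential tail of the loss weight beyond that ball. -/
theorem tendsto_farBound {ρ s c J : ℝ} (hρ : 1 < ρ) (hs1 : s < 1) (n : ℕ) :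
    Tendsto (fun r : ℝ => 2 * Real.exp (-(r ^ ((ρ - 1) / 2)) ^ 2 / 2) * (c * r ^ n) +
      Real.exp (-((1 - s) * r / 2)) * J) atTop (𝓝 0) := by
  have h1 : Tendsto (fun r : ℝ => r ^ (ρ - 1)) atTop atTop := tendsto_rpow_atTop (by linarith)
  have h2 := (tendsto_rpow_mul_exp_neg_mul_atTop_nhds_zero (n / (ρ - 1)) (1 / 2)
    (by norm_num)).comp h1
  have h3 : Tendsto (fun r : ℝ => 2 * Real.exp (-(r ^ ((ρ - 1) / 2)) ^ 2 / 2) * (c * r ^ n))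
      atTop (𝓝 0) := by
    have h4 := h2.const_mul (2 * c)
    rw [mul_zero] at h4
    refine h4.congr' ?_
    filter_upwards [eventually_gt_atTop 0] with r hr
    have h5 : (r ^ ((ρ - 1) / 2)) ^ 2 = r ^ (ρ - 1) := by
      rw [← Real.rpow_natCast, ← Real.rpow_mul hr.le]; congr 1; push_cast; ring
    have h6 : (r ^ (ρ - 1)) ^ (n / (ρ - 1)) = r ^ n := by
      rw [← Real.rpow_mul hr.le, mul_div_cancel₀ _ (by linarith), Real.rpow_natCast]
    simp only [Function.comp]
    rw [h5, h6]
    ring_nf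
  have h4 : Tendsto (fun r : ℝ => Real.exp (-((1 - s) * r / 2)) * J) atTop (𝓝 0) := by
    have h5 : Tendsto (fun r : ℝ => (1 - s) * r / 2) atTop atTop :=
      (tendsto_id.const_mul_atTop (by linarith : 0 < 1 - s)).atTop_div_const two_pos
    simpa using (Real.tendsto_exp_neg_atTop_nhds_zero.comp h5).mul_const J
  simpa using h3.add h4

variable {π : E → ℝ} {ρ β R : ℝ}

/-- Off the near region either ‖T(y-x)‖ is large and the Gaussian factor is tiny on a ball of
polynomial volume, or ‖y‖ > 2B‖x‖ and the weight itself is exponentially small and integrable.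
Neither bound uses anything about T, so the result is uniform over covariances. -/
theorem exists_setIntegral_compl_lossWeight_le (h : IsTarget π ρ β R)
    {s : ℝ} (hs0 : 0 < s) (hs1 : s < 1) {B R1 : ℝ} (hB : 1 ≤ B)
    (hcon : ∀ x : E, R1 ≤ ‖x‖ → ∀ y : E, B * ‖x‖ ≤ ‖y‖ → π y ≤ π x) {ε : ℝ} (hε : 0 < ε) :
    ∃ R' : ℝ, ∀ x : E, R' ≤ ‖x‖ → ∀ N : ℝ, 0 ≤ N → ∀ T : E →L[ℝ] E,
      ∫ y in {y | ‖T (y - x)‖ ≤ ‖x‖ ^ ((ρ - 1) / 2) ∧ ‖y‖ ≤ 2 * B * ‖x‖}ᶜ,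
        lossWeight π s x y * (N * Real.exp (-‖T (y - x)‖ ^ 2 / 2)) ≤ ε * N := by
  obtain ⟨R2, hR2, hdec⟩ := h.exists_exp_decay 1 zero_le_one
  set n := Module.finrank ℝ E
  set v := (volume : Measure E).real (Metric.closedBall 0 1) with hv
  have hJi : Integrable (fun y : E => Real.exp (-((1 - s) / 4 * ‖y‖))) :=
    integrable_exp_neg_mul_norm (by linarith)
  set J := ∫ y : E, Real.exp (-((1 - s) / 4 * ‖y‖))
  obtain ⟨r0, hr0⟩ := eventually_atTop.1 ((tendsto_farBound (s := s) (J := J)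
    (c := (2 * B) ^ n * v) h.one_lt hs1 n).eventually (gt_mem_nhds hε))
  refine ⟨max (max r0 R1) R2, fun x hx N hN T => ?_⟩
  have hxr0 : r0 ≤ ‖x‖ := (le_max_left _ _).trans ((le_max_left _ _).trans hx)
  have hxR1 : R1 ≤ ‖x‖ := (le_max_right _ _).trans ((le_max_left _ _).trans hx)
  have hxR2 : R2 ≤ ‖x‖ := (le_max_right _ _).trans hx
  have hfar := hr0 ‖x‖ hxr0
  set r := ‖x‖ with hr
  have hr1 : 1 ≤ r := hR2.trans hxR2
  have hr0' : 0 < r := by linarith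
  set D := r ^ ((ρ - 1) / 2)
  set G := {y : E | ‖T (y - x)‖ ≤ D ∧ ‖y‖ ≤ 2 * B * r} with hGdef
  have hG : MeasurableSet G := measurableSet_near T x D (2 * B * r)
  have hbound : ∀ y, Gᶜ.indicator (fun y => lossWeight π s x y *
      (N * Real.exp (-‖T (y - x)‖ ^ 2 / 2))) y ≤
      N * (2 * Real.exp (-D ^ 2 / 2) * (Metric.closedBall (0 : E) (2 * B * r)).indicator 1 y +
        Real.exp (-((1 - s) * r / 2)) * Real.exp (-((1 - s) / 4 * ‖y‖))) := by
    intro y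
    have hnn1 : 0 ≤ (Metric.closedBall (0 : E) (2 * B * r)).indicator (1 : E → ℝ) y :=
      Set.indicator_nonneg (fun _ _ => zero_le_one) y
    have hnn : 0 ≤ N * (2 * Real.exp (-D ^ 2 / 2) *
        (Metric.closedBall (0 : E) (2 * B * r)).indicator 1 y) := by positivity
    by_cases hyG : y ∈ Gᶜ
    · rw [Set.indicator_of_mem hyG]
      have hl2 := lossWeight_le_two (x := x) (y := y) h.pos hs0 hs1
      have hl0 := lossWeight_nonneg (s := s) h.pos x y
      by_cases hyn : ‖y‖ ≤ 2 * B * r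
      · have hT : D < ‖T (y - x)‖ := by
          by_contra hcon
          exact hyG ⟨not_lt.1 hcon, hyn⟩
        rw [Set.indicator_of_mem (by simpa using hyn)]
        have h1 : Real.exp (-‖T (y - x)‖ ^ 2 / 2) ≤ Real.exp (-D ^ 2 / 2) := by
          apply Real.exp_le_exp.2
          have : 0 ≤ D := by positivity
          nlinarith
        calc lossWeight π s x y * (N * Real.exp (-‖T (y - x)‖ ^ 2 / 2))
            ≤ 2 * (N * Real.exp (-D ^ 2 / 2)) := by gcongr
          _ = N * (2 * Real.exp (-D ^ 2 / 2) * 1) := by ring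
          _ ≤ _ := by
            gcongr
            simp only [Pi.one_apply, mul_one]
            have : 0 ≤ Real.exp (-((1 - s) * r / 2)) * Real.exp (-((1 - s) / 4 * ‖y‖)) := by
              positivity
            linarith
      · push Not at hyn
        have hy0 : 0 < ‖y‖ := lt_trans (by positivity) hyn
        have hBr : 0 < B * r := by positivity
        have h1 : lossWeight π s x y ≤
            Real.exp (-((1 - s) * r / 2)) * Real.exp (-((1 - s) / 4 * ‖y‖)) := by
          -- z is the point of norm B‖x‖ on the ray of y. The contour comparison gives π z ≤ π x,
          -- and radial decay from z out to y does the rest.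
          set z := (B * r / ‖y‖) • y with hz
          have hzn : ‖z‖ = B * r := by
            rw [hz, norm_smul, Real.norm_of_nonneg (by positivity), div_mul_cancel₀ _ hy0.ne']
          have hzx : π z ≤ π x := hcon x hxR1 z (by rw [hzn])
          have hyz : y = (‖y‖ / (B * r)) • z := by
            rw [hz, smul_smul, show ‖y‖ / (B * r) * (B * r / ‖y‖) = 1 by field_simp, one_smul]
          have h2 := hdec z (by rw [hzn]; nlinarith) (‖y‖ / (B * r)) (by
            rw [le_div_iff₀ hBr]; linarith)
          rw [← hyz, hzn] at h2
          have h3 : ‖y‖ / 2 ≤ 1 * (B * r) ^ ρ * (‖y‖ / (B * r) - 1) := by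
            have h4 : B * r ≤ (B * r) ^ ρ := by
              simpa using Real.rpow_le_rpow_of_exponent_le (show 1 ≤ B * r by nlinarith)
                h.one_lt.le
            have h5 : B * r * (‖y‖ / (B * r) - 1) = ‖y‖ - B * r := by field_simp
            have h6 : 0 ≤ ‖y‖ / (B * r) - 1 := by
              rw [sub_nonneg, le_div_iff₀ hBr]; linarith
            nlinarith
          have h4 : π y ≤ π x * Real.exp (-(‖y‖ / 2)) := by
            refine h2.trans ?_
            gcongr
            exact (h.pos x).le
          have h5 : 0 < lossWeight π s x x :=
            (lossWeight_pos_iff h.pos).2 (by linarith [h.pos x])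
          have h6 := (lossWeight_le_of_le h.pos hs1 h5 h4 (by positivity)).2
          have h7 : lossWeight π s x x = 1 := by
            unfold lossWeight
            rw [if_pos (by linarith [h.pos x]), div_self (h.pos x).ne', Real.one_rpow]
          rw [h7, mul_one] at h6
          refine h6.trans ?_
          rw [← Real.exp_add]
          apply Real.exp_le_exp.2
          have : (1 - s) * r ≤ (1 - s) * (‖y‖ / 2) :=
            mul_le_mul_of_nonneg_left (by nlinarith) (by linarith)
          linarith
        have h2 : Real.exp (-‖T (y - x)‖ ^ 2 / 2) ≤ 1 := Real.exp_le_one_iff.2 (by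
          have := sq_nonneg ‖T (y - x)‖; linarith)
        calc lossWeight π s x y * (N * Real.exp (-‖T (y - x)‖ ^ 2 / 2))
            ≤ (Real.exp (-((1 - s) * r / 2)) * Real.exp (-((1 - s) / 4 * ‖y‖))) * (N * 1) := by
              gcongr
          _ ≤ _ := by
              rw [mul_add]; linarith
    · rw [Set.indicator_of_notMem hyG]
      positivity
  have hci : Integrable ((Metric.closedBall (0 : E) (2 * B * r)).indicator (1 : E → ℝ)) :=
    (integrable_indicator_iff measurableSet_closedBall).2
      (integrableOn_const (measure_closedBall_lt_top.ne))
  rw [← integral_indicator hG.compl]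
  calc ∫ y, Gᶜ.indicator (fun y => lossWeight π s x y *
      (N * Real.exp (-‖T (y - x)‖ ^ 2 / 2))) y
      ≤ ∫ y, N * (2 * Real.exp (-D ^ 2 / 2) *
          (Metric.closedBall (0 : E) (2 * B * r)).indicator 1 y +
        Real.exp (-((1 - s) * r / 2)) * Real.exp (-((1 - s) / 4 * ‖y‖))) := by
        refine integral_mono_of_nonneg (Eventually.of_forall fun y => ?_)
          (((hci.const_mul _).add (hJi.const_mul _)).const_mul N) (Eventually.of_forall hbound)
        refine Set.indicator_nonneg (fun y _ => ?_) y
        exact mul_nonneg (lossWeight_nonneg h.pos x y) (by positivity)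
    _ = N * (2 * Real.exp (-D ^ 2 / 2) * ((2 * B) ^ n * v * r ^ n) +
          Real.exp (-((1 - s) * r / 2)) * J) := by
        rw [integral_const_mul, integral_add (hci.const_mul _) (hJi.const_mul _),
          integral_const_mul, integral_const_mul, integral_indicator_one measurableSet_closedBall]
        have : (volume : Measure E).real (Metric.closedBall 0 (2 * B * r)) =
            (2 * B) ^ n * v * r ^ n := by
          rw [measureReal_def, Measure.addHaar_closedBall' _ _ (by positivity), ENNReal.toReal_mul,
            ENNReal.toReal_ofReal (by positivity), ← measureReal_def, ← hv, mul_pow]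
          ring
        rw [this]
    _ ≤ ε * N := by
        rw [mul_comm ε]; gcongr

-- Dilations by 1 + jη with η = ‖x‖^(-ρ) and j < K are long enough for each to multiply the loss
-- weight by at most exp(-(1-s)), yet short enough that all K of them move points by only
-- O(‖x‖^(1-ρ)), a scale on which the Gaussian density in the near region changes by at most a
-- factor e. With K fixed and large, the near loss is a small multiple of the gain mass plus a small
-- multiple of the total loss, which is absorbed. Rank > 1 enters through the contour comparison
-- only.
set_option maxHeartbeats 800000 in
theorem exists_integral_lossWeight_le_of_one_lt_rank (h : IsTarget π ρ β R)
    (hdim : 1 < Module.rank ℝ E) {s : ℝ} (hs0 : 0 < s) (hs1 : s < 1) {k : ℝ} (hk : 0 ≤ k)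
    {ε : ℝ} (hε : 0 < ε) :
    ∃ R' : ℝ, ∀ x : E, R' ≤ ‖x‖ → ∀ N : ℝ, 0 ≤ N → ∀ T : E →L[ℝ] E, ‖T‖ ≤ k →
      Integrable (fun z => N * Real.exp (-‖T z‖ ^ 2 / 2)) →
      ∫ y, lossWeight π s x y * (N * Real.exp (-‖T (y - x)‖ ^ 2 / 2)) ≤
        ε * (∫ y in {y | 2 * π x ≤ π y}, N * Real.exp (-‖T (y - x)‖ ^ 2 / 2)) + ε * N := by
  obtain ⟨B, R1, hB, hR1, hcon⟩ := h.exists_contour hdim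
  obtain ⟨R2, hR2, hdec⟩ := h.exists_exp_decay (2 * B ^ ρ) (by positivity)
  obtain ⟨R3, hR3⟩ := exists_setIntegral_compl_lossWeight_le h hs0 hs1 hB
    (fun x hx => (hcon x hx).2) (half_pos hε)
  set θ := Real.exp (-((1 - s) * 1)) with hθ
  have hθ1 : θ < 1 := by rw [hθ, Real.exp_lt_one_iff]; linarith
  set C := 2 ^ Module.finrank ℝ E * Real.exp 1 / (1 - θ) with hC
  have hC0 : 0 < C := by
    have : 0 < 1 - θ := by linarith
    positivity
  -- From K(L - Lf) ≤ C(2A + L): K ≥ 2C absorbs the L on the right, and K ≥ 4C/ε makes the A term at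
  -- most εA/2 per half of L.
  obtain ⟨K, hK⟩ := exists_nat_ge (max (2 * C) (4 * C / ε))
  have hK1 : 2 * C ≤ K := (le_max_left _ _).trans hK
  have hK2 : 4 * C ≤ ε * K := by
    have := (le_max_right _ _).trans hK
    rw [div_le_iff₀ hε] at this
    linarith
  have e3 : ∀ᶠ r : ℝ in atTop, K * r ^ (-ρ) ≤ 1 := by
    have : Tendsto (fun r : ℝ => K * r ^ (-ρ)) atTop (𝓝 (K * 0)) :=
      (tendsto_rpow_neg_atTop (by linarith [h.one_lt])).const_mul _
    rw [mul_zero] at this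
    filter_upwards [this.eventually (gt_mem_nhds one_pos)] with r hr using hr.le
  have e5 : ∀ᶠ r : ℝ in atTop, (k * K * (2 * B)) * r ^ (-((ρ - 1) / 2)) ≤ 1 / 2 := by
    have : Tendsto (fun r : ℝ => (k * K * (2 * B)) * r ^ (-((ρ - 1) / 2))) atTop
        (𝓝 ((k * K * (2 * B)) * 0)) :=
      (tendsto_rpow_neg_atTop (by linarith [h.one_lt])).const_mul _
    rw [mul_zero] at this
    filter_upwards [this.eventually (gt_mem_nhds (show (0 : ℝ) < 1 / 2 by norm_num))]
      with r hr using hr.le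
  obtain ⟨R', hR'⟩ := eventually_atTop.1 (((e3.and e5).and (eventually_ge_atTop R1)).and
    ((eventually_ge_atTop (B * R2)).and (eventually_ge_atTop R3)))
  refine ⟨R', fun x hx N hN T hT hint => ?_⟩
  obtain ⟨⟨⟨h3, h5⟩, hxR1⟩, hxR2, hxR3⟩ := hR' ‖x‖ hx
  have hLf := hR3 x hxR3 N hN T
  set r := ‖x‖ with hr
  have hr1 : 1 ≤ r := hR1.trans hxR1
  have hr0 : 0 < r := by linarith
  set D := r ^ ((ρ - 1) / 2) with hD
  have hD1 : 1 ≤ D := Real.one_le_rpow hr1 (by linarith [h.one_lt])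
  set G := {y : E | ‖T (y - x)‖ ≤ D ∧ ‖y‖ ≤ 2 * B * r} with hGdef
  have hG : MeasurableSet G := measurableSet_near T x D (2 * B * r)
  set p : E → ℝ := fun y => N * Real.exp (-‖T (y - x)‖ ^ 2 / 2) with hp
  have hp0 : ∀ y, 0 ≤ p y := fun y => by rw [hp]; positivity
  have hpi : Integrable p := hint.comp_sub_right x
  have hwm := measurable_lossWeight (s := s) h.diff.continuous.measurable x
  have hwp : Integrable (fun y => lossWeight π s x y * p y) := by
    refine hpi.bdd_mul (c := 2) hwm.aestronglyMeasurable (Eventually.of_forall fun y => ?_)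
    rw [Real.norm_of_nonneg (lossWeight_nonneg h.pos x y)]; exact lossWeight_le_two h.pos hs0 hs1 x y
  set η := r ^ (-ρ) with hη
  have hη0 : 0 < η := by positivity
  have hout : ∀ y, 0 < lossWeight π s x y → r / B ≤ ‖y‖ := by
    intro y hy
    rw [lossWeight_pos_iff h.pos] at hy
    by_contra hlt
    have := (hcon x hxR1).1 y (not_le.1 hlt).le
    linarith
  have key := mul_setIntegral_le_of_dilation (w := lossWeight π s x) (p := p) (K := K)
    (c := Real.exp 1) hG hwm (lossWeight_nonneg h.pos x)
    (lossWeight_le_two h.pos hs0 hs1 x) hp0 hpi hθ1 hη0.le h3 (Real.exp_pos 1).le ?_ ?_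
  · have hset : {y | lossWeight π s x y = 0} = {y | 2 * π x ≤ π y} := by
      ext y; exact lossWeight_eq_zero_iff h.pos
    rw [hset] at key
    have hsplit := integral_add_compl hG hwp
    set A := ∫ y in {y | 2 * π x ≤ π y}, p y
    set L := ∫ y, lossWeight π s x y * p y
    set Ln := ∫ y in G, lossWeight π s x y * p y
    set Lf := ∫ y in Gᶜ, lossWeight π s x y * p y
    rw [← hC] at key
    have hA : 0 ≤ A := integral_nonneg hp0
    have hL : 0 ≤ L := integral_nonneg fun y => mul_nonneg (lossWeight_nonneg h.pos x y) (hp0 y)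
    have hKp : (0 : ℝ) < K := by linarith
    have h6 : K * (L / 2) ≤ K * (ε / 2 * A + ε / 2 * N) := by
      have : K * Ln = K * L - K * Lf := by rw [← hsplit]; ring
      have h7 : K * Lf ≤ K * (ε / 2 * N) := by gcongr
      nlinarith
    have := le_of_mul_le_mul_left h6 hKp
    linarith
  · intro z j hj hw
    have hlj : 1 ≤ 1 + j * η := by
      have : (0 : ℝ) ≤ j * η := by positivity
      linarith
    have hlj2 : 1 + j * η ≤ 2 := by
      have : (j : ℝ) * η ≤ K * η := by gcongr
      linarith
    have hn := hout _ hw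
    set y := (1 + j * η : ℝ) • z with hy
    have hyz : (1 + (j + 1 : ℕ) * η : ℝ) • z = (1 + η / (1 + j * η)) • y := by
      rw [hy, smul_smul]; congr 1; push_cast; field_simp; ring
    rw [hyz]
    have hR2y : R2 ≤ ‖y‖ := by
      refine le_trans ?_ hn
      rw [le_div_iff₀ (by linarith)]; linarith
    have h6 := hdec y hR2y (1 + η / (1 + j * η)) (by
      have : 0 ≤ η / (1 + j * η) := by positivity
      linarith)
    -- The decay constant 2B^ρ was chosen for this: ‖y‖ ≥ r/B wherever the weight is positive, η r^ρ
    -- = 1, and 1 + jη ≤ 2 costs the factor 2.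
    have h7 : (1 : ℝ) ≤ 2 * B ^ ρ * ‖y‖ ^ ρ * (1 + η / (1 + j * η) - 1) := by
      rw [add_sub_cancel_left]
      calc (1 : ℝ) = 2 * B ^ ρ * (r / B) ^ ρ * (η / 2) := by
            rw [Real.div_rpow hr0.le (by linarith), hη, Real.rpow_neg hr0.le]
            have : 0 < B ^ ρ := by positivity
            field_simp
        _ ≤ _ := by
            gcongr
            linarith [h.one_lt]
    refine lossWeight_le_of_le h.pos hs1 hw (h6.trans ?_) zero_le_one
    gcongr
    exact (h.pos y).le
  · intro z j hj hyG hw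
    have hlj : 1 ≤ 1 + j * η := by
      have : (0 : ℝ) ≤ j * η := by positivity
      linarith
    set y := (1 + j * η : ℝ) • z with hy
    have hzy : ‖z‖ ≤ ‖y‖ := by
      rw [hy, norm_smul, Real.norm_of_nonneg (by linarith)]
      nlinarith [norm_nonneg z]
    have hd : ‖z - y‖ ≤ K * η * (2 * B * r) := by
      have : z - y = -((j * η) • z) := by rw [hy, add_smul, one_smul]; abel
      rw [this, norm_neg, norm_smul, Real.norm_of_nonneg (by positivity)]
      have := hzy.trans hyG.2
      gcongr
    have hTd : ‖T (z - y)‖ ≤ k * (K * η * (2 * B * r)) :=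
      (T.le_opNorm _).trans (by gcongr)
    set δ := k * (K * η * (2 * B * r)) with hδ
    have hδ0 : 0 ≤ δ := by positivity
    -- D = r^((ρ-1)/2) against a displacement of order r^(1-ρ): the product is of order
    -- r^(-(ρ-1)/2).
    have hDδ : D * δ ≤ 1 / 2 := by
      refine le_trans (le_of_eq ?_) h5
      have h6 : D * (η * r) = r ^ (-((ρ - 1) / 2)) := by
        rw [hD, hη]
        nth_rewrite 3 [← Real.rpow_one r]
        rw [← Real.rpow_add hr0, ← Real.rpow_add hr0]
        congr 1; ring
      rw [← h6, hδ]; ring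
    exact exp_neg_sq_norm_le T hN hδ0 hD1 hDδ hyG.1 hTd

end Loss

/-! ### The expected loss in dimension one, and the two cases combined -/

section Drift

variable {E : Type*} [NormedAddCommGroup E] [InnerProductSpace ℝ E] [FiniteDimensional ℝ E]
  [MeasurableSpace E] [BorelSpace E] {π : E → ℝ} {ρ β R : ℝ}

/-- On a half-line no contour comparison is needed. Past the infimum a of the points with positive
weight, the weight is at most 2 up to some t1 within ε/4 of a, and from t1 on it decays
exponentially at a rate that can be taken as large as desired. -/
theorem exists_setIntegral_Ioi_lossWeight_le (h : IsTarget π ρ β R) {s : ℝ} (hs0 : 0 < s)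
    (hs1 : s < 1) {e : E} (he : ‖e‖ = 1) {ε : ℝ} (hε : 0 < ε) :
    ∃ R' : ℝ, ∀ x : E, R' ≤ ‖x‖ →
      IntegrableOn (fun t : ℝ => lossWeight π s x (t • e)) (Set.Ioi 0) ∧
        ∫ t in Set.Ioi (0 : ℝ), lossWeight π s x (t • e) ≤ ε := by
  set M := 4 / ((1 - s) * ε) with hM
  have h1s : 0 < 1 - s := by linarith
  have hM0 : 0 < M := by positivity
  obtain ⟨R1, hR1, hdec⟩ := h.exists_exp_decay M hM0.le
  obtain ⟨R2, hR2, hcen⟩ := h.exists_two_mul_le_of_norm_le R1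
  refine ⟨R2, fun x hx => ?_⟩
  set S : Set ℝ := {t | 0 < t ∧ 0 < lossWeight π s x (t • e)} with hS
  have hw0 := lossWeight_nonneg (s := s) h.pos x
  have hnorm : ∀ t : ℝ, 0 < t → ‖t • e‖ = t := fun t ht => by
    rw [norm_smul, he, mul_one, Real.norm_of_nonneg ht.le]
  have hlarge : ∀ t ∈ S, R1 < t := by
    rintro t ⟨ht, htw⟩
    rw [lossWeight_pos_iff h.pos] at htw
    by_contra hlt
    have := hcen x hx (t • e) (by rw [hnorm t ht]; exact not_lt.1 hlt)
    linarith
  have hmeas : Measurable (fun t : ℝ => lossWeight π s x (t • e)) :=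
    (measurable_lossWeight h.diff.continuous.measurable x).comp (by fun_prop)
  rcases S.eq_empty_or_nonempty with hemp | hne
  · have hz : Set.EqOn (fun t : ℝ => lossWeight π s x (t • e)) (fun _ => 0) (Set.Ioi 0) := by
      intro t ht
      have : t ∉ S := by rw [hemp]; simp
      have h2 : ¬ 0 < lossWeight π s x (t • e) := fun h3 => this ⟨ht, h3⟩
      exact le_antisymm (not_lt.1 h2) (hw0 _)
    refine ⟨(integrableOn_congr_fun hz measurableSet_Ioi).2 integrableOn_zero, ?_⟩
    rw [setIntegral_congr_fun measurableSet_Ioi hz]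
    simpa using hε.le
  · have hbdd : BddBelow S := ⟨0, fun t ht => ht.1.le⟩
    obtain ⟨t1, ht1S, ht1⟩ := exists_lt_of_csInf_lt hne
      (show sInf S < sInf S + ε / 4 by linarith)
    set a := sInf S with ha
    have ha1 : a ≤ t1 := csInf_le hbdd ht1S
    set b := (1 - s) * M with hb
    have hb0 : 0 < b := by positivity
    set g : ℝ → ℝ := fun t => 2 * (Set.Icc a t1).indicator 1 t +
      (Set.Ioi t1).indicator (fun t => 2 * (Real.exp (b * t1) * Real.exp (-b * t))) t with hg
    have hexp : IntegrableOn (fun t : ℝ => 2 * (Real.exp (b * t1) * Real.exp (-b * t)))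
        (Set.Ioi t1) :=
      ((integrableOn_exp_mul_Ioi (by linarith : -b < 0) t1).const_mul _).const_mul _
    have hci : Integrable ((Set.Icc a t1).indicator (1 : ℝ → ℝ)) :=
      (integrable_indicator_iff measurableSet_Icc).2 (integrableOn_const (measure_Icc_lt_top.ne))
    have hg2 : Integrable ((Set.Ioi t1).indicator
        (fun t => 2 * (Real.exp (b * t1) * Real.exp (-b * t)))) :=
      (integrable_indicator_iff measurableSet_Ioi).2 hexp
    have hgi : Integrable g := (hci.const_mul 2).add hg2
    have hg0 : ∀ t, 0 ≤ g t := fun t => by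
      have h1 : 0 ≤ (Set.Icc a t1).indicator (1 : ℝ → ℝ) t :=
        Set.indicator_nonneg (fun _ _ => zero_le_one) t
      have h2 : 0 ≤ (Set.Ioi t1).indicator
          (fun t => 2 * (Real.exp (b * t1) * Real.exp (-b * t))) t :=
        Set.indicator_nonneg (fun _ _ => by positivity) t
      simp only [hg]; positivity
    have hgint : ∫ t, g t ≤ ε := by
      rw [hg, integral_add (hci.const_mul 2) hg2, integral_const_mul,
        integral_indicator_one measurableSet_Icc, integral_indicator measurableSet_Ioi,
        integral_const_mul, integral_const_mul, integral_exp_mul_Ioi (by linarith : -b < 0),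
        Real.volume_real_Icc_of_le ha1]
      have h1 : Real.exp (b * t1) * (-Real.exp (-b * t1) / -b) = 1 / b := by
        rw [neg_div_neg_eq, mul_div_assoc', ← Real.exp_add]; simp
      have h2 : 2 * (1 / b) = ε / 2 := by rw [hb, hM]; field_simp; norm_num
      rw [h1, h2]
      linarith
    have hle : ∀ t ∈ Set.Ioi (0 : ℝ), lossWeight π s x (t • e) ≤ g t := by
      intro t ht
      by_cases htS : t ∈ S
      · have hat : a ≤ t := csInf_le hbdd htS
        rcases le_or_gt t t1 with h1 | h1
        · have h2 : t ∈ Set.Icc a t1 := ⟨hat, h1⟩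
          simp only [hg]
          rw [Set.indicator_of_mem h2, Set.indicator_of_notMem (by simpa using h1)]
          simpa using lossWeight_le_two h.pos hs0 hs1 x _
        · have h2 : t ∉ Set.Icc a t1 := fun h3 => by linarith [h3.2]
          simp only [hg]
          rw [Set.indicator_of_notMem h2, Set.indicator_of_mem (by simpa using h1)]
          have ht10 : 0 < t1 := ht1S.1
          have h3 := hdec (t1 • e) (by rw [hnorm t1 ht10]; exact (hlarge t1 ht1S).le) (t / t1)
            (by rw [le_div_iff₀ ht10]; linarith)
          rw [smul_smul, div_mul_cancel₀ _ ht10.ne', hnorm t1 ht10] at h3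
          have h4 : M * (t - t1) ≤ M * t1 ^ ρ * (t / t1 - 1) := by
            have h5 : t1 ≤ t1 ^ ρ := by
              simpa using Real.rpow_le_rpow_of_exponent_le
                (show 1 ≤ t1 by linarith [hlarge t1 ht1S]) h.one_lt.le
            have h6 : t1 * (t / t1 - 1) = t - t1 := by field_simp
            have h7 : 0 ≤ t / t1 - 1 := by
              rw [sub_nonneg, le_div_iff₀ ht10]; linarith
            rw [← h6, mul_assoc]
            gcongr
          have h5 : π (t • e) ≤ π (t1 • e) * Real.exp (-(M * (t - t1))) := by
            refine h3.trans ?_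
            gcongr
            exact (h.pos _).le
          have h6 := (lossWeight_le_of_le h.pos hs1 ht1S.2 h5
            (mul_nonneg hM0.le (by linarith))).2
          have h7 := lossWeight_le_two (x := x) (y := t1 • e) h.pos hs0 hs1
          have h8 : Real.exp (-((1 - s) * (M * (t - t1)))) =
              Real.exp (b * t1) * Real.exp (-b * t) := by
            rw [← Real.exp_add, hb]; ring_nf
          rw [h8] at h6
          have h9 : 0 < Real.exp (b * t1) * Real.exp (-b * t) := by positivity
          nlinarith
      · have h2 : ¬ 0 < lossWeight π s x (t • e) := fun h3 => htS ⟨ht, h3⟩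
        exact (not_lt.1 h2).trans (hg0 t)
    have hwi : IntegrableOn (fun t : ℝ => lossWeight π s x (t • e)) (Set.Ioi 0) := by
      refine Integrable.mono' hgi.integrableOn hmeas.aestronglyMeasurable ?_
      refine (ae_restrict_iff' measurableSet_Ioi).2 (Eventually.of_forall fun t ht => ?_)
      rw [Real.norm_of_nonneg (hw0 _)]
      exact hle t ht
    refine ⟨hwi, ?_⟩
    calc ∫ t in Set.Ioi (0 : ℝ), lossWeight π s x (t • e) ≤ ∫ t in Set.Ioi (0 : ℝ), g t :=
          setIntegral_mono_on hwi hgi.integrableOn measurableSet_Ioi hle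
      _ ≤ ∫ t, g t := setIntegral_le_integral hgi (Eventually.of_forall hg0)
      _ ≤ ε := hgint

theorem exists_integral_lossWeight_le_of_finrank_eq_one (h : IsTarget π ρ β R)
    (hdim : Module.finrank ℝ E = 1) {s : ℝ} (hs0 : 0 < s) (hs1 : s < 1) {ε : ℝ} (hε : 0 < ε) :
    ∃ R' : ℝ, ∀ x : E, R' ≤ ‖x‖ → Integrable (lossWeight π s x) ∧ ∫ y, lossWeight π s x y ≤ ε := by
  have : Nontrivial E := Module.nontrivial_of_finrank_pos (R := ℝ) (by omega)
  obtain ⟨e, he⟩ := exists_norm_eq E zero_le_one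
  obtain ⟨R1, hR1⟩ := exists_setIntegral_Ioi_lossWeight_le h hs0 hs1 he (half_pos hε)
  obtain ⟨R2, hR2⟩ := exists_setIntegral_Ioi_lossWeight_le h hs0 hs1
    (show ‖-e‖ = 1 by rwa [norm_neg]) (half_pos hε)
  let f : ℝ ≃ₗᵢ[ℝ] E := (LinearIsometry.toSpanSingleton ℝ E he).toLinearIsometryEquiv
    (by rw [hdim]; simp)
  have hf : ∀ t : ℝ, f t = t • e := fun t => by
    simp [f]
  refine ⟨max R1 R2, fun x hx => ?_⟩
  obtain ⟨hi1, hl1⟩ := hR1 x ((le_max_left _ _).trans hx)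
  obtain ⟨hi2, hl2⟩ := hR2 x ((le_max_right _ _).trans hx)
  have hmp := f.measurePreserving
  have hme : MeasurableEmbedding f := f.toHomeomorph.measurableEmbedding
  have hi3 : IntegrableOn (fun t : ℝ => lossWeight π s x (t • e)) (Set.Iic 0) := by
    rw [← integrableOn_Ici_iff_integrableOn_Ioi] at hi2
    have h2 := hi2.comp_neg
    simpa using h2
  have hint : Integrable (fun t : ℝ => lossWeight π s x (t • e)) := by
    rw [← integrableOn_univ, ← Set.Iic_union_Ioi (a := (0 : ℝ))]
    exact hi3.union hi1
  have hcomp : (fun t : ℝ => lossWeight π s x (t • e)) = lossWeight π s x ∘ f := by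
    ext t; simp [hf]
  constructor
  · rw [← hmp.integrable_comp_emb hme, ← hcomp]
    exact hint
  · rw [← hmp.integral_comp hme]
    have h1 := intervalIntegral.integral_Iic_add_Ioi hi3 hi1
    have h2 := integral_comp_neg_Ioi (0 : ℝ) (fun t : ℝ => lossWeight π s x (t • e))
    simp only [neg_smul, neg_zero] at h2
    simp only [smul_neg] at hl2
    rw [h2] at hl2
    simp only [hf]
    linarith

theorem exists_integral_lossWeight_le (h : IsTarget π ρ β R) (hdim : 1 ≤ Module.finrank ℝ E)
    {s : ℝ} (hs0 : 0 < s) (hs1 : s < 1) {k : ℝ} (hk : 0 ≤ k) {ε : ℝ} (hε : 0 < ε) :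
    ∃ R' : ℝ, ∀ x : E, R' ≤ ‖x‖ → ∀ N : ℝ, 0 ≤ N → ∀ T : E →L[ℝ] E, ‖T‖ ≤ k →
      Integrable (fun z => N * Real.exp (-‖T z‖ ^ 2 / 2)) →
      ∫ y, lossWeight π s x y * (N * Real.exp (-‖T (y - x)‖ ^ 2 / 2)) ≤
        ε * (∫ y in {y | 2 * π x ≤ π y}, N * Real.exp (-‖T (y - x)‖ ^ 2 / 2)) + ε * N := by
  rcases hdim.eq_or_lt with h1 | h1
  · obtain ⟨R', hR'⟩ := exists_integral_lossWeight_le_of_finrank_eq_one h h1.symm hs0 hs1 hε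
    refine ⟨R', fun x hx N hN T _ _ => ?_⟩
    obtain ⟨hi, hl⟩ := hR' x hx
    have h2 : ∫ y, lossWeight π s x y * (N * Real.exp (-‖T (y - x)‖ ^ 2 / 2)) ≤
        ∫ y, N * lossWeight π s x y := by
      refine integral_mono_of_nonneg (Eventually.of_forall fun y => ?_) (hi.const_mul N)
        (Eventually.of_forall fun y => ?_)
      · exact mul_nonneg (lossWeight_nonneg h.pos x y) (by positivity)
      · have h3 : Real.exp (-‖T (y - x)‖ ^ 2 / 2) ≤ 1 := Real.exp_le_one_iff.2 (by
          have := sq_nonneg ‖T (y - x)‖; linarith)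
        have h4 := lossWeight_nonneg (s := s) h.pos x y
        calc lossWeight π s x y * (N * Real.exp (-‖T (y - x)‖ ^ 2 / 2))
            ≤ lossWeight π s x y * (N * 1) := by gcongr
          _ = N * lossWeight π s x y := by ring
    rw [integral_const_mul] at h2
    have h3 : 0 ≤ ∫ y in {y | 2 * π x ≤ π y}, N * Real.exp (-‖T (y - x)‖ ^ 2 / 2) :=
      integral_nonneg fun y => by positivity
    nlinarith
  · refine exists_integral_lossWeight_le_of_one_lt_rank h ?_ hs0 hs1 hk hε
    rw [← Module.finrank_eq_rank]
    exact_mod_cast h1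

end Drift

/-! ### Pointwise inequalities for the acceptance step -/

section AcceptAlgebra

variable {E : Type*} {π : E → ℝ} {s c : ℝ}

/-- With u = π(y)/π(x) this is min(1, u) u^(-s) ≤ 1, true for u ≥ 1 and, since s < 1, for u ≤ 1. It
makes the Lyapunov function integrable after an accepted move, whatever the proposal. -/
theorem min_one_mul_rpow_le (hpos : ∀ x, 0 < π x) (hs0 : 0 < s) (hs1 : s < 1) (x y : E) :
    min 1 (π y / π x) * π y ^ (-s) ≤ π x ^ (-s) := by
  have hu : 0 < π y / π x := div_pos (hpos y) (hpos x)
  have hy : π y ^ (-s) = π x ^ (-s) * (π y / π x) ^ (-s) := by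
    rw [← Real.mul_rpow (hpos x).le hu.le, mul_div_cancel₀ _ (hpos x).ne']
  rw [hy, mul_left_comm]
  refine mul_le_of_le_one_right (Real.rpow_nonneg (hpos x).le _) ?_
  rcases le_total 1 (π y / π x) with h | h
  · rw [min_eq_left h, one_mul]
    exact Real.rpow_le_one_of_one_le_of_nonpos h (by linarith)
  · rw [min_eq_right h]
    nth_rewrite 1 [← Real.rpow_one (π y / π x)]
    rw [← Real.rpow_add hu]
    exact Real.rpow_le_one hu.le h (by linarith)

theorem abs_min_one_mul_sub_le (hpos : ∀ x, 0 < π x) (hs0 : 0 < s) (hs1 : s < 1) (hc : 0 ≤ c)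
    (x y : E) :
    |min 1 (π y / π x) * (π y ^ (-s) * c - π x ^ (-s) * c)| ≤ π x ^ (-s) * c := by
  have h1 := mul_le_mul_of_nonneg_right (min_one_mul_rpow_le hpos hs0 hs1 x y) hc
  have h0 : 0 ≤ min 1 (π y / π x) := le_min zero_le_one (div_pos (hpos y) (hpos x)).le
  have h2 : min 1 (π y / π x) ≤ 1 := min_le_left _ _
  have h3 : 0 ≤ π y ^ (-s) * c := mul_nonneg (Real.rpow_nonneg (hpos y).le _) hc
  have h4 : 0 ≤ π x ^ (-s) * c := mul_nonneg (Real.rpow_nonneg (hpos x).le _) hc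
  rw [abs_le]
  constructor <;> nlinarith

/-- A move to at least twice the level is always accepted and multiplies the Lyapunov function by at
most 2^(-s); any other move costs at most min(1, u) u^(-s) ≤ u^(1-s), u being the ratio of levels.
-/
theorem min_one_mul_sub_le (hpos : ∀ x, 0 < π x) (hs0 : 0 < s) (hc : 0 ≤ c) (x y : E) :
    min 1 (π y / π x) * (π y ^ (-s) * c - π x ^ (-s) * c) ≤ π x ^ (-s) * c *
      (lossWeight π s x y - (1 - 2 ^ (-s)) * {y | 2 * π x ≤ π y}.indicator (fun _ => 1) y) := by
  have hu : 0 < π y / π x := div_pos (hpos y) (hpos x)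
  have hy : π y ^ (-s) = π x ^ (-s) * (π y / π x) ^ (-s) := by
    rw [← Real.mul_rpow (hpos x).le hu.le, mul_div_cancel₀ _ (hpos x).ne']
  have hV : 0 ≤ π x ^ (-s) * c := mul_nonneg (Real.rpow_nonneg (hpos x).le _) hc
  have h0 : min 1 (π y / π x) * (π y ^ (-s) * c - π x ^ (-s) * c) =
      π x ^ (-s) * c * (min 1 (π y / π x) * ((π y / π x) ^ (-s) - 1)) := by rw [hy]; ring
  rw [h0]
  refine mul_le_mul_of_nonneg_left ?_ hV
  by_cases h : 2 * π x ≤ π y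
  · have h1 : 2 ≤ π y / π x := by rw [le_div_iff₀ (hpos x)]; exact h
    rw [Set.indicator_of_mem (by simpa using h), (lossWeight_eq_zero_iff hpos).2 h,
      min_eq_left (by linarith)]
    have h2 : (π y / π x) ^ (-s) ≤ 2 ^ (-s) :=
      Real.rpow_le_rpow_of_nonpos two_pos h1 (by linarith)
    linarith
  · rw [Set.indicator_of_notMem (by simpa using h), lossWeight, if_pos (not_le.1 h), mul_zero,
      sub_zero]
    have h1 : min 1 (π y / π x) * (π y / π x) ^ (-s) ≤ (π y / π x) ^ (1 - s) := by
      rw [sub_eq_add_neg, Real.rpow_add hu, Real.rpow_one]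
      exact mul_le_mul_of_nonneg_right (min_le_right _ _) (Real.rpow_nonneg hu.le _)
    have h2 : 0 ≤ min 1 (π y / π x) := le_min zero_le_one hu.le
    linarith

end AcceptAlgebra

/-! ### Drift condition, uniform in the proposal -/

section Drift

variable {E : Type*} [NormedAddCommGroup E] [InnerProductSpace ℝ E] [FiniteDimensional ℝ E]
  [MeasurableSpace E] [BorelSpace E] {π : E → ℝ} {ρ β R : ℝ}

/-- Drift condition for random-walk Metropolis kernels with Gaussian proposals, uniformly over
proposal covariances that are bounded from below. -/
theorem IsTarget.exists_drift (h : IsTarget π ρ β R) (hdim : 1 ≤ Module.finrank ℝ E)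
    {s : ℝ} (hs0 : 0 < s) (hs1 : s < 1) {k : ℝ} (hk : 0 ≤ k) {v : ℝ} (hv : 0 ≤ v) :
    ∃ c b : ℝ, 0 < c ∧ 0 ≤ b ∧ ∀ N : ℝ, 0 ≤ N → ∀ T : E →L[ℝ] E, ‖T‖ ≤ k →
      Integrable (fun z => N * Real.exp (-‖T z‖ ^ 2 / 2)) →
      ∫ z, N * Real.exp (-‖T z‖ ^ 2 / 2) = 1 → c * N ≤ 1 ∧ ∀ x : E,
        ∫ y, min 1 (π y / π x) * (π y ^ (-s) * v - π x ^ (-s) * v) *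
          (N * Real.exp (-‖T (y - x)‖ ^ 2 / 2)) ≤ -(c * N) * (π x ^ (-s) * v) + b := by
  have hfin : Nontrivial E := Module.nontrivial_of_finrank_pos (R := ℝ) (by omega)
  obtain ⟨D, R1, hD, hR1, hball⟩ := h.exists_inner_ball
  set c2 : ℝ := 1 - 2 ^ (-s) with hc2
  have hc20 : 0 < c2 := by
    have : (2 : ℝ) ^ (-s) < 1 := Real.rpow_lt_one_of_one_lt_of_neg one_lt_two (by linarith)
    linarith
  have hc21 : c2 ≤ 1 := by
    have : (0 : ℝ) < 2 ^ (-s) := by positivity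
    linarith
  set vb := (volume : Measure E).real (Metric.ball 0 1) with hvb
  have hvb0 : 0 < vb :=
    ENNReal.toReal_pos (Metric.measure_ball_pos _ _ one_pos).ne' measure_ball_lt_top.ne
  set c3 := Real.exp (-(k * (D + 1)) ^ 2 / 2) * vb with hc3
  have hc30 : 0 < c3 := by positivity
  -- The gain is c2 A with A ≥ c3 N, and the loss at most εA + εN. This ε leaves a net gain of at
  -- least (3/4)c2c3N - (1/4)c2c3N = c2c3N/2.
  set ε := min (c2 / 4) (c2 * c3 / 4) with hε
  have hε0 : 0 < ε := lt_min (by positivity) (by positivity)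
  have hε1 : ε ≤ c2 / 4 := min_le_left _ _
  have hε2 : ε ≤ c2 * c3 / 4 := min_le_right _ _
  obtain ⟨R2, hR2⟩ := exists_integral_lossWeight_le h hdim hs0 hs1 hk hε0
  set r := max R1 R2 with hr
  have hVcont : Continuous fun x => π x ^ (-s) * v :=
    (h.diff.continuous.rpow_const (fun x => Or.inl (h.pos x).ne')).mul continuous_const
  obtain ⟨b0, hb0⟩ := ((isCompact_closedBall (0 : E) r).image hVcont).bddAbove
  have hb : ∀ x : E, ‖x‖ ≤ r → π x ^ (-s) * v ≤ b0 := fun x hx => hb0 ⟨x, by simpa using hx, rfl⟩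
  have hV0 : ∀ x, 0 ≤ π x ^ (-s) * v := fun x => mul_nonneg (Real.rpow_nonneg (h.pos x).le _) hv
  -- Twice the bound b0: inside the ball the increment is at most V ≤ b0, and the term -(cN)V on the
  -- right can be as low as -b0 since cN ≤ 1.
  refine ⟨c2 * c3 / 2, 2 * max b0 0, by positivity, by positivity, ?_⟩
  intro N hN T hT hint h1
  set p : E → E → ℝ := fun x y => N * Real.exp (-‖T (y - x)‖ ^ 2 / 2) with hp
  have hp0 : ∀ x y, 0 ≤ p x y := fun x y => by simp only [hp]; positivity
  have hpi : ∀ x, Integrable (p x) := fun x => hint.comp_sub_right x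
  have hp1 : ∀ x, ∫ y, p x y = 1 := fun x => by
    rw [← h1]; exact integral_sub_right_eq_self (fun z => N * Real.exp (-‖T z‖ ^ 2 / 2)) x
  have hAm : ∀ x, MeasurableSet {y | 2 * π x ≤ π y} := fun x =>
    measurableSet_le measurable_const h.diff.continuous.measurable
  have hA : ∀ x, R1 ≤ ‖x‖ → c3 * N ≤ ∫ y in {y | 2 * π x ≤ π y}, p x y := by
    intro x hx
    obtain ⟨q, hq, hqb⟩ := hball x hx
    calc c3 * N = ∫ y in Metric.ball q 1, N * Real.exp (-(k * (D + 1)) ^ 2 / 2) := by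
          rw [setIntegral_const, smul_eq_mul, measureReal_def, Measure.addHaar_ball_center,
            ← measureReal_def, ← hvb, hc3]
          ring
      _ ≤ ∫ y in Metric.ball q 1, p x y := by
          refine setIntegral_mono_on (integrableOn_const measure_ball_lt_top.ne)
            (hpi x).integrableOn measurableSet_ball fun y hy => ?_
          simp only [hp]
          rw [Metric.mem_ball, dist_eq_norm] at hy
          have h2 : ‖T (y - x)‖ ≤ k * (D + 1) := by
            have h3 : ‖y - x‖ ≤ D + 1 := by
              have : y - x = (q - x) + (y - q) := by abel
              rw [this]
              exact (norm_add_le _ _).trans (by linarith)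
            exact (T.le_opNorm _).trans (by gcongr)
          have h3 : ‖T (y - x)‖ ^ 2 ≤ (k * (D + 1)) ^ 2 := by gcongr
          gcongr
      _ ≤ _ := setIntegral_mono_set (hpi x).integrableOn (Eventually.of_forall (hp0 x))
          (Eventually.of_forall hqb)
  have hc3N : c3 * N ≤ 1 := by
    obtain ⟨x, hx⟩ := exists_norm_eq E (show (0 : ℝ) ≤ R1 by linarith)
    refine (hA x hx.ge).trans ?_
    rw [← hp1 x]
    exact setIntegral_le_integral (hpi x) (Eventually.of_forall (hp0 x))
  have hcN : c2 * c3 / 2 * N ≤ 1 := by nlinarith [mul_nonneg hc30.le hN]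
  refine ⟨hcN, fun x => ?_⟩
  have hint2 : Integrable fun y => min 1 (π y / π x) * (π y ^ (-s) * v - π x ^ (-s) * v) *
      p x y := by
    refine (hpi x).bdd_mul (c := π x ^ (-s) * v) ?_ (Eventually.of_forall fun y => ?_)
    · have hm := h.diff.continuous.measurable
      exact Measurable.aestronglyMeasurable (by fun_prop)
    · exact abs_min_one_mul_sub_le h.pos hs0 hs1 hv x y
  rcases le_or_gt ‖x‖ r with hx | hx
  · have h2 : ∫ y, min 1 (π y / π x) * (π y ^ (-s) * v - π x ^ (-s) * v) * p x y ≤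
        ∫ y, π x ^ (-s) * v * p x y := by
      refine integral_mono hint2 ((hpi x).const_mul _) fun y => ?_
      exact mul_le_mul_of_nonneg_right ((le_abs_self _).trans
        (abs_min_one_mul_sub_le h.pos hs0 hs1 hv x y)) (hp0 x y)
    rw [integral_const_mul, hp1, mul_one] at h2
    have h3 := hb x hx
    have h4 := le_max_left b0 0
    have h5 := mul_le_mul_of_nonneg_right hcN (hV0 x)
    linarith
  · have hx1 : R1 ≤ ‖x‖ := (le_max_left _ _).trans hx.le
    have hx2 : R2 ≤ ‖x‖ := (le_max_right _ _).trans hx.le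
    have hL := hR2 x hx2 N hN T hT hint
    have hAx := hA x hx1
    have hwp : Integrable (fun y => lossWeight π s x y * p x y) := by
      refine (hpi x).bdd_mul (c := 2)
        (measurable_lossWeight h.diff.continuous.measurable x).aestronglyMeasurable
        (Eventually.of_forall fun y => ?_)
      rw [Real.norm_of_nonneg (lossWeight_nonneg h.pos x y)]
      exact lossWeight_le_two h.pos hs0 hs1 x y
    have hAi : Integrable ({y | 2 * π x ≤ π y}.indicator (p x)) := (hpi x).indicator (hAm x)
    have h2 : ∫ y, min 1 (π y / π x) * (π y ^ (-s) * v - π x ^ (-s) * v) * p x y ≤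
        ∫ y, π x ^ (-s) * v * (lossWeight π s x y * p x y -
          c2 * {y | 2 * π x ≤ π y}.indicator (p x) y) := by
      refine integral_mono hint2 ((hwp.sub (hAi.const_mul _)).const_mul _) fun y => ?_
      have h3 := mul_le_mul_of_nonneg_right (min_one_mul_sub_le h.pos hs0 hv x y) (hp0 x y)
      refine h3.trans (le_of_eq ?_)
      by_cases hy : y ∈ {y | 2 * π x ≤ π y}
      · rw [Set.indicator_of_mem hy, Set.indicator_of_mem hy]; ring
      · rw [Set.indicator_of_notMem hy, Set.indicator_of_notMem hy]; ring
    rw [integral_const_mul, integral_sub hwp (hAi.const_mul _), integral_const_mul,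
      integral_indicator (hAm x)] at h2
    set A := ∫ y in {y | 2 * π x ≤ π y}, p x y
    have hA0 : 0 ≤ A := integral_nonneg (hp0 x)
    have h3 : (∫ y, lossWeight π s x y * p x y) - c2 * A ≤ -(c2 * c3 / 2 * N) := by
      have h4 : ε * A ≤ c2 / 4 * A := by gcongr
      have h5 : ε * N ≤ c2 * c3 / 4 * N := by gcongr
      have h6 : c2 * (c3 * N) ≤ c2 * A := by gcongr
      have h7 : ∫ y, lossWeight π s x y * p x y ≤ ε * A + ε * N := hL
      linarith
    have h4 := mul_le_mul_of_nonneg_left h3 (hV0 x)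
    have h5 : 0 ≤ max b0 0 := le_max_right _ _
    linarith

end Drift

/-! ### Density of the standard Gaussian -/

section StdGaussian

variable {E : Type*} [NormedAddCommGroup E] [InnerProductSpace ℝ E] [FiniteDimensional ℝ E]
  [MeasurableSpace E] [BorelSpace E]

theorem integrable_exp_neg_sq_norm_div_two :
    Integrable (fun z : E => Real.exp (-‖z‖ ^ 2 / 2)) := by
  have h := (GaussianFourier.integrable_cexp_neg_mul_sq_norm_add (V := E) (b := (1 / 2 : ℂ))
    (by norm_num) 0 0).re
  refine h.congr (Eventually.of_forall fun z => ?_)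
  simp only [zero_mul, add_zero]
  rw [show (-(1 / 2 : ℂ) * (‖z‖ : ℂ) ^ 2) = ((-‖z‖ ^ 2 / 2 : ℝ) : ℂ) by push_cast; ring]
  exact Complex.exp_ofReal_re _

theorem integral_exp_neg_sq_norm_pos : 0 < ∫ z : E, Real.exp (-‖z‖ ^ 2 / 2) := by
  refine (integral_pos_iff_support_of_nonneg (fun _ => (Real.exp_pos _).le)
    integrable_exp_neg_sq_norm_div_two).2 ?_
  have : Function.support (fun z : E => Real.exp (-‖z‖ ^ 2 / 2)) = Set.univ := by
    ext z; simp [(Real.exp_pos _).ne']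
  rw [this]
  exact Measure.measure_univ_pos.2 (NeZero.ne _)

/-- Both sides are finite measures with the same characteristic function. N is the inverse of the
unnormalized mass, whose explicit value is never needed. -/
theorem stdGaussian_eq_withDensity :
    ∃ N : ℝ, 0 < N ∧ stdGaussian E =
      (volume : Measure E).withDensity fun z => ENNReal.ofReal (N * Real.exp (-‖z‖ ^ 2 / 2)) := by
  set I := ∫ z : E, Real.exp (-‖z‖ ^ 2 / 2) with hI
  have hI0 : 0 < I := integral_exp_neg_sq_norm_pos
  have hint : Integrable fun z : E => I⁻¹ * Real.exp (-‖z‖ ^ 2 / 2) :=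
    integrable_exp_neg_sq_norm_div_two.const_mul _
  refine ⟨I⁻¹, by positivity, ?_⟩
  have hfin : IsFiniteMeasure ((volume : Measure E).withDensity fun z =>
      ENNReal.ofReal (I⁻¹ * Real.exp (-‖z‖ ^ 2 / 2))) :=
    isFiniteMeasure_withDensity_ofReal hint.2
  refine Measure.ext_of_charFun (funext fun t => ?_)
  rw [charFun_stdGaussian, charFun_apply, integral_withDensity_eq_integral_toReal_smul
    (by fun_prop) (Eventually.of_forall fun _ => ENNReal.ofReal_lt_top)]
  have h1 : ∀ z : E, (ENNReal.ofReal (I⁻¹ * Real.exp (-‖z‖ ^ 2 / 2))).toReal •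
      Complex.exp (inner ℝ z t * Complex.I) =
      (I⁻¹ : ℂ) * Complex.exp (-(1 / 2 : ℂ) * (‖z‖ : ℂ) ^ 2 + Complex.I * (inner ℝ t z : ℝ)) := by
    intro z
    rw [ENNReal.toReal_ofReal (by positivity), Complex.real_smul, Complex.ofReal_mul,
      Complex.ofReal_exp, mul_assoc, ← Complex.exp_add, real_inner_comm]
    push_cast
    congr 2
    ring
  have h2 : (I : ℂ) = ∫ z : E, Complex.exp (-(1 / 2 : ℂ) * (‖z‖ : ℂ) ^ 2) := by
    rw [hI, ← integral_complex_ofReal]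
    congr 1; ext z
    rw [Complex.ofReal_exp]
    congr 1; push_cast; ring
  rw [GaussianFourier.integral_cexp_neg_mul_sq_norm (by norm_num)] at h2
  simp_rw [h1]
  rw [integral_const_mul, GaussianFourier.integral_cexp_neg_mul_sq_norm_add (by norm_num), ← h2,
    ← mul_assoc, inv_mul_cancel₀ (by exact_mod_cast hI0.ne'), one_mul, Complex.I_sq]
  congr 1
  ring

end StdGaussian

/-! ### Gaussian densities with a general covariance -/

noncomputable section Gaussian

variable {d : ℕ}

local notation "𝔼" => EuclideanSpace ℝ (Fin d)

/-- The quadratic form of the inverse of a matrix. -/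
def invQuad (S : Matrix (Fin d) (Fin d) ℝ) (z : EuclideanSpace ℝ (Fin d)) : ℝ :=
  z.ofLp ⬝ᵥ S⁻¹.mulVec z.ofLp

/-- The unnormalized centred Gaussian density with covariance `S`. -/
def gaussKernel (S : Matrix (Fin d) (Fin d) ℝ) (z : EuclideanSpace ℝ (Fin d)) : ℝ :=
  Real.exp (-invQuad S z / 2)

/-- The normalization constant of the centred Gaussian density with covariance `S`. -/
def gaussMass (S : Matrix (Fin d) (Fin d) ℝ) : ℝ := ∫ z, gaussKernel S z

/-- The centred Gaussian density with covariance `S`. -/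
def gaussDensity (S : Matrix (Fin d) (Fin d) ℝ) (z : EuclideanSpace ℝ (Fin d)) : ℝ :=
  (gaussMass S)⁻¹ * gaussKernel S z

theorem gaussKernel_pos (S : Matrix (Fin d) (Fin d) ℝ) (z : 𝔼) : 0 < gaussKernel S z :=
  Real.exp_pos _

theorem invQuad_neg (S : Matrix (Fin d) (Fin d) ℝ) (z : 𝔼) : invQuad S (-z) = invQuad S z := by
  simp [invQuad, Matrix.mulVec_neg]

theorem gaussDensity_neg (S : Matrix (Fin d) (Fin d) ℝ) (z : 𝔼) :
    gaussDensity S (-z) = gaussDensity S z := by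
  simp [gaussDensity, gaussKernel, invQuad_neg]

/-- Cramer's formula: the form is det⁻¹ times a polynomial in the entries, hence measurable in the
matrix across the singular locus as well. -/
theorem measurable_invQuad :
    Measurable fun p : (Fin d → Fin d → ℝ) × 𝔼 => invQuad (Matrix.of p.1) p.2 := by
  have hdet : Continuous fun p : (Fin d → Fin d → ℝ) × 𝔼 => (Matrix.of p.1).det :=
    Continuous.matrix_det (by fun_prop)
  have hadj : Continuous fun p : (Fin d → Fin d → ℝ) × 𝔼 =>
      p.2.ofLp ⬝ᵥ (Matrix.of p.1).adjugate.mulVec p.2.ofLp := by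
    have h1 : Continuous fun p : (Fin d → Fin d → ℝ) × 𝔼 => (Matrix.of p.1).adjugate :=
      Continuous.matrix_adjugate (by fun_prop)
    have h2 : Continuous fun p : (Fin d → Fin d → ℝ) × 𝔼 => p.2.ofLp := by fun_prop
    exact h2.dotProduct (h1.matrix_mulVec h2)
  have : (fun p : (Fin d → Fin d → ℝ) × 𝔼 => invQuad (Matrix.of p.1) p.2) =
      fun p => ((Matrix.of p.1).det)⁻¹ *
        (p.2.ofLp ⬝ᵥ (Matrix.of p.1).adjugate.mulVec p.2.ofLp) := by
    ext p
    rw [invQuad, Matrix.inv_def, Ring.inverse_eq_inv', Matrix.smul_mulVec, dotProduct_smul,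
      smul_eq_mul]
  rw [this]
  exact (hdet.measurable.inv).mul hadj.measurable

theorem measurable_gaussKernel :
    Measurable fun p : (Fin d → Fin d → ℝ) × 𝔼 => gaussKernel (Matrix.of p.1) p.2 := by
  unfold gaussKernel
  exact Real.measurable_exp.comp (measurable_invQuad.neg.div_const 2)

theorem measurable_gaussDensity :
    Measurable fun p : (Fin d → Fin d → ℝ) × 𝔼 => gaussDensity (Matrix.of p.1) p.2 := by
  unfold gaussDensity gaussMass
  have h : StronglyMeasurable fun A : Fin d → Fin d → ℝ =>
      ∫ z : 𝔼, gaussKernel (Matrix.of A) z :=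
    measurable_gaussKernel.stronglyMeasurable.integral_prod_right
  exact ((h.measurable.comp measurable_fst).inv).mul measurable_gaussKernel

/-- T is S^(-1/2) and A is S^(1/2), the map used to define the multivariate Gaussian as an affine
image of the standard one. -/
theorem exists_clm_norm_sq_eq_invQuad {S : Matrix (Fin d) (Fin d) ℝ} (hS : S.PosDef) :
    ∃ T A : 𝔼 →L[ℝ] 𝔼, (∀ z, invQuad S z = ‖T z‖ ^ 2) ∧ (∀ z, T (A z) = z) ∧
      (∀ z, A (T z) = z) ∧ ∀ x, multivariateGaussian x S =
        (stdGaussian 𝔼).map (fun z => x + A z) := by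
  open scoped MatrixOrder in
  set Q := CFC.sqrt S with hQ
  have hQQ : Q * Q = S := by
    open scoped MatrixOrder in
    exact CFC.sqrt_mul_sqrt_self S hS.posSemidef.nonneg
  have hQs : Q.IsSymm := by
    open scoped MatrixOrder in
    have h1 : Q.PosSemidef := Matrix.nonneg_iff_posSemidef.1 (CFC.sqrt_nonneg S)
    have h2 := h1.1
    rwa [Matrix.IsHermitian, Matrix.conjTranspose_eq_transpose_of_trivial] at h2
  have hSu : IsUnit S.det := hS.det_pos.ne'.isUnit
  have hQu : IsUnit Q.det := by
    rw [← hQQ, Matrix.det_mul] at hSu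
    exact isUnit_of_mul_isUnit_left hSu
  refine ⟨Matrix.toEuclideanCLM (𝕜 := ℝ) Q⁻¹, Matrix.toEuclideanCLM (𝕜 := ℝ) Q, fun z => ?_,
    fun z => ?_, fun z => ?_, fun x => rfl⟩
  · rw [← real_inner_self_eq_norm_sq, EuclideanSpace.inner_eq_star_dotProduct]
    simp only [star_trivial, Matrix.ofLp_toEuclideanCLM]
    rw [invQuad, ← hQQ, Matrix.mul_inv_rev, ← Matrix.mulVec_mulVec, Matrix.dotProduct_mulVec,
      ← Matrix.mulVec_transpose, Matrix.transpose_nonsing_inv, hQs.eq]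
  · rw [← mul_apply_eq_comp, ← map_mul, Matrix.nonsing_inv_mul _ hQu, map_one]; rfl
  · rw [← mul_apply_eq_comp, ← map_mul, Matrix.mul_nonsing_inv _ hQu, map_one]; rfl

theorem exists_multivariateGaussian_eq_withDensity {S : Matrix (Fin d) (Fin d) ℝ} (hS : S.PosDef) :
    ∃ N : ℝ, 0 < N ∧ ∀ x : 𝔼, multivariateGaussian x S =
      (volume : Measure 𝔼).withDensity fun y => ENNReal.ofReal (N * gaussKernel S (y - x)) := by
  obtain ⟨T, A, hT, hTA, hAT, hmap⟩ := exists_clm_norm_sq_eq_invQuad hS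
  obtain ⟨N, hN, hstd⟩ := stdGaussian_eq_withDensity (E := 𝔼)
  have hdet : LinearMap.det (A : 𝔼 →ₗ[ℝ] 𝔼) ≠ 0 := by
    have h1 : (T : 𝔼 →ₗ[ℝ] 𝔼) ∘ₗ (A : 𝔼 →ₗ[ℝ] 𝔼) = LinearMap.id := by
      ext z : 1; exact hTA z
    have h2 := congrArg LinearMap.det h1
    rw [LinearMap.det_comp, LinearMap.det_id] at h2
    exact right_ne_zero_of_mul_eq_one h2
  have hvol := Measure.map_linearMap_addHaar_eq_smul_addHaar (volume : Measure 𝔼) hdet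
  set a := |(LinearMap.det (A : 𝔼 →ₗ[ℝ] 𝔼))⁻¹| with ha
  have ha0 : 0 < a := abs_pos.2 (inv_ne_zero hdet)
  refine ⟨N * a, by positivity, fun x => ?_⟩
  have hvol2 : (volume : Measure 𝔼).map (fun z => x + A z) = ENNReal.ofReal a • volume := by
    have h1 : (fun z => x + A z) = (fun y => x + y) ∘ A := rfl
    have hvol : (volume : Measure 𝔼).map A = ENNReal.ofReal a • volume := hvol
    rw [h1, ← Measure.map_map (measurable_const_add x) A.continuous.measurable, hvol,
      Measure.map_smul, map_add_left_eq_self]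
  have hf : Measurable fun z => x + A z := by fun_prop
  ext B hB
  rw [hmap, Measure.map_apply hf hB, hstd, withDensity_apply _ (hf hB), withDensity_apply _ hB,
    ← lintegral_indicator (hf hB), ← lintegral_indicator hB]
  have hgm : Measurable fun y => ENNReal.ofReal (N * Real.exp (-‖T (y - x)‖ ^ 2 / 2)) := by
    fun_prop
  have h2 : ∫⁻ y, B.indicator (fun y => ENNReal.ofReal (N * Real.exp (-‖T (y - x)‖ ^ 2 / 2))) y
      ∂((volume : Measure 𝔼).map (fun z => x + A z)) =
      ∫⁻ z, B.indicator (fun y => ENNReal.ofReal (N * Real.exp (-‖T (y - x)‖ ^ 2 / 2)))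
        (x + A z) := lintegral_map (hgm.indicator hB) hf
  have h3 : ∀ z, ((fun z => x + A z) ⁻¹' B).indicator
      (fun z => ENNReal.ofReal (N * Real.exp (-‖z‖ ^ 2 / 2))) z =
      B.indicator (fun y => ENNReal.ofReal (N * Real.exp (-‖T (y - x)‖ ^ 2 / 2))) (x + A z) := by
    intro z
    by_cases hz : x + A z ∈ B
    · rw [Set.indicator_of_mem hz, Set.indicator_of_mem (by exact hz), add_sub_cancel_left, hTA]
    · rw [Set.indicator_of_notMem hz, Set.indicator_of_notMem (by exact hz)]
  simp_rw [h3]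
  rw [← h2, hvol2, lintegral_smul_measure, smul_eq_mul,
    ← lintegral_const_mul _ (hgm.indicator hB)]
  congr 1; ext y
  by_cases hy : y ∈ B
  · rw [Set.indicator_of_mem hy, Set.indicator_of_mem hy, ← ENNReal.ofReal_mul ha0.le, gaussKernel,
      hT]
    congr 1; ring_nf
  · rw [Set.indicator_of_notMem hy, Set.indicator_of_notMem hy, mul_zero]

end Gaussian

/-! ### Monotonicity in the covariance and total variation bounds -/

noncomputable section Gaussian

variable {d : ℕ} {S S' : Matrix (Fin d) (Fin d) ℝ}

local notation "𝔼" => EuclideanSpace ℝ (Fin d)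

theorem integrable_gaussKernel (hS : S.PosDef) : Integrable (gaussKernel S) := by
  obtain ⟨N, hN, hden⟩ := exists_multivariateGaussian_eq_withDensity hS
  have h0 := hden 0
  have h1 : (multivariateGaussian (0 : 𝔼) S) Set.univ = 1 := measure_univ
  rw [h0, withDensity_apply _ MeasurableSet.univ, Measure.restrict_univ] at h1
  simp only [sub_zero] at h1
  have hm : Measurable (gaussKernel S) := by
    have : Continuous (invQuad S) := by unfold invQuad; fun_prop
    exact Real.measurable_exp.comp (this.measurable.neg.div_const 2)
  have h2 : Integrable fun z => N * gaussKernel S z := by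
    refine ⟨(hm.const_mul N).aestronglyMeasurable, ?_⟩
    rw [hasFiniteIntegral_iff_ofReal (Eventually.of_forall fun z =>
      (mul_pos hN (gaussKernel_pos S z)).le), h1]
    exact ENNReal.one_lt_top
  have h3 := h2.const_mul N⁻¹
  simpa [← mul_assoc, inv_mul_cancel₀ hN.ne'] using h3

theorem gaussMass_pos (hS : S.PosDef) : 0 < gaussMass S := by
  refine (integral_pos_iff_support_of_nonneg (fun z => (gaussKernel_pos S z).le)
    (integrable_gaussKernel hS)).2 ?_
  have : Function.support (gaussKernel S) = Set.univ := by
    ext z; simp [(gaussKernel_pos S z).ne']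
  rw [this]
  exact Measure.measure_univ_pos.2 (NeZero.ne _)

theorem gaussDensity_pos (hS : S.PosDef) (z : 𝔼) : 0 < gaussDensity S z :=
  mul_pos (inv_pos.2 (gaussMass_pos hS)) (gaussKernel_pos S z)

theorem integrable_gaussDensity (hS : S.PosDef) : Integrable (gaussDensity S) :=
  (integrable_gaussKernel hS).const_mul _

theorem integral_gaussDensity (hS : S.PosDef) : ∫ z, gaussDensity S z = 1 := by
  unfold gaussDensity
  rw [integral_const_mul]
  exact inv_mul_cancel₀ (gaussMass_pos hS).ne'

theorem multivariateGaussian_eq_withDensity (hS : S.PosDef) (x : 𝔼) :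
    multivariateGaussian x S =
      (volume : Measure 𝔼).withDensity fun y => ENNReal.ofReal (gaussDensity S (y - x)) := by
  obtain ⟨N, hN, hden⟩ := exists_multivariateGaussian_eq_withDensity hS
  have h1 : (multivariateGaussian (0 : 𝔼) S) Set.univ = 1 := measure_univ
  rw [hden, withDensity_apply _ MeasurableSet.univ, Measure.restrict_univ] at h1
  simp only [sub_zero] at h1
  rw [← ofReal_integral_eq_lintegral_ofReal ((integrable_gaussKernel hS).const_mul N)
    (Eventually.of_forall fun z => (mul_pos hN (gaussKernel_pos S z)).le), integral_const_mul,
    ENNReal.ofReal_eq_one] at h1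
  have h2 : N = (gaussMass S)⁻¹ := eq_inv_of_mul_eq_one_left h1
  rw [hden x, h2]
  rfl

/-- Inversion is antitone for the Loewner order: with w = S'⁻¹z and u = S⁻¹z, expand 0 ≤
(w-u)ᵀS(w-u) and use wᵀSw ≤ wᵀS'w = zᵀw. -/
theorem dotProduct_inv_mulVec_le (hS : S.PosDef) (hle : (S' - S).PosSemidef)
    (z : 𝔼) : invQuad S' z ≤ invQuad S z := by
  have hS' : S'.PosDef := by
    have := hS.add_posSemidef hle
    rwa [add_sub_cancel] at this
  have hSs : S.transpose = S := by
    have := hS.1; rwa [Matrix.IsHermitian, Matrix.conjTranspose_eq_transpose_of_trivial] at this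
  have hu : IsUnit S.det := hS.det_pos.ne'.isUnit
  have hu' : IsUnit S'.det := hS'.det_pos.ne'.isUnit
  set a := z.ofLp with ha
  set w := S'⁻¹.mulVec a with hw
  set u := S⁻¹.mulVec a with hudef
  have h1 : S'.mulVec w = a := by
    rw [hw, Matrix.mulVec_mulVec, Matrix.mul_nonsing_inv _ hu', Matrix.one_mulVec]
  have h2 : S.mulVec u = a := by
    rw [hudef, Matrix.mulVec_mulVec, Matrix.mul_nonsing_inv _ hu, Matrix.one_mulVec]
  have h3 := hle.dotProduct_mulVec_nonneg w
  have h4 := hS.posSemidef.dotProduct_mulVec_nonneg (w - u)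
  simp only [star_trivial, Matrix.sub_mulVec, Matrix.mulVec_sub, dotProduct_sub, sub_dotProduct,
    h1, h2] at h3 h4
  have h5 : u ⬝ᵥ S.mulVec w = a ⬝ᵥ w := by
    rw [Matrix.dotProduct_mulVec, ← Matrix.mulVec_transpose, hSs, h2]
  rw [h5, dotProduct_comm w a, dotProduct_comm u a] at h4
  rw [dotProduct_comm w a] at h3
  change a ⬝ᵥ w ≤ a ⬝ᵥ u
  linarith

theorem gaussKernel_le_of_le (hS : S.PosDef) (hle : (S' - S).PosSemidef) (z : 𝔼) :
    gaussKernel S z ≤ gaussKernel S' z := by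
  apply Real.exp_le_exp.2
  linarith [dotProduct_inv_mulVec_le hS hle z]

theorem posDef_of_le (hS : S.PosDef) (hle : (S' - S).PosSemidef) : S'.PosDef := by
  have := hS.add_posSemidef hle
  rwa [add_sub_cancel] at this

theorem gaussMass_le_of_le (hS : S.PosDef) (hle : (S' - S).PosSemidef) :
    gaussMass S ≤ gaussMass S' :=
  integral_mono (integrable_gaussKernel hS) (integrable_gaussKernel (posDef_of_le hS hle))
    (gaussKernel_le_of_le hS hle)

/-- No invertibility is needed: singular matrices have inverse 0 and 0⁻¹ = 0, so both sides vanish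
in the degenerate cases. -/
theorem invQuad_smul {c : ℝ} (S : Matrix (Fin d) (Fin d) ℝ) (z : 𝔼) :
    invQuad (c • S) z = c⁻¹ * invQuad S z := by
  rcases eq_or_ne c 0 with rfl | hc
  · simp [invQuad]
  by_cases hu : IsUnit S.det
  · have h1 : (c • S)⁻¹ = c⁻¹ • S⁻¹ := by
      have : Invertible c := invertibleOfNonzero hc
      rw [Matrix.inv_smul S c hu, invOf_eq_inv]
    rw [invQuad, h1, Matrix.smul_mulVec, dotProduct_smul, smul_eq_mul]; rfl
  · have hu2 : ¬ IsUnit (c • S).det := by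
      rw [Matrix.det_smul, isUnit_iff_ne_zero, not_not]
      rw [isUnit_iff_ne_zero, not_not] at hu
      rw [hu, mul_zero]
    simp [invQuad, Matrix.nonsing_inv_apply_not_isUnit _ hu,
      Matrix.nonsing_inv_apply_not_isUnit _ hu2]

theorem invQuad_smul_vec (a : ℝ) (S : Matrix (Fin d) (Fin d) ℝ) (z : 𝔼) :
    invQuad S (a • z) = a ^ 2 * invQuad S z := by
  simp [invQuad, Matrix.mulVec_smul]; ring

theorem gaussMass_smul {c : ℝ} (hc : 0 < c) (S : Matrix (Fin d) (Fin d) ℝ) :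
    gaussMass (c • S) = √c ^ d * gaussMass S := by
  have h1 : gaussKernel (c • S) = fun z => gaussKernel S ((√c)⁻¹ • z) := by
    ext z
    rw [gaussKernel, gaussKernel, invQuad_smul, invQuad_smul_vec, inv_pow, Real.sq_sqrt hc.le]
  rw [gaussMass, h1, Measure.integral_comp_inv_smul_of_nonneg _ _ (Real.sqrt_nonneg c)]
  simp [gaussMass]

theorem invQuad_one (z : 𝔼) : invQuad (1 : Matrix (Fin d) (Fin d) ℝ) z = ‖z‖ ^ 2 := by
  rw [invQuad, inv_one, Matrix.one_mulVec, ← real_inner_self_eq_norm_sq,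
    EuclideanSpace.inner_eq_star_dotProduct, star_trivial]

/-- Domination of densities controls the `L¹` distance. -/
theorem integral_abs_sub_le_of_mul_le {α : Type*} [MeasurableSpace α] {μ : Measure α}
    {p q : α → ℝ} {a : ℝ} (hp : Integrable p μ) (hq : Integrable q μ) (hp1 : ∫ z, p z ∂μ = 1)
    (hq1 : ∫ z, q z ∂μ = 1) (hq0 : ∀ z, 0 ≤ q z) (ha : a ≤ 1) (h : ∀ z, a * q z ≤ p z) :
    ∫ z, |p z - q z| ∂μ ≤ 2 * (1 - a) := by
  calc ∫ z, |p z - q z| ∂μ ≤ ∫ z, ((p z - a * q z) + (1 - a) * q z) ∂μ := by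
        refine integral_mono (hp.sub hq).abs ((hp.sub (hq.const_mul a)).add (hq.const_mul _))
          fun z => ?_
        have h1 := h z
        have h2 := mul_nonneg (sub_nonneg.2 ha) (hq0 z)
        refine abs_le.2 ⟨?_, ?_⟩ <;> simp only <;> linarith
    _ = 2 * (1 - a) := by
        have hi : Integrable (fun z => p z - a * q z) μ := hp.sub (hq.const_mul a)
        rw [integral_add hi (hq.const_mul _), integral_sub hp (hq.const_mul a), integral_const_mul, integral_const_mul, hp1, hq1]
        ring

/-- The larger covariance has the larger kernel, so its density dominates the other one times the
ratio of the masses. -/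
theorem integral_abs_gaussDensity_sub_le_of_le (hS : S.PosDef) (hle : (S' - S).PosSemidef) :
    ∫ z, |gaussDensity S' z - gaussDensity S z| ≤ 2 * (1 - gaussMass S / gaussMass S') := by
  have hS' := posDef_of_le hS hle
  have h0 := gaussMass_pos hS
  have h0' := gaussMass_pos hS'
  refine integral_abs_sub_le_of_mul_le (integrable_gaussDensity hS') (integrable_gaussDensity hS)
    (integral_gaussDensity hS') (integral_gaussDensity hS) (fun z => (gaussDensity_pos hS z).le)
    ?_ fun z => ?_
  · rw [div_le_one h0']; exact gaussMass_le_of_le hS hle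
  · have h1 := gaussKernel_le_of_le hS hle z
    rw [gaussDensity, gaussDensity, ← mul_assoc, div_mul_eq_mul_div, mul_inv_cancel₀ h0.ne',
      one_div]
    gcongr

/-- For t in [0, 1], t ≤ √t, and Bernoulli's inequality bounds t^d from below. -/
theorem one_sub_sqrt_pow_le {t : ℝ} (ht0 : 0 ≤ t) (ht1 : t ≤ 1) :
    1 - √t ^ d ≤ d * (1 - t) := by
  have h1 : t ≤ √t := by
    have h2 := Real.sq_sqrt ht0
    have h3 : √t ≤ 1 := Real.sqrt_le_one.2 ht1
    nlinarith [Real.sqrt_nonneg t]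
  have h2 : t ^ d ≤ √t ^ d := by gcongr
  have h3 := one_add_mul_le_pow (show (-2 : ℝ) ≤ t - 1 by linarith) d
  rw [add_sub_cancel] at h3
  linarith

/-- Total variation estimate for Gaussian densities with comparable covariances. -/
theorem integral_abs_gaussDensity_sub_le (hS : S.PosDef) {η C : ℝ} (hη0 : 0 ≤ η) (hη1 : η < 1)
    (hC : 1 ≤ C) (hlow : (S' - (1 - η) • S).PosSemidef) (hup : (C • S - S').PosSemidef) :
    ∫ z, |gaussDensity S' z - gaussDensity S z| ≤ 4 * d * (η + (C - 1)) := by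
  have h1η : 0 < 1 - η := by linarith
  have hS1 : ((1 - η) • S).PosDef := hS.smul h1η
  have hS' : S'.PosDef := posDef_of_le hS1 hlow
  have hle : (S - (1 - η) • S).PosSemidef := by
    have : S - (1 - η) • S = η • S := by rw [sub_smul, one_smul, sub_sub_cancel]
    rw [this]
    exact hS.posSemidef.smul hη0
  -- S and S' need not be ordered; both lie above (1 - η)S, so the estimate goes through this common
  -- lower bound, and the upper bound by CS controls the mass of S'.
  have h1 := integral_abs_gaussDensity_sub_le_of_le hS1 hle
  have h2 := integral_abs_gaussDensity_sub_le_of_le hS1 hlow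
  have hm0 := gaussMass_pos hS
  have hm0' := gaussMass_pos hS'
  have h3 : gaussMass S' ≤ √C ^ d * gaussMass S := by
    rw [← gaussMass_smul (by linarith)]
    exact gaussMass_le_of_le hS' hup
  rw [gaussMass_smul h1η] at h1 h2
  have h4 : √((1 - η) / C) ^ d ≤ √(1 - η) ^ d * gaussMass S / gaussMass S' := by
    rw [Real.sqrt_div h1η.le, div_pow, div_le_div_iff₀ (by positivity) hm0', mul_assoc]
    gcongr
    linarith
  rw [mul_div_assoc, div_self hm0.ne', mul_one] at h1
  have h5 := one_sub_sqrt_pow_le (d := d) h1η.le (by linarith : 1 - η ≤ 1)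
  have h6 := one_sub_sqrt_pow_le (d := d) (t := (1 - η) / C) (by positivity) (by
    rw [div_le_one (by linarith)]; linarith)
  have h7 : 1 - (1 - η) / C ≤ η + (C - 1) := by
    rw [sub_le_iff_le_add, ← sub_le_iff_le_add', le_div_iff₀ (by linarith)]
    nlinarith
  have h8 : ∫ z, |gaussDensity S' z - gaussDensity S z| ≤
      (∫ z, |gaussDensity S' z - gaussDensity ((1 - η) • S) z|) +
        ∫ z, |gaussDensity S z - gaussDensity ((1 - η) • S) z| := by
    have i0 := integrable_gaussDensity hS
    have i1 := integrable_gaussDensity hS1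
    have i2 := integrable_gaussDensity hS'
    have i3 : Integrable fun z => |gaussDensity S' z - gaussDensity ((1 - η) • S) z| :=
      (i2.sub i1).abs
    have i4 : Integrable fun z => |gaussDensity S z - gaussDensity ((1 - η) • S) z| :=
      (i0.sub i1).abs
    rw [← integral_add i3 i4]
    refine integral_mono (i2.sub i0).abs (i3.add i4) fun z => ?_
    beta_reduce
    rw [abs_sub_comm (gaussDensity S z)]
    exact abs_sub_le _ _ _
  have hd : (0 : ℝ) ≤ d := Nat.cast_nonneg d
  have h9 : (d : ℝ) * (1 - (1 - η) / C) ≤ d * (η + (C - 1)) := by gcongr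
  have h10 : (d : ℝ) * (1 - (1 - η)) ≤ d * (η + (C - 1)) := by gcongr; linarith
  linarith

theorem gaussDensity_eq_of_clm (hS : S.PosDef) :
    ∃ T : 𝔼 →L[ℝ] 𝔼, (∀ z, ‖T z‖ ^ 2 = invQuad S z) ∧
      ∀ z, gaussDensity S z = (gaussMass S)⁻¹ * Real.exp (-‖T z‖ ^ 2 / 2) := by
  obtain ⟨T, A, hT, -⟩ := exists_clm_norm_sq_eq_invQuad hS
  exact ⟨T, fun z => (hT z).symm, fun z => by rw [gaussDensity, gaussKernel, hT]⟩

theorem invQuad_le_of_smul_one_le {κ : ℝ} (hκ : 0 < κ) (h : (S - κ • 1).PosSemidef) (z : 𝔼) :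
    invQuad S z ≤ κ⁻¹ * ‖z‖ ^ 2 := by
  have h1 := dotProduct_inv_mulVec_le (Matrix.PosDef.one.smul hκ) h z
  rwa [invQuad_smul, invQuad_one] at h1

theorem posDef_of_smul_one_le {κ : ℝ} (hκ : 0 < κ) (h : (S - κ • 1).PosSemidef) : S.PosDef :=
  posDef_of_le (Matrix.PosDef.one.smul hκ) h

theorem gaussMass_le_of_le_smul_one (hS : S.PosDef) {L : ℝ} (hL : 0 < L)
    (h : (L • 1 - S).PosSemidef) :
    gaussMass S ≤ √L ^ d * gaussMass (1 : Matrix (Fin d) (Fin d) ℝ) := by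
  rw [← gaussMass_smul hL]
  exact gaussMass_le_of_le hS h

end Gaussian

/-! ### The Metropolis operator with a symmetric proposal density -/

noncomputable section Operator

variable {d : ℕ} {π : EuclideanSpace ℝ (Fin d) → ℝ} {q q' : EuclideanSpace ℝ (Fin d) → ℝ}

local notation "𝔼" => EuclideanSpace ℝ (Fin d)

/-- A symmetric probability density for the increments of a random walk. -/
structure IsProposal (q : EuclideanSpace ℝ (Fin d) → ℝ) : Prop where
  nonneg : ∀ z, 0 ≤ q z
  integrable : Integrable q
  integral_eq_one : ∫ z, q z = 1
  even : ∀ z, q (-z) = q z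

/-- The random-walk Metropolis operator with increment density `q`. -/
def mhOp (π q g : EuclideanSpace ℝ (Fin d) → ℝ) (x : EuclideanSpace ℝ (Fin d)) : ℝ :=
  g x + ∫ y, accept π x y * (g y - g x) * q (y - x)

theorem accept_nonneg (hpos : ∀ x, 0 < π x) (x y : 𝔼) : 0 ≤ accept π x y :=
  le_min zero_le_one (div_pos (hpos y) (hpos x)).le

theorem accept_le_one (x y : 𝔼) : accept π x y ≤ 1 := min_le_left _ _

theorem measurable_accept (hm : Measurable π) : Measurable fun p : 𝔼 × 𝔼 => accept π p.1 p.2 := by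
  unfold accept
  fun_prop

theorem measurable_accept_right (hm : Measurable π) (x : 𝔼) : Measurable (accept π x) := by
  unfold accept
  fun_prop

theorem IsProposal.integrable_sub (hq : IsProposal q) (x : 𝔼) :
    Integrable fun y => q (y - x) := hq.integrable.comp_sub_right x

theorem IsProposal.integral_sub (hq : IsProposal q) (x : 𝔼) : ∫ y, q (y - x) = 1 := by
  rw [integral_sub_right_eq_self q x, hq.integral_eq_one]

/-- Functions to which the Metropolis operator at `x` can be applied. -/
def MHIntegrable (π q : EuclideanSpace ℝ (Fin d) → ℝ) (x : EuclideanSpace ℝ (Fin d))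
    (g : EuclideanSpace ℝ (Fin d) → ℝ) : Prop :=
  Integrable fun y => accept π x y * g y * q (y - x)

theorem integrable_accept_mul (hpos : ∀ x, 0 < π x) (hm : Measurable π) (hq : IsProposal q)
    (x : 𝔼) (a : ℝ) : Integrable fun y => accept π x y * a * q (y - x) := by
  refine (hq.integrable_sub x).bdd_mul (c := |a|)
    ((measurable_accept_right hm x).mul_const a).aestronglyMeasurable
    (Eventually.of_forall fun y => ?_)
  rw [norm_mul, Real.norm_of_nonneg (accept_nonneg hpos x y)]
  exact mul_le_of_le_one_left (abs_nonneg a) (accept_le_one x y)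

theorem mhIntegrable_of_bdd (hpos : ∀ x, 0 < π x) (hm : Measurable π) (hq : IsProposal q)
    {g : 𝔼 → ℝ} (hg : Measurable g) {C : ℝ} (hC : ∀ x, |g x| ≤ C) (x : 𝔼) :
    MHIntegrable π q x g := by
  refine (hq.integrable_sub x).bdd_mul (c := C)
    ((measurable_accept_right hm x).mul hg).aestronglyMeasurable
    (Eventually.of_forall fun y => ?_)
  rw [norm_mul, Real.norm_of_nonneg (accept_nonneg hpos x y)]
  exact (mul_le_of_le_one_left (abs_nonneg (g y)) (accept_le_one x y)).trans (hC y)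

theorem mhOp_eq_integral (hpos : ∀ x, 0 < π x) (hm : Measurable π) (hq : IsProposal q)
    {g : 𝔼 → ℝ} {x : 𝔼} (hg : MHIntegrable π q x g) :
    mhOp π q g x =
      ∫ y, (accept π x y * g y * q (y - x) + (1 - accept π x y) * g x * q (y - x)) := by
  have h1 := integrable_accept_mul hpos hm hq x (g x)
  have h2 : Integrable fun y => (1 - accept π x y) * g x * q (y - x) := by
    refine (((hq.integrable_sub x).const_mul (g x)).sub h1).congr (Eventually.of_forall fun y => ?_)
    simp only [Pi.sub_apply]; ring
  have h3 : ∫ y, (1 - accept π x y) * g x * q (y - x) =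
      g x - ∫ y, accept π x y * g x * q (y - x) := by
    have h5 : ∫ y, g x * q (y - x) = g x := by
      rw [integral_const_mul, hq.integral_sub, mul_one]
    nth_rewrite 2 [← h5]
    rw [← integral_sub ((hq.integrable_sub x).const_mul (g x)) h1]
    congr 1; ext y; ring
  have h4 : ∫ y, accept π x y * (g y - g x) * q (y - x) =
      (∫ y, accept π x y * g y * q (y - x)) - ∫ y, accept π x y * g x * q (y - x) := by
    rw [← integral_sub hg h1]
    congr 1; ext y; ring
  rw [integral_add hg h2, h3, mhOp, h4]
  ring

theorem integrable_mhOp_integrand (hpos : ∀ x, 0 < π x) (hm : Measurable π) (hq : IsProposal q)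
    {g : 𝔼 → ℝ} {x : 𝔼} (hg : MHIntegrable π q x g) :
    Integrable fun y => accept π x y * g y * q (y - x) + (1 - accept π x y) * g x * q (y - x) := by
  have h1 := integrable_accept_mul hpos hm hq x (g x)
  refine Integrable.add hg ?_
  refine (((hq.integrable_sub x).const_mul (g x)).sub h1).congr (Eventually.of_forall fun y => ?_)
  simp only [Pi.sub_apply]; ring

/-- A local lower bound `a` on the transition density improves the domination by `a ∫_B H`. -/
theorem abs_mhOp_sub_le (hpos : ∀ x, 0 < π x) (hm : Measurable π) (hq : IsProposal q)
    {h H : 𝔼 → ℝ} {x : 𝔼} (hh : MHIntegrable π q x h) (hH : MHIntegrable π q x H)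
    (hle : ∀ y, |h y| ≤ H y) {B : Set 𝔼} (hB : MeasurableSet B) (hhB : IntegrableOn h B)
    (hHB : IntegrableOn H B) {a : ℝ} (ha : ∀ y ∈ B, a ≤ accept π x y * q (y - x)) :
    |mhOp π q h x - a * ∫ y in B, h y| ≤ mhOp π q H x - a * ∫ y in B, H y := by
  rw [mhOp_eq_integral hpos hm hq hh, mhOp_eq_integral hpos hm hq hH, ← integral_indicator hB,
    ← integral_indicator hB, ← integral_const_mul, ← integral_const_mul,
    ← integral_sub (integrable_mhOp_integrand hpos hm hq hh)
      ((hhB.integrable_indicator hB).const_mul a),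
    ← integral_sub (integrable_mhOp_integrand hpos hm hq hH)
      ((hHB.integrable_indicator hB).const_mul a)]
  refine (abs_integral_le_integral_abs).trans (integral_mono
    ((integrable_mhOp_integrand hpos hm hq hh).sub
      ((hhB.integrable_indicator hB).const_mul a)).abs
    ((integrable_mhOp_integrand hpos hm hq hH).sub
      ((hHB.integrable_indicator hB).const_mul a)) fun y => ?_)
  have h1 := accept_le_one (π := π) x y
  have h2 := mul_nonneg (sub_nonneg.2 h1) (hq.nonneg (y - x))
  have h0 := mul_nonneg (accept_nonneg hpos x y) (hq.nonneg (y - x))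
  have h3 := abs_le.1 (hle y)
  have h4 := abs_le.1 (hle x)
  have h7 := mul_le_mul_of_nonneg_left h4.1 h2
  have h8 := mul_le_mul_of_nonneg_left h4.2 h2
  by_cases hy : y ∈ B
  · simp only [Set.indicator_of_mem hy]
    have h9 := sub_nonneg.2 (ha y hy)
    have h5 := mul_le_mul_of_nonneg_left h3.1 h9
    have h6 := mul_le_mul_of_nonneg_left h3.2 h9
    rw [abs_le]
    constructor <;> linarith
  · simp only [Set.indicator_of_notMem hy]
    have h5 := mul_le_mul_of_nonneg_left h3.1 h0
    have h6 := mul_le_mul_of_nonneg_left h3.2 h0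
    rw [abs_le]
    constructor <;> linarith

theorem abs_mhOp_le (hpos : ∀ x, 0 < π x) (hm : Measurable π) (hq : IsProposal q)
    {h H : 𝔼 → ℝ} {x : 𝔼} (hh : MHIntegrable π q x h) (hH : MHIntegrable π q x H)
    (hle : ∀ y, |h y| ≤ H y) : |mhOp π q h x| ≤ mhOp π q H x := by
  simpa using abs_mhOp_sub_le hpos hm hq hh hH hle MeasurableSet.empty (by simp) (by simp) (a := 0)
    (by simp)

theorem mhOp_const_add_mul {g : 𝔼 → ℝ} {x : 𝔼} (a b : ℝ) :
    mhOp π q (fun y => a + b * g y) x = a + b * mhOp π q g x := by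
  unfold mhOp
  rw [mul_add, ← integral_const_mul, ← add_assoc]
  congr 2; ext y; ring

theorem abs_mhOp_le_of_bdd (hpos : ∀ x, 0 < π x) (hm : Measurable π) (hq : IsProposal q)
    {g : 𝔼 → ℝ} (hg : Measurable g) {C : ℝ} (hC : ∀ x, |g x| ≤ C) (x : 𝔼) :
    |mhOp π q g x| ≤ C := by
  have h0 : 0 ≤ C := (abs_nonneg _).trans (hC 0)
  have h1 := abs_mhOp_le hpos hm hq (mhIntegrable_of_bdd hpos hm hq hg hC x)
    (mhIntegrable_of_bdd hpos hm hq (g := fun _ => C) measurable_const (C := C)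
      (fun _ => (abs_of_nonneg h0).le) x) hC
  simpa [mhOp] using h1

theorem abs_mhOp_sub_mhOp_le (hpos : ∀ x, 0 < π x) (hm : Measurable π) (hq : IsProposal q)
    (hq' : IsProposal q') {g : 𝔼 → ℝ} (hg : Measurable g) {C : ℝ} (hC : ∀ x, |g x| ≤ C) (x : 𝔼) :
    |mhOp π q g x - mhOp π q' g x| ≤ 2 * C * ∫ z, |q z - q' z| := by
  have h0 : 0 ≤ C := (abs_nonneg _).trans (hC 0)
  have hb : ∀ y, ‖accept π x y * (g y - g x)‖ ≤ 2 * C := by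
    intro y
    rw [norm_mul, Real.norm_of_nonneg (accept_nonneg hpos x y)]
    refine (mul_le_of_le_one_left (norm_nonneg _) (accept_le_one x y)).trans ?_
    refine (abs_sub _ _).trans ?_
    linarith [hC x, hC y]
  have hmeas : AEStronglyMeasurable (fun y => accept π x y * (g y - g x)) volume :=
    ((measurable_accept_right hm x).mul (hg.sub_const _)).aestronglyMeasurable
  have hi : Integrable fun y => accept π x y * (g y - g x) * q (y - x) :=
    (hq.integrable_sub x).bdd_mul hmeas (Eventually.of_forall hb)
  have hi' : Integrable fun y => accept π x y * (g y - g x) * q' (y - x) :=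
    (hq'.integrable_sub x).bdd_mul hmeas (Eventually.of_forall hb)
  unfold mhOp
  rw [add_sub_add_left_eq_sub, ← integral_sub hi hi', ← integral_const_mul,
    ← integral_sub_right_eq_self (fun z => 2 * C * |q z - q' z|) x]
  refine (abs_integral_le_integral_abs).trans (integral_mono (hi.sub hi').abs
    (((hq.integrable.sub hq'.integrable).abs.const_mul (2 * C)).comp_sub_right x) fun y => ?_)
  simp only
  rw [← mul_sub, abs_mul]
  exact mul_le_mul_of_nonneg_right (hb y) (abs_nonneg _)

/-- Joint measurability in a parameter is needed because the operator will be run with a random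
frozen covariance. -/
theorem measurable_mhOp_param {Θ : Type*} [MeasurableSpace Θ] (hm : Measurable π)
    {Q g : Θ → 𝔼 → ℝ} (hQ : Measurable fun p : Θ × 𝔼 => Q p.1 p.2)
    (hg : Measurable fun p : Θ × 𝔼 => g p.1 p.2) :
    Measurable fun p : Θ × 𝔼 => mhOp π (Q p.1) (g p.1) p.2 := by
  unfold mhOp
  refine hg.add ?_
  have h : Measurable fun r : (Θ × 𝔼) × 𝔼 =>
      accept π r.1.2 r.2 * (g r.1.1 r.2 - g r.1.1 r.1.2) * Q r.1.1 (r.2 - r.1.2) := by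
    have h1 : Measurable fun r : (Θ × 𝔼) × 𝔼 => accept π r.1.2 r.2 :=
      (measurable_accept hm).comp (by fun_prop : Measurable fun r : (Θ × 𝔼) × 𝔼 => (r.1.2, r.2))
    have h2 : Measurable fun r : (Θ × 𝔼) × 𝔼 => g r.1.1 r.2 :=
      hg.comp (by fun_prop : Measurable fun r : (Θ × 𝔼) × 𝔼 => (r.1.1, r.2))
    have h3 : Measurable fun r : (Θ × 𝔼) × 𝔼 => g r.1.1 r.1.2 :=
      hg.comp (by fun_prop : Measurable fun r : (Θ × 𝔼) × 𝔼 => (r.1.1, r.1.2))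
    have h4 : Measurable fun r : (Θ × 𝔼) × 𝔼 => Q r.1.1 (r.2 - r.1.2) :=
      hQ.comp (by fun_prop : Measurable fun r : (Θ × 𝔼) × 𝔼 => (r.1.1, r.2 - r.1.2))
    exact (h1.mul (h2.sub h3)).mul h4
  exact h.stronglyMeasurable.integral_prod_right.measurable

theorem measurable_mhOp (hm : Measurable π) {g : 𝔼 → ℝ} (hq : Measurable q) (hg : Measurable g) :
    Measurable (mhOp π q g) := by
  have := measurable_mhOp_param (Θ := Unit) (Q := fun _ => q) (g := fun _ => g) hm
    (hq.comp measurable_snd) (hg.comp measurable_snd)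
  exact this.comp (measurable_const.prodMk measurable_id : Measurable fun x : 𝔼 => ((), x))

/-- The Metropolis operator leaves the target invariant. -/
theorem integral_mhOp_mul (hpos : ∀ x, 0 < π x) (hm : Measurable π) (hπ : Integrable π)
    (hq : IsProposal q) (hqm : Measurable q) {g : 𝔼 → ℝ} (hg : Measurable g) {C : ℝ}
    (hC : ∀ x, |g x| ≤ C) : ∫ x, mhOp π q g x * π x = ∫ x, g x * π x := by
  -- Detailed balance: accept times π equals min(π(x), π(y)), symmetric in x and y, and q is even.
  -- So F is antisymmetric and its double integral vanishes by Fubini.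
  let F : 𝔼 → 𝔼 → ℝ := fun x y => accept π x y * (g y - g x) * q (y - x) * π x
  have hanti : ∀ x y, F y x = -F x y := by
    intro x y
    have h1 : accept π y x * π y = accept π x y * π x := by
      unfold accept
      rw [min_mul_of_nonneg _ _ (hpos y).le, min_mul_of_nonneg _ _ (hpos x).le,
        div_mul_cancel₀ _ (hpos y).ne', div_mul_cancel₀ _ (hpos x).ne', one_mul, one_mul, min_comm]
    have h2 : q (x - y) = q (y - x) := by rw [← hq.even, neg_sub]
    calc F y x = (accept π y x * π y) * (g x - g y) * q (x - y) := by simp only [F]; ring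
      _ = -F x y := by rw [h1, h2]; simp only [F]; ring
  have hFm : Measurable (Function.uncurry F) := by
    have h1 := measurable_accept hm
    have h2 : Measurable fun p : 𝔼 × 𝔼 => q (p.2 - p.1) :=
      hqm.comp (by fun_prop : Measurable fun p : 𝔼 × 𝔼 => p.2 - p.1)
    exact ((h1.mul ((hg.comp measurable_snd).sub (hg.comp measurable_fst))).mul h2).mul
      (hm.comp measurable_fst)
  have hFi : Integrable (Function.uncurry F) ((volume : Measure 𝔼).prod volume) := by
    have h1 := (Integrable.convolution_integrand (ContinuousLinearMap.mul ℝ ℝ) hπ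
      hq.integrable).swap
    refine (h1.const_mul (2 * C)).mono' hFm.aestronglyMeasurable (Eventually.of_forall fun p => ?_)
    simp only [Function.uncurry, F, Function.comp, Prod.fst_swap, Prod.snd_swap,
      ContinuousLinearMap.mul_apply']
    have h2 : |accept π p.1 p.2 * (g p.2 - g p.1)| ≤ 2 * C := by
      rw [abs_mul, abs_of_nonneg (accept_nonneg hpos _ _)]
      refine (mul_le_of_le_one_left (abs_nonneg _) (accept_le_one _ _)).trans ?_
      refine (abs_sub _ _).trans ?_
      linarith [hC p.1, hC p.2]
    rw [Real.norm_eq_abs, abs_mul, abs_mul, abs_of_nonneg (hq.nonneg _), abs_of_pos (hpos _),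
      mul_assoc, mul_comm (π p.1)]
    exact mul_le_mul_of_nonneg_right h2 (mul_nonneg (hq.nonneg _) (hpos _).le)
  have hz : ∫ x, ∫ y, F x y = 0 := by
    have h1 := integral_integral_swap hFi
    have h2 : ∫ y, ∫ x, F x y = -∫ x, ∫ y, F x y := by
      rw [← integral_neg]
      congr 1; ext x
      rw [← integral_neg]
      congr 1; ext y
      exact hanti x y
    linarith
  have hsplit : ∀ x, mhOp π q g x * π x = g x * π x + ∫ y, F x y := by
    intro x
    rw [mhOp, add_mul, ← integral_mul_const]
  simp_rw [hsplit]
  have hFi2 : Integrable fun x => ∫ y, F x y := hFi.integral_prod_left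
  rw [integral_add ?_ hFi2, hz, add_zero]
  exact hπ.bdd_mul hg.aestronglyMeasurable (Eventually.of_forall hC)

end Operator

/-! ### Geometric ergodicity from drift and minorization -/

noncomputable section Contraction

variable {d : ℕ} {π : EuclideanSpace ℝ (Fin d) → ℝ} {q : EuclideanSpace ℝ (Fin d) → ℝ}

local notation "𝔼" => EuclideanSpace ℝ (Fin d)

/-- The hypothesis says that every interval [f x - ψ x, f x + ψ x] meets every other one; the
supremum of the left endpoints lies in all of them. This trades a weighted oscillation for a
weighted sup norm of f - c. -/
theorem exists_center {α : Type*} [Nonempty α] {f ψ : α → ℝ}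
    (h : ∀ x y, |f x - f y| ≤ ψ x + ψ y) : ∃ c, ∀ x, |f x - c| ≤ ψ x := by
  have hle : ∀ x y, f x - ψ x ≤ f y + ψ y := fun x y => by
    linarith [(abs_le.1 (h x y)).2]
  obtain ⟨y0⟩ := ‹Nonempty α›
  have hbdd : BddAbove (Set.range fun x => f x - ψ x) :=
    ⟨f y0 + ψ y0, by rintro _ ⟨x, rfl⟩; exact hle x y0⟩
  have : Nonempty α := ⟨y0⟩
  refine ⟨⨆ x, (f x - ψ x), fun x => ?_⟩
  have h1 : f x - ψ x ≤ ⨆ x, (f x - ψ x) := le_ciSup hbdd x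
  have h2 : ⨆ x, (f x - ψ x) ≤ f x + ψ x := ciSup_le fun z => hle z x
  rw [abs_le]
  constructor <;> linarith

/-- One-step contraction for a weighted oscillation seminorm, from a drift condition and a local
minorization. -/
theorem mhOp_contraction (hpos : ∀ x, 0 < π x) (hm : Measurable π) (hq : IsProposal q)
    {V : 𝔼 → ℝ} (hV0 : ∀ x, 0 ≤ V x) (hVi : ∀ x, MHIntegrable π q x V)
    {B : Set 𝔼} (hB : MeasurableSet B) (hBf : volume B ≠ ⊤) (hVB : IntegrableOn V B)
    {c b a : ℝ} (hc0 : 0 < c) (hb : 0 < b)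
    (hdrift : ∀ x, mhOp π q V x ≤ (1 - c) * V x + b) (ha0 : 0 ≤ a)
    (hminor : ∀ x, V x ≤ 4 * b / c → ∀ y ∈ B, a ≤ accept π x y * q (y - x))
    {f : 𝔼 → ℝ} (hf : Measurable f) {C : ℝ} (hC : ∀ x, |f x| ≤ C) {Λ : ℝ} (hΛ : 0 ≤ Λ)
    (hosc : ∀ x y, |f x - f y| ≤ Λ * (2 + a * volume.real B / (2 * b) * (V x + V y))) (x y : 𝔼) :
    |mhOp π q f x - mhOp π q f y| ≤ (1 - min c (a * volume.real B) / 4) * Λ *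
      (2 + a * volume.real B / (2 * b) * (V x + V y)) := by
  set α := a * volume.real B with hα
  have hα0 : 0 ≤ α := mul_nonneg ha0 measureReal_nonneg
  set β := α / (2 * b) with hβ
  have hβ0 : 0 ≤ β := by positivity
  -- The weight β is tuned so that the additive drift constants of the two points together
  -- contribute exactly α.
  have hbβ : 2 * (b * β) = α := by rw [hβ]; field_simp
  set τ := min c α / 4 with hτ
  have hτc : 4 * τ ≤ c := by rw [hτ]; linarith [min_le_left c α]
  have hτα : 4 * τ ≤ α := by rw [hτ]; linarith [min_le_right c α]
  have hτ0 : 0 ≤ τ := by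
    have := le_min hc0.le hα0
    rw [hτ]; linarith
  obtain ⟨k, hk⟩ := exists_center (f := f) (ψ := fun x => Λ + Λ * β * V x) (fun x y => by
    refine (hosc x y).trans (le_of_eq ?_); ring)
  set h : 𝔼 → ℝ := fun x => -k + 1 * f x with hh
  set H : 𝔼 → ℝ := fun x => Λ + Λ * β * V x with hH
  have hhm : Measurable h := (hf.const_mul 1).const_add (-k)
  have hhb : ∀ x, |h x| ≤ |k| + C := fun x => by
    simp only [hh, one_mul]
    refine (abs_add_le _ _).trans ?_
    rw [abs_neg]
    linarith [hC x]
  have hhH : ∀ x, |h x| ≤ H x := fun x => by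
    have := hk x
    simp only [hh, hH]
    rwa [one_mul, neg_add_eq_sub]
  have hhi : ∀ x, MHIntegrable π q x h := fun x => mhIntegrable_of_bdd hpos hm hq hhm hhb x
  have hHi : ∀ x, MHIntegrable π q x H := fun x => by
    refine ((integrable_accept_mul hpos hm hq x Λ).add ((hVi x).const_mul (Λ * β))).congr
      (Eventually.of_forall fun y => ?_)
    simp only [hH, Pi.add_apply]; ring
  have hmh : ∀ x, mhOp π q h x = -k + mhOp π q f x := fun x => by
    rw [hh, mhOp_const_add_mul, one_mul]
  have hmH : ∀ x, mhOp π q H x = Λ + Λ * β * mhOp π q V x := fun x => by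
    rw [hH, mhOp_const_add_mul]
  have hΛβ : 0 ≤ Λ * β := mul_nonneg hΛ hβ0
  have hmH2 : ∀ x, mhOp π q H x ≤ Λ + Λ * β * ((1 - c) * V x + b) := fun x => by
    rw [hmH]
    have := mul_le_mul_of_nonneg_left (hdrift x) hΛβ
    linarith
  have hdiff : mhOp π q f x - mhOp π q f y = mhOp π q h x - mhOp π q h y := by
    rw [hmh, hmh]; ring
  rw [hdiff]
  set S := V x + V y with hS
  have hS0 : 0 ≤ S := add_nonneg (hV0 x) (hV0 y)
  -- If S is small both points lie in the sublevel set and the minorization removes 2α, against the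
  -- α added by the drift constants. If S is large, cβS > 4bβ = 2α, so the drift alone pays for
  -- them. In both cases 4τ ≤ min(c, α) leaves the factor 1 - τ.
  rcases le_or_gt S (4 * b / c) with hSl | hSl
  · have hx := hminor x (by linarith [hV0 y])
    have hy := hminor y (by linarith [hV0 x])
    have hhB : IntegrableOn h B :=
      Measure.integrableOn_of_bounded (M := |k| + C) hBf hhm.aestronglyMeasurable
        (Eventually.of_forall hhb)
    have hcB : IntegrableOn (fun _ : 𝔼 => Λ) B := integrableOn_const hBf
    have hHB : IntegrableOn H B := hcB.add (hVB.const_mul (Λ * β))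
    have hHint : Λ * volume.real B ≤ ∫ y in B, H y := by
      have h1 : Λ * volume.real B = ∫ y in B, (fun _ => Λ) y := by
        rw [setIntegral_const, smul_eq_mul, mul_comm]
      rw [h1]
      refine setIntegral_mono hcB hHB fun y => ?_
      simp only [hH]
      have := mul_nonneg hΛβ (hV0 y)
      linarith
    have h1 := abs_mhOp_sub_le hpos hm hq (hhi x) (hHi x) hhH hB hhB hHB hx
    have h2 := abs_mhOp_sub_le hpos hm hq (hhi y) (hHi y) hhH hB hhB hHB hy
    have h3 : Λ * α ≤ a * ∫ y in B, H y := by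
      have := mul_le_mul_of_nonneg_left hHint ha0
      rw [hα]; linarith
    have h4 := hmH2 x
    have h5 := hmH2 y
    have h6 : |mhOp π q h x - mhOp π q h y| ≤ |mhOp π q h x - a * ∫ y in B, h y| +
        |mhOp π q h y - a * ∫ y in B, h y| := by
      have := abs_sub_le (mhOp π q h x) (a * ∫ y in B, h y) (mhOp π q h y)
      rwa [abs_sub_comm (a * _) (mhOp π q h y)] at this
    have h7 : |mhOp π q h x - mhOp π q h y| ≤ Λ * (2 - 2 * α + β * ((1 - c) * S + 2 * b)) := by
      rw [hS]; linarith
    refine h7.trans ?_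
    rw [mul_comm (1 - τ), mul_assoc]
    refine mul_le_mul_of_nonneg_left ?_ hΛ
    have h8 : 0 ≤ β * S * (c - τ) := mul_nonneg (mul_nonneg hβ0 hS0) (by linarith)
    nlinarith
  · have h1 := abs_mhOp_le hpos hm hq (hhi x) (hHi x) hhH
    have h2 := abs_mhOp_le hpos hm hq (hhi y) (hHi y) hhH
    have h4 := hmH2 x
    have h5 := hmH2 y
    have h6 := abs_sub (mhOp π q h x) (mhOp π q h y)
    have h7 : |mhOp π q h x - mhOp π q h y| ≤ Λ * (2 + β * ((1 - c) * S + 2 * b)) := by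
      rw [hS]; linarith
    refine h7.trans ?_
    rw [mul_comm (1 - τ), mul_assoc]
    refine mul_le_mul_of_nonneg_left ?_ hΛ
    rw [div_lt_iff₀ hc0] at hSl
    have h8 : β * (4 * b) ≤ β * (S * c) := mul_le_mul_of_nonneg_left hSl.le hβ0
    have h9 : 0 ≤ β * S * (c - 4 * τ) := mul_nonneg (mul_nonneg hβ0 hS0) (by linarith)
    nlinarith

theorem iterate_mhOp_bdd (hpos : ∀ x, 0 < π x) (hm : Measurable π) (hq : IsProposal q)
    (hqm : Measurable q) {f : 𝔼 → ℝ} (hf : Measurable f) {C : ℝ} (hC : ∀ x, |f x| ≤ C) (n : ℕ) :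
    Measurable ((mhOp π q)^[n] f) ∧ ∀ x, |(mhOp π q)^[n] f x| ≤ C := by
  induction n with
  | zero => exact ⟨hf, hC⟩
  | succ n ih =>
    rw [Function.iterate_succ_apply']
    exact ⟨measurable_mhOp hm hqm ih.1, abs_mhOp_le_of_bdd hpos hm hq ih.1 ih.2⟩

theorem integral_iterate_mhOp (hpos : ∀ x, 0 < π x) (hm : Measurable π) (hπ : Integrable π)
    (hq : IsProposal q) (hqm : Measurable q) {f : 𝔼 → ℝ} (hf : Measurable f) {C : ℝ}
    (hC : ∀ x, |f x| ≤ C) (n : ℕ) :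
    ∫ x, (mhOp π q)^[n] f x * π x = ∫ x, f x * π x := by
  induction n with
  | zero => rfl
  | succ n ih =>
    rw [Function.iterate_succ_apply']
    have := iterate_mhOp_bdd hpos hm hq hqm hf hC n
    rw [integral_mhOp_mul hpos hm hπ hq hqm this.1 this.2, ih]

/-- Geometric ergodicity with explicit rate. -/
theorem abs_iterate_mhOp_sub_le (hpos : ∀ x, 0 < π x) (hm : Measurable π) (hπ : Integrable π)
    (hπ1 : ∫ x, π x = 1) (hq : IsProposal q) (hqm : Measurable q)
    {V : 𝔼 → ℝ} (hV0 : ∀ x, 0 ≤ V x) (hVi : ∀ x, MHIntegrable π q x V)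
    (hVπ : Integrable fun x => V x * π x)
    {B : Set 𝔼} (hB : MeasurableSet B) (hBf : volume B ≠ ⊤) (hVB : IntegrableOn V B)
    {c b a : ℝ} (hc1 : c ≤ 1) (hc0 : 0 < c) (hb : 0 < b)
    (hdrift : ∀ x, mhOp π q V x ≤ (1 - c) * V x + b) (ha0 : 0 ≤ a)
    (hminor : ∀ x, V x ≤ 4 * b / c → ∀ y ∈ B, a ≤ accept π x y * q (y - x))
    {f : 𝔼 → ℝ} (hf : Measurable f) {C : ℝ} (hC : ∀ x, |f x| ≤ C) (n : ℕ) (x : 𝔼) :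
    |(mhOp π q)^[n] f x - ∫ y, f y * π y| ≤ C * (1 - min c (a * volume.real B) / 4) ^ n *
      (2 + a * volume.real B / (2 * b) * (V x + ∫ y, V y * π y)) := by
  have hC0 : 0 ≤ C := (abs_nonneg _).trans (hC 0)
  set r := 1 - min c (a * volume.real B) / 4 with hr
  have hr0 : 0 ≤ r := by
    rw [hr]; linarith [min_le_left c (a * volume.real B)]
  set β := a * volume.real B / (2 * b) with hβ
  have hβ0 : 0 ≤ β := div_nonneg (mul_nonneg ha0 measureReal_nonneg) (by linarith)
  have hcontr : ∀ x y, |(mhOp π q)^[n] f x - (mhOp π q)^[n] f y| ≤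
      C * r ^ n * (2 + β * (V x + V y)) := by
    induction n with
    | zero =>
      intro x y
      simp only [Function.iterate_zero, id, pow_zero, mul_one]
      have h1 := (abs_sub (f x) (f y)).trans (add_le_add (hC x) (hC y))
      have h2 := mul_nonneg hC0 (mul_nonneg hβ0 (add_nonneg (hV0 x) (hV0 y)))
      linarith
    | succ n ih =>
      intro x y
      simp only [Function.iterate_succ_apply']
      have hb' := iterate_mhOp_bdd hpos hm hq hqm hf hC n
      have := mhOp_contraction hpos hm hq hV0 hVi hB hBf hVB hc0 hb hdrift ha0 hminor
        hb'.1 hb'.2 (mul_nonneg hC0 (pow_nonneg hr0 n)) ih x y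
      refine this.trans (le_of_eq ?_)
      rw [pow_succ]; ring
  have hgb := iterate_mhOp_bdd hpos hm hq hqm hf hC n
  set g := (mhOp π q)^[n] f with hg
  have hgπ : Integrable fun y => g y * π y :=
    hπ.bdd_mul hgb.1.aestronglyMeasurable (Eventually.of_forall hgb.2)
  -- By invariance the target mean of f equals that of g, so the deviation at x is an average over π
  -- of differences controlled by the contraction.
  have h1 : g x - ∫ y, f y * π y = ∫ y, (g x - g y) * π y := by
    rw [← integral_iterate_mhOp hpos hm hπ hq hqm hf hC n, ← hg]
    have : ∀ y, (g x - g y) * π y = g x * π y - g y * π y := fun y => by ring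
    simp_rw [this]
    rw [integral_sub (hπ.const_mul _) hgπ, integral_const_mul, hπ1, mul_one]
  have hi : Integrable fun y => C * r ^ n * (2 + β * V x) * π y + C * r ^ n * β * (V y * π y) :=
    (hπ.const_mul _).add (hVπ.const_mul _)
  calc |g x - ∫ y, f y * π y| ≤ ∫ y, |(g x - g y) * π y| := by
        rw [h1]; exact abs_integral_le_integral_abs
    _ ≤ ∫ y, (C * r ^ n * (2 + β * V x) * π y + C * r ^ n * β * (V y * π y)) := by
        refine integral_mono_of_nonneg (Eventually.of_forall fun y => abs_nonneg _) hi
          (Eventually.of_forall fun y => ?_)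
        simp only
        rw [abs_mul, abs_of_pos (hpos y)]
        have := mul_le_mul_of_nonneg_right (hcontr x y) (hpos y).le
        refine this.trans (le_of_eq ?_)
        ring
    _ = _ := by
        rw [integral_add (hπ.const_mul _) (hVπ.const_mul _), integral_const_mul,
          integral_const_mul, hπ1]
        ring

end Contraction

/-! ### The Lyapunov function W and its drift -/

noncomputable section Rate

variable {d : ℕ} {π : EuclideanSpace ℝ (Fin d) → ℝ} {s : ℝ}

local notation "𝔼" => EuclideanSpace ℝ (Fin d)

theorem bddAbove_range_rpow (hpos : ∀ x, 0 < π x) {M : ℝ} (hM : ∀ x, π x ≤ M) (hs0 : 0 < s) :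
    BddAbove (Set.range fun y => |π y ^ s|) := by
  refine ⟨M ^ s, ?_⟩
  rintro _ ⟨y, rfl⟩
  simp only
  rw [abs_of_nonneg (Real.rpow_nonneg (hpos y).le _)]
  exact Real.rpow_le_rpow (hpos y).le (hM y) hs0.le

theorem iSup_abs_rpow_pos (hpos : ∀ x, 0 < π x) {M : ℝ} (hM : ∀ x, π x ≤ M) (hs0 : 0 < s) :
    0 < ⨆ y, |π y ^ s| :=
  (abs_pos.2 (Real.rpow_pos_of_pos (hpos 0) s).ne').trans_le
    (le_ciSup (bddAbove_range_rpow hpos hM hs0) 0)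

theorem one_le_W (hpos : ∀ x, 0 < π x) {M : ℝ} (hM : ∀ x, π x ≤ M) (hs0 : 0 < s) (x : 𝔼) :
    1 ≤ W π s x := by
  have h1 := le_ciSup (bddAbove_range_rpow hpos hM hs0) x
  have h1' : |π x ^ s| = π x ^ s := abs_of_nonneg (Real.rpow_nonneg (hpos x).le _)
  have h2 : 0 < π x ^ (-s) := Real.rpow_pos_of_pos (hpos x) _
  calc (1 : ℝ) = π x ^ (-s) * π x ^ s := by
        rw [← Real.rpow_add (hpos x), neg_add_cancel, Real.rpow_zero]
    _ ≤ W π s x := mul_le_mul_of_nonneg_left (h1'.symm.le.trans h1) h2.le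

theorem continuous_W (hpos : ∀ x, 0 < π x) (hc : Continuous π) : Continuous (W π s) := by
  unfold W
  exact (hc.rpow_const (fun x => Or.inl (hpos x).ne')).mul continuous_const

/-- Taking logarithms in the exponential tail bound of π. The logarithmic size of sublevel sets of W
is what keeps the rates, and later the covariances, under control. -/
theorem exists_norm_le_log_W (hpos : ∀ x, 0 < π x) {M : ℝ} (hM : ∀ x, π x ≤ M) (hs0 : 0 < s)
    {C : ℝ} (hC0 : 0 < C) (hC : ∀ x, π x ≤ C * Real.exp (-‖x‖)) :
    ∃ a : ℝ, 0 ≤ a ∧ ∀ x, ‖x‖ ≤ a + s⁻¹ * Real.log (W π s x) := by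
  set v := ⨆ y, |π y ^ s| with hv
  have hv0 : 0 < v := iSup_abs_rpow_pos hpos hM hs0
  refine ⟨|Real.log C - s⁻¹ * Real.log v|, abs_nonneg _, fun x => ?_⟩
  have h1 : Real.log (W π s x) = -s * Real.log (π x) + Real.log v := by
    rw [W, Real.log_mul (Real.rpow_pos_of_pos (hpos x) _).ne' hv0.ne', Real.log_rpow (hpos x)]
  have h2 : Real.log (π x) ≤ Real.log C - ‖x‖ := by
    have := Real.log_le_log (hpos x) (hC x)
    rwa [Real.log_mul hC0.ne' (Real.exp_pos _).ne', Real.log_exp, ← sub_eq_add_neg] at this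
  have h3 : s⁻¹ * Real.log (W π s x) = -Real.log (π x) + s⁻¹ * Real.log v := by
    rw [h1, mul_add, ← mul_assoc, mul_neg, inv_mul_cancel₀ hs0.ne']; ring
  rw [h3]
  linarith [le_abs_self (Real.log C - s⁻¹ * Real.log v)]

/-- Up to a constant W π is π^(1-s), which inherits exponential tails. -/
theorem integrable_W_mul (hpos : ∀ x, 0 < π x) (hc : Continuous π) (hs1 : s < 1)
    {C : ℝ} (hC0 : 0 < C) (hC : ∀ x, π x ≤ C * Real.exp (-‖x‖)) :
    Integrable fun x => W π s x * π x := by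
  set v := ⨆ y, |π y ^ s| with hv
  have hv0 : 0 ≤ v := Real.iSup_nonneg fun y => abs_nonneg _
  have h1s : 0 < 1 - s := by linarith
  refine ((integrable_exp_neg_mul_norm (E := 𝔼) h1s).const_mul (C ^ (1 - s) * v)).mono'
    ((continuous_W hpos hc).mul hc).aestronglyMeasurable (Eventually.of_forall fun x => ?_)
  have hW0 : 0 ≤ W π s x := mul_nonneg (Real.rpow_nonneg (hpos x).le _) hv0
  rw [Real.norm_of_nonneg (mul_nonneg hW0 (hpos x).le)]
  have h1 : W π s x * π x = π x ^ (1 - s) * v := by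
    rw [W, mul_right_comm]
    nth_rewrite 2 [← Real.rpow_one (π x)]
    rw [← Real.rpow_add (hpos x), neg_add_eq_sub]
  have h2 : π x ^ (1 - s) ≤ C ^ (1 - s) * Real.exp (-((1 - s) * ‖x‖)) := by
    refine (Real.rpow_le_rpow (hpos x).le (hC x) h1s.le).trans (le_of_eq ?_)
    rw [Real.mul_rpow hC0.le (Real.exp_pos _).le, ← Real.exp_mul]
    congr 2; ring
  rw [h1]
  calc π x ^ (1 - s) * v ≤ C ^ (1 - s) * Real.exp (-((1 - s) * ‖x‖)) * v := by gcongr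
    _ = _ := by ring

theorem isProposal_gaussDensity {S : Matrix (Fin d) (Fin d) ℝ} (hS : S.PosDef) :
    IsProposal (gaussDensity S) where
  nonneg z := (gaussDensity_pos hS z).le
  integrable := integrable_gaussDensity hS
  integral_eq_one := integral_gaussDensity hS
  even := gaussDensity_neg S

theorem measurable_gaussDensity_right (S : Matrix (Fin d) (Fin d) ℝ) :
    Measurable (gaussDensity S) := by
  have h : Continuous (invQuad S) := by
    unfold invQuad
    fun_prop
  exact (Real.measurable_exp.comp (h.measurable.neg.div_const 2)).const_mul _

theorem mhIntegrable_W (hpos : ∀ x, 0 < π x) (hc : Continuous π) (hs0 : 0 < s) (hs1 : s < 1)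
    {q : 𝔼 → ℝ} (hq : IsProposal q) (x : 𝔼) : MHIntegrable π q x (W π s) := by
  have hv : 0 ≤ ⨆ y, |π y ^ s| := Real.iSup_nonneg fun y => abs_nonneg _
  have hW0 : ∀ y, 0 ≤ W π s y := fun y => mul_nonneg (Real.rpow_nonneg (hpos y).le _) hv
  refine (hq.integrable_sub x).bdd_mul (c := W π s x)
    ((measurable_accept_right hc.measurable x).mul
      (continuous_W hpos hc).measurable).aestronglyMeasurable (Eventually.of_forall fun y => ?_)
  rw [Real.norm_of_nonneg (mul_nonneg (accept_nonneg hpos x y) (hW0 y))]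
  have := mul_le_mul_of_nonneg_right (min_one_mul_rpow_le hpos hs0 hs1 x y) hv
  rw [mul_assoc] at this
  exact this

/-- Uniform drift for the Metropolis operators with Gaussian proposals. -/
theorem IsTarget.exists_mhOp_W_le {ρ β R : ℝ} (h : IsTarget π ρ β R) (hd : 1 ≤ d)
    (hs0 : 0 < s) (hs1 : s < 1) {κ : ℝ} (hκ : 0 < κ) :
    ∃ c b : ℝ, 0 < c ∧ 0 ≤ b ∧ ∀ S : Matrix (Fin d) (Fin d) ℝ, (S - κ • 1).PosSemidef →
      c * (gaussMass S)⁻¹ ≤ 1 ∧ ∀ x, mhOp π (gaussDensity S) (W π s) x ≤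
        (1 - c * (gaussMass S)⁻¹) * W π s x + b := by
  have hv : 0 ≤ ⨆ y, |π y ^ s| := Real.iSup_nonneg fun y => abs_nonneg _
  obtain ⟨c, b, hc, hb, hdr⟩ := h.exists_drift (by simpa using hd) hs0 hs1
    (Real.sqrt_nonneg κ⁻¹) hv
  refine ⟨c, b, hc, hb, fun S hS => ?_⟩
  have hSp := posDef_of_smul_one_le hκ hS
  obtain ⟨T, hT, hden⟩ := gaussDensity_eq_of_clm hSp
  have hTn : ‖T‖ ≤ √κ⁻¹ := by
    refine T.opNorm_le_bound (Real.sqrt_nonneg _) fun z => ?_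
    have h1 := invQuad_le_of_smul_one_le hκ hS z
    rw [← hT] at h1
    have h2 : (√κ⁻¹ * ‖z‖) ^ 2 = κ⁻¹ * ‖z‖ ^ 2 := by
      rw [mul_pow, Real.sq_sqrt (by positivity)]
    rw [← h2] at h1
    exact le_of_sq_le_sq h1 (by positivity)
  have hfun : (fun z => (gaussMass S)⁻¹ * Real.exp (-‖T z‖ ^ 2 / 2)) = gaussDensity S :=
    funext fun z => (hden z).symm
  obtain ⟨h1, h2⟩ := hdr (gaussMass S)⁻¹ (inv_nonneg.2 (gaussMass_pos hSp).le) T hTn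
    (by rw [hfun]; exact integrable_gaussDensity hSp)
    (by rw [hfun]; exact integral_gaussDensity hSp)
  refine ⟨h1, fun x => ?_⟩
  have h3 := h2 x
  simp_rw [← hden] at h3
  have h4 : mhOp π (gaussDensity S) (W π s) x = W π s x +
      ∫ y, min 1 (π y / π x) * (π y ^ (-s) * (⨆ y, |π y ^ s|) - π x ^ (-s) * ⨆ y, |π y ^ s|) *
        gaussDensity S (y - x) := rfl
  have h5 : π x ^ (-s) * (⨆ y, |π y ^ s|) = W π s x := rfl
  rw [h4]
  rw [h5] at h3
  rw [h5]
  linarith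

end Rate

/-! ### Explicit rate in terms of an upper bound on the covariance -/

noncomputable section Rate

variable {d : ℕ} {π : EuclideanSpace ℝ (Fin d) → ℝ} {s : ℝ}

local notation "𝔼" => EuclideanSpace ℝ (Fin d)

/-- On the unit ball π is bounded below by compactness, and π(x) ≤ M for every x, so the bound is
uniform in the starting point. -/
theorem exists_le_accept (hpos : ∀ x, 0 < π x) (hc : Continuous π) {M : ℝ}
    (hM : ∀ x, π x ≤ M) :
    ∃ m : ℝ, 0 < m ∧ m ≤ 1 ∧ ∀ x : 𝔼, ∀ y ∈ Metric.ball (0 : 𝔼) 1, m ≤ accept π x y := by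
  obtain ⟨y0, -, hy0⟩ := (isCompact_closedBall (0 : 𝔼) 1).exists_isMinOn
    ⟨0, by simp⟩ hc.continuousOn
  have hM0 : 0 < M := (hpos 0).trans_le (hM 0)
  refine ⟨min 1 (π y0 / M), lt_min one_pos (div_pos (hpos _) hM0), min_le_left _ _,
    fun x y hy => min_le_min le_rfl ?_⟩
  have h1 : π y0 ≤ π y := hy0 (Metric.ball_subset_closedBall hy)
  exact div_le_div₀ (hpos y).le h1 (hpos x) (hM x)

theorem inv_gaussMass_ge {S : Matrix (Fin d) (Fin d) ℝ} (hS : S.PosDef) {L : ℝ} (hL : 1 ≤ L)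
    (hSL : (L • 1 - S).PosSemidef) :
    (gaussMass (1 : Matrix (Fin d) (Fin d) ℝ))⁻¹ * Real.exp (-(d * Real.log L)) ≤
      (gaussMass S)⁻¹ := by
  have hL0 : 0 < L := by linarith
  have hI10 : 0 < gaussMass (1 : Matrix (Fin d) (Fin d) ℝ) := gaussMass_pos Matrix.PosDef.one
  have h1 := gaussMass_le_of_le_smul_one hS hL0 hSL
  have h2 : √L ≤ L := by
    rw [Real.sqrt_le_left hL0.le]; nlinarith
  have h3 : gaussMass S ≤ L ^ d * gaussMass (1 : Matrix (Fin d) (Fin d) ℝ) :=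
    h1.trans (mul_le_mul_of_nonneg_right (pow_le_pow_left₀ (Real.sqrt_nonneg L) h2 d) hI10.le)
  have h4 : (gaussMass (1 : Matrix (Fin d) (Fin d) ℝ))⁻¹ * Real.exp (-(d * Real.log L)) =
      (L ^ d * gaussMass (1 : Matrix (Fin d) (Fin d) ℝ))⁻¹ := by
    rw [Real.exp_neg, mul_comm (d : ℝ), Real.exp_mul, Real.exp_log hL0, Real.rpow_natCast,
      ← mul_inv, mul_comm]
  rw [h4]
  exact inv_anti₀ (gaussMass_pos hS) h3

/-- Drift and minorization on a sublevel set, with constants explicit in `L`. -/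
theorem IsTarget.exists_drift_minorization {ρ β R : ℝ} (h : IsTarget π ρ β R) (hd : 1 ≤ d)
    (hs0 : 0 < s) (hs1 : s < 1) {M : ℝ} (hM : ∀ x, π x ≤ M) {κ : ℝ} (hκ : 0 < κ) (v : ℝ)
    (hv : 0 ≤ v) :
    ∃ c b m D : ℝ, 0 < c ∧ 1 ≤ b ∧ 0 < m ∧ 0 ≤ D ∧ m * v ≤ b ∧ ∀ L : ℝ, 1 ≤ L →
      ∀ S : Matrix (Fin d) (Fin d) ℝ, (S - κ • 1).PosSemidef → (L • 1 - S).PosSemidef →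
      c * Real.exp (-(d * Real.log L)) ≤ 1 ∧
      (∀ x, mhOp π (gaussDensity S) (W π s) x ≤
        (1 - c * Real.exp (-(d * Real.log L))) * W π s x + b) ∧
      (∀ x, W π s x ≤ 4 * b / (c * Real.exp (-(d * Real.log L))) →
        ∀ y ∈ Metric.ball (0 : 𝔼) 1,
          m * Real.exp (-(d * Real.log L)) *
            Real.exp (-((D * (1 + Real.log L)) ^ 2 / (2 * κ))) ≤
            accept π x y * gaussDensity S (y - x)) := by
  have hpos := h.pos
  obtain ⟨c, b, hc, hb, hdr⟩ := h.exists_mhOp_W_le hd hs0 hs1 hκ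
  obtain ⟨Ce, hCe0, hCe⟩ := h.exists_le_exp_neg_norm
  obtain ⟨a0, ha0, hnorm⟩ := exists_norm_le_log_W hpos hM hs0 hCe0 hCe
  obtain ⟨m, hm0, -, hacc⟩ := exists_le_accept hpos h.diff.continuous hM
  have hW1 := one_le_W hpos hM hs0
  have hI : 0 < (gaussMass (1 : Matrix (Fin d) (Fin d) ℝ))⁻¹ :=
    inv_pos.2 (gaussMass_pos Matrix.PosDef.one)
  obtain ⟨I, hIdef⟩ : ∃ I, I = (gaussMass (1 : Matrix (Fin d) (Fin d) ℝ))⁻¹ := ⟨_, rfl⟩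
  rw [← hIdef] at hI
  -- Enlarging b is harmless for the drift. The extra m I v is there so that the weight a·vol/(2b)
  -- in the contraction is at most 1.
  obtain ⟨b1, hb1⟩ : ∃ b1, b1 = b + 1 + m * I * v := ⟨_, rfl⟩
  have hmv : 0 ≤ m * I * v := by positivity
  have hb10 : 1 ≤ b1 := by linarith
  obtain ⟨E, hE⟩ : ∃ E, E = |Real.log (4 * b1 / (c * I))| := ⟨_, rfl⟩
  have hE0 : 0 ≤ E := hE ▸ abs_nonneg _
  have hsi : 0 < s⁻¹ := inv_pos.2 hs0
  have hD0 : 0 ≤ 1 + a0 + s⁻¹ * (E + d) := by positivity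
  refine ⟨c * I, b1, m * I, 1 + a0 + s⁻¹ * (E + d), mul_pos hc hI, hb10, mul_pos hm0 hI, hD0,
    by linarith, fun L hL S hS hSL => ?_⟩
  have hSp := posDef_of_smul_one_le hκ hS
  obtain ⟨hcN, hdrift⟩ := hdr S hS
  have hNlow := inv_gaussMass_ge hSp hL hSL
  rw [← hIdef] at hNlow
  have hl0 : 0 ≤ Real.log L := Real.log_nonneg hL
  generalize Real.log L = l at *
  have hc1N : c * I * Real.exp (-(d * l)) ≤ c * (gaussMass S)⁻¹ := by
    rw [mul_assoc]
    exact mul_le_mul_of_nonneg_left hNlow hc.le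
  refine ⟨hc1N.trans hcN, fun x => ?_, fun x hx y hy => ?_⟩
  · have h1 := hdrift x
    have h2 := mul_le_mul_of_nonneg_right hc1N (zero_le_one.trans (hW1 x))
    linarith
  · have hyn : ‖y‖ ≤ 1 := by simpa using (Metric.ball_subset_closedBall hy)
    -- The sublevel height is of order L^d, so log W, and with it ‖x‖, is affine in log L.
    have h1 : Real.log (W π s x) ≤ E + d * l := by
      have h2 := Real.log_le_log (by linarith [hW1 x]) hx
      have h3 : 4 * b1 / (c * I * Real.exp (-(d * l))) =
          4 * b1 / (c * I) * Real.exp (d * l) := by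
        rw [Real.exp_neg]; field_simp
      rw [h3, Real.log_mul (by positivity) (Real.exp_pos _).ne', Real.log_exp] at h2
      linarith [le_abs_self (Real.log (4 * b1 / (c * I)))]
    have h2 : ‖y - x‖ ≤ (1 + a0 + s⁻¹ * (E + d)) * (1 + l) := by
      have h3 := hnorm x
      have h4 : ‖y - x‖ ≤ 1 + ‖x‖ := (norm_sub_le y x).trans (by linarith)
      have h5 : s⁻¹ * Real.log (W π s x) ≤ s⁻¹ * (E + d * l) :=
        mul_le_mul_of_nonneg_left h1 hsi.le
      have h6 : 0 ≤ s⁻¹ * E * l := by positivity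
      have h7 : 0 ≤ s⁻¹ * (d : ℝ) := by positivity
      have h8 : 0 ≤ (1 + a0) * l := by positivity
      linarith
    generalize 1 + a0 + s⁻¹ * (E + d) = D at *
    have h3 : Real.exp (-((D * (1 + l)) ^ 2 / (2 * κ))) ≤ gaussKernel S (y - x) := by
      apply Real.exp_le_exp.2
      have h4 := invQuad_le_of_smul_one_le hκ hS (y - x)
      have h5 : κ⁻¹ * ‖y - x‖ ^ 2 ≤ κ⁻¹ * (D * (1 + l)) ^ 2 := by gcongr
      have h6 : (D * (1 + l)) ^ 2 / (2 * κ) = κ⁻¹ * (D * (1 + l)) ^ 2 / 2 := by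
        field_simp
      rw [h6]
      linarith
    have h4 := hacc x y hy
    have h5 : 0 ≤ (gaussMass S)⁻¹ := inv_nonneg.2 (gaussMass_pos hSp).le
    calc m * I * Real.exp (-(d * l)) * Real.exp (-((D * (1 + l)) ^ 2 / (2 * κ)))
        = m * ((I * Real.exp (-(d * l))) * Real.exp (-((D * (1 + l)) ^ 2 / (2 * κ)))) := by ring
      _ ≤ accept π x y * ((gaussMass S)⁻¹ * gaussKernel S (y - x)) :=
        mul_le_mul h4 (mul_le_mul hNlow h3 (Real.exp_pos _).le h5) (by positivity)
          (accept_nonneg hpos x y)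

/-- Puts the drift and minorization constants in the single form exp(-A(1 + l)²): constants, terms
linear in l and quadratic terms are all bounded by multiples of (1 + l)² ≥ 1. -/
theorem exp_le_min_div_four {c m κ D n l : ℝ} (hc : 0 < c) (hm : 0 < m) (hκ : 0 < κ)
    (hn : 0 ≤ n) (hl : 0 ≤ l) :
    Real.exp (-((|Real.log (c / 4)| + |Real.log (m / 4)| + n + D ^ 2 / (2 * κ)) * (1 + l) ^ 2)) ≤
      min (c * Real.exp (-(n * l)))
        (m * Real.exp (-(n * l)) * Real.exp (-((D * (1 + l)) ^ 2 / (2 * κ)))) / 4 := by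
  have hl1 : 1 ≤ (1 + l) ^ 2 := by nlinarith
  have hl2 : l ≤ (1 + l) ^ 2 := by nlinarith
  have e1 : n * l ≤ n * (1 + l) ^ 2 := mul_le_mul_of_nonneg_left hl2 hn
  have e3 : ∀ t : ℝ, -(|t| * (1 + l) ^ 2) ≤ t := fun t => by
    nlinarith [neg_abs_le t, abs_nonneg t]
  have e4 : ∀ t : ℝ, 0 ≤ |t| * (1 + l) ^ 2 := fun t => by positivity
  have e5 : 0 ≤ D ^ 2 / (2 * κ) * (1 + l) ^ 2 := by positivity
  rw [← min_div_div_right zero_le_four]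
  refine le_min ?_ ?_
  · have h1 : c * Real.exp (-(n * l)) / 4 = Real.exp (Real.log (c / 4) - n * l) := by
      rw [sub_eq_add_neg, Real.exp_add, Real.exp_log (by positivity)]; ring
    rw [h1]
    apply Real.exp_le_exp.2
    have := e3 (Real.log (c / 4))
    have := e4 (Real.log (m / 4))
    linarith
  · have h1 : m * Real.exp (-(n * l)) * Real.exp (-((D * (1 + l)) ^ 2 / (2 * κ))) / 4 =
        Real.exp (Real.log (m / 4) - n * l - D ^ 2 / (2 * κ) * (1 + l) ^ 2) := by
      rw [sub_eq_add_neg, sub_eq_add_neg, Real.exp_add, Real.exp_add,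
        Real.exp_log (by positivity)]
      have : (D * (1 + l)) ^ 2 / (2 * κ) = D ^ 2 / (2 * κ) * (1 + l) ^ 2 := by ring
      rw [this]; ring
    rw [h1]
    apply Real.exp_le_exp.2
    have := e3 (Real.log (m / 4))
    have := e4 (Real.log (c / 4))
    linarith

/-- Geometric ergodicity with a rate depending polylogarithmically on the proposal covariance. -/
theorem IsTarget.exists_rate {ρ β R : ℝ} (h : IsTarget π ρ β R) (hd : 1 ≤ d)
    (hs0 : 0 < s) (hs1 : s < 1) {M : ℝ} (hM : ∀ x, π x ≤ M) (hπ : Integrable π)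
    (hπ1 : ∫ x, π x = 1) {κ : ℝ} (hκ : 0 < κ) :
    ∃ A K : ℝ, 0 ≤ A ∧ 0 ≤ K ∧ ∀ L : ℝ, 1 ≤ L → ∀ S : Matrix (Fin d) (Fin d) ℝ,
      (S - κ • 1).PosSemidef → (L • 1 - S).PosSemidef → ∀ f : 𝔼 → ℝ, Measurable f →
      ∀ C : ℝ, (∀ x, |f x| ≤ C) → ∀ (n : ℕ) (x : 𝔼),
        |(mhOp π (gaussDensity S))^[n] f x - ∫ y, f y * π y| ≤
          K * C * (1 - Real.exp (-(A * (1 + Real.log L) ^ 2))) ^ n * W π s x := by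
  have hpos := h.pos
  have hcont := h.diff.continuous
  obtain ⟨Ce, hCe0, hCe⟩ := h.exists_le_exp_neg_norm
  have hW1 := one_le_W hpos hM hs0
  have hW0 : ∀ x, 0 ≤ W π s x := fun x => zero_le_one.trans (hW1 x)
  have hWπ := integrable_W_mul (s := s) hpos hcont hs1 hCe0 hCe
  have hvB0 : 0 < (volume : Measure 𝔼).real (Metric.ball 0 1) :=
    ENNReal.toReal_pos (Metric.measure_ball_pos _ _ one_pos).ne' measure_ball_lt_top.ne
  obtain ⟨c, b, m, D, hc, hb, hm, hD, hmv, H⟩ := h.exists_drift_minorization hd hs0 hs1 hM hκ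
    ((volume : Measure 𝔼).real (Metric.ball 0 1)) hvB0.le
  have hWi0 : 0 ≤ ∫ y, W π s y * π y := integral_nonneg fun y => mul_nonneg (hW0 y) (hpos y).le
  refine ⟨|Real.log (c / 4)| +
    |Real.log (m * (volume : Measure 𝔼).real (Metric.ball 0 1) / 4)| + d + D ^ 2 / (2 * κ),
    3 + ∫ y, W π s y * π y, by positivity, by positivity, ?_⟩
  intro L hL S hS hSL f hf C hC n x
  obtain ⟨hc1, hdr, hminor⟩ := H L hL S hS hSL
  have hSp := posDef_of_smul_one_le hκ hS
  have hq := isProposal_gaussDensity hSp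
  have hl0 : 0 ≤ Real.log L := Real.log_nonneg hL
  have hτ := exp_le_min_div_four (D := D) hc (mul_pos hm hvB0) hκ (Nat.cast_nonneg d) hl0
  have hWB : IntegrableOn (W π s) (Metric.ball (0 : 𝔼) 1) :=
    ((continuous_W hpos hcont).continuousOn.integrableOn_compact
      (isCompact_closedBall (0 : 𝔼) 1)).mono_set Metric.ball_subset_closedBall
  have e1 : Real.exp (-(d * Real.log L)) ≤ 1 := Real.exp_le_one_iff.2 (by
    have : 0 ≤ (d : ℝ) * Real.log L := by positivity
    linarith)
  have e2 : Real.exp (-((D * (1 + Real.log L)) ^ 2 / (2 * κ))) ≤ 1 := Real.exp_le_one_iff.2 (by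
    have : 0 ≤ (D * (1 + Real.log L)) ^ 2 / (2 * κ) := by positivity
    linarith)
  have ha00 : 0 ≤ m * Real.exp (-(d * Real.log L)) *
    Real.exp (-((D * (1 + Real.log L)) ^ 2 / (2 * κ))) := by positivity
  have ham : m * Real.exp (-(d * Real.log L)) *
      Real.exp (-((D * (1 + Real.log L)) ^ 2 / (2 * κ))) ≤ m * 1 * 1 := by gcongr
  have hc10 : 0 < c * Real.exp (-(d * Real.log L)) := by positivity
  have key := abs_iterate_mhOp_sub_le (V := W π s)
    (c := c * Real.exp (-(d * Real.log L))) (b := b)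
    (a := m * Real.exp (-(d * Real.log L)) *
      Real.exp (-((D * (1 + Real.log L)) ^ 2 / (2 * κ))))
    hpos hcont.measurable hπ hπ1 hq
    (measurable_gaussDensity_right S) hW0 (mhIntegrable_W hpos hcont hs0 hs1 hq) hWπ
    (B := Metric.ball (0 : 𝔼) 1) measurableSet_ball measure_ball_lt_top.ne hWB
    hc1 hc10 (by linarith) hdr ha00 hminor hf hC n x
  have hC0 : 0 ≤ C := (abs_nonneg _).trans (hC 0)
  have hcomm : m * Real.exp (-(d * Real.log L)) *
      Real.exp (-((D * (1 + Real.log L)) ^ 2 / (2 * κ))) *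
        (volume : Measure 𝔼).real (Metric.ball 0 1) =
      m * (volume : Measure 𝔼).real (Metric.ball 0 1) * Real.exp (-(d * Real.log L)) *
      Real.exp (-((D * (1 + Real.log L)) ^ 2 / (2 * κ))) := by ring
  rw [← hcomm] at hτ
  generalize m * Real.exp (-(d * Real.log L)) *
      Real.exp (-((D * (1 + Real.log L)) ^ 2 / (2 * κ))) = a at *
  generalize c * Real.exp (-(d * Real.log L)) = c1 at *
  generalize Real.exp (-((|Real.log (c / 4)| +
    |Real.log (m * (volume : Measure 𝔼).real (Metric.ball 0 1) / 4)| + d + D ^ 2 / (2 * κ)) *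
      (1 + Real.log L) ^ 2)) = τ at *
  generalize (volume : Measure 𝔼).real (Metric.ball 0 1) = vB at *
  have hβ1 : a * vB / (2 * b) ≤ 1 := by
    rw [div_le_one (by linarith)]
    have h2 : a * vB ≤ m * vB := mul_le_mul_of_nonneg_right (by linarith) hvB0.le
    linarith
  have hβ0 : 0 ≤ a * vB / (2 * b) := by positivity
  have hr0 : 0 ≤ 1 - min c1 (a * vB) / 4 := by linarith [min_le_left c1 (a * vB)]
  refine key.trans ?_
  generalize a * vB / (2 * b) = β1 at *
  generalize min c1 (a * vB) / 4 = t at *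
  generalize ∫ y, W π s y * π y = w at *
  have h1 : 2 + β1 * (W π s x + w) ≤ (3 + w) * W π s x := by
    have h2 : β1 * (W π s x + w) ≤ 1 * (W π s x + w) :=
      mul_le_mul_of_nonneg_right hβ1 (add_nonneg (hW0 x) hWi0)
    nlinarith [hW1 x]
  have h0 : 0 ≤ 2 + β1 * (W π s x + w) := by
    have := hW0 x
    positivity
  have h2 : (1 - t) ^ n ≤ (1 - τ) ^ n := pow_le_pow_left₀ hr0 (by linarith) n
  have h3 : 0 ≤ (1 - τ) ^ n := (pow_nonneg hr0 n).trans h2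
  calc C * (1 - t) ^ n * (2 + β1 * (W π s x + w))
      ≤ C * (1 - τ) ^ n * ((3 + w) * W π s x) :=
        mul_le_mul (mul_le_mul_of_nonneg_left h2 hC0) h1 h0 (mul_nonneg hC0 h3)
    _ = _ := by ring

end Rate

/-! ### The Metropolis kernel as an operator -/

noncomputable section Kernel

variable {d : ℕ} {π : EuclideanSpace ℝ (Fin d) → ℝ} {s : ℝ}

local notation "𝔼" => EuclideanSpace ℝ (Fin d)

instance (Γ : Matrix (Fin d) (Fin d) ℝ) (x : 𝔼) : IsProbabilityMeasure (proposal Γ x) := by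
  unfold proposal
  infer_instance

theorem integrable_accept_proposal (hpos : ∀ x, 0 < π x) (hm : Measurable π)
    (Γ : Matrix (Fin d) (Fin d) ℝ) (x : 𝔼) : Integrable (accept π x) (proposal Γ x) :=
  Integrable.of_bound (measurable_accept_right hm x).aestronglyMeasurable 1
    (Eventually.of_forall fun y => by
      rw [Real.norm_of_nonneg (accept_nonneg hpos x y)]
      exact accept_le_one x y)

theorem integral_accept_proposal_le_one (hpos : ∀ x, 0 < π x) (hm : Measurable π)
    (Γ : Matrix (Fin d) (Fin d) ℝ) (x : 𝔼) : ∫ y, accept π x y ∂(proposal Γ x) ≤ 1 := by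
  refine (integral_mono (integrable_accept_proposal hpos hm Γ x) (integrable_const 1)
    fun y => accept_le_one x y).trans ?_
  simp

theorem isProbabilityMeasure_metropolis (hpos : ∀ x, 0 < π x) (hm : Measurable π)
    (Γ : Matrix (Fin d) (Fin d) ℝ) (x : 𝔼) : IsProbabilityMeasure (metropolis π Γ x) := by
  constructor
  have h1 := integral_accept_proposal_le_one hpos hm Γ x
  have h0 : 0 ≤ ∫ y, accept π x y ∂(proposal Γ x) :=
    integral_nonneg fun y => accept_nonneg hpos x y
  rw [metropolis, Measure.add_apply, withDensity_apply _ MeasurableSet.univ,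
    setLIntegral_univ, ← ofReal_integral_eq_lintegral_ofReal
      (integrable_accept_proposal hpos hm Γ x) (Eventually.of_forall (accept_nonneg hpos x)),
    Measure.smul_apply, measure_univ, smul_eq_mul, mul_one,
    ← ENNReal.ofReal_add h0 (by linarith)]
  simp

/-- The rejected mass 1 - ∫ accept sits at x, so the kernel acts as g x plus the expected accepted
increment. This holds for degenerate Γ too. -/
theorem integral_metropolis (hpos : ∀ x, 0 < π x) (hm : Measurable π)
    (Γ : Matrix (Fin d) (Fin d) ℝ) (x : 𝔼) {g : 𝔼 → ℝ} (hg : Measurable g) {C : ℝ}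
    (hC : ∀ x, |g x| ≤ C) :
    ∫ y, g y ∂(metropolis π Γ x) =
      g x + ∫ y, accept π x y * (g y - g x) ∂(proposal Γ x) := by
  have h1 := integral_accept_proposal_le_one hpos hm Γ x
  have := isProbabilityMeasure_metropolis hpos hm Γ x
  have hgi : Integrable g (metropolis π Γ x) :=
    Integrable.of_bound hg.aestronglyMeasurable C (Eventually.of_forall hC)
  have hacc := integrable_accept_proposal hpos hm Γ x
  have hag : Integrable (fun y => accept π x y * g y) (proposal Γ x) :=
    hacc.mul_bdd (c := C) hg.aestronglyMeasurable (Eventually.of_forall hC)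
  rw [metropolis] at hgi ⊢
  rw [integral_add_measure (hgi.mono_measure (Measure.le_add_right le_rfl))
    (hgi.mono_measure (Measure.le_add_left le_rfl)), integral_smul_measure, integral_dirac,
    integral_withDensity_eq_integral_toReal_smul
      (measurable_accept_right hm x).ennreal_ofReal (by simp),
    ENNReal.toReal_ofReal (by linarith)]
  simp_rw [ENNReal.toReal_ofReal (accept_nonneg hpos x _), smul_eq_mul, mul_sub]
  rw [integral_sub hag (hacc.mul_const _), integral_mul_const]
  ring

theorem integral_metropolis_eq_mhOp (hpos : ∀ x, 0 < π x) (hm : Measurable π)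
    {Γ : Matrix (Fin d) (Fin d) ℝ} (hΓ : (((2.38 : ℝ) ^ 2 / (d : ℝ)) • Γ).PosDef) (x : 𝔼)
    {g : 𝔼 → ℝ} (hg : Measurable g) {C : ℝ} (hC : ∀ x, |g x| ≤ C) :
    ∫ y, g y ∂(metropolis π Γ x) =
      mhOp π (gaussDensity (((2.38 : ℝ) ^ 2 / (d : ℝ)) • Γ)) g x := by
  have hmeas : Measurable fun y : 𝔼 => ENNReal.ofReal
      (gaussDensity (((2.38 : ℝ) ^ 2 / (d : ℝ)) • Γ) (y - x)) :=
    ((measurable_gaussDensity_right _).comp (measurable_id.sub_const x)).ennreal_ofReal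
  rw [integral_metropolis hpos hm Γ x hg hC, mhOp, proposal,
    multivariateGaussian_eq_withDensity hΓ, integral_withDensity_eq_integral_toReal_smul hmeas
      (by simp)]
  congr 1
  refine integral_congr_ae (Eventually.of_forall fun y => ?_)
  simp only [smul_eq_mul]
  rw [ENNReal.toReal_ofReal (gaussDensity_pos hΓ _).le, mul_comm]

theorem accept_mul_W_le (hpos : ∀ x, 0 < π x) (hs0 : 0 < s) (hs1 : s < 1) (x y : 𝔼) :
    accept π x y * W π s y ≤ W π s x := by
  have hv : 0 ≤ ⨆ y, |π y ^ s| := Real.iSup_nonneg fun y => abs_nonneg _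
  have := mul_le_mul_of_nonneg_right (min_one_mul_rpow_le hpos hs0 hs1 x y) hv
  rw [mul_assoc] at this
  exact this

theorem W_nonneg (hpos : ∀ x, 0 < π x) (x : 𝔼) : 0 ≤ W π s x :=
  mul_nonneg (Real.rpow_nonneg (hpos x).le _) (Real.iSup_nonneg fun _ => abs_nonneg _)

/-- Whatever the proposal, one Metropolis step at most doubles the mean of `W`. -/
theorem integral_min_W_metropolis_le (hpos : ∀ x, 0 < π x) (hc : Continuous π) (hs0 : 0 < s)
    (hs1 : s < 1) (Γ : Matrix (Fin d) (Fin d) ℝ) (x : 𝔼) (k : ℕ) :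
    ∫ y, min (W π s y) k ∂(metropolis π Γ x) ≤ 2 * W π s x := by
  have hg : Measurable fun y : 𝔼 => min (W π s y) (k : ℝ) :=
    (continuous_W hpos hc).measurable.min measurable_const
  have hg0 : ∀ y : 𝔼, 0 ≤ min (W π s y) (k : ℝ) := fun y => le_min (W_nonneg hpos y)
    (Nat.cast_nonneg k)
  rw [integral_metropolis hpos hc.measurable Γ x hg (C := k) fun y => by
    rw [abs_of_nonneg (hg0 y)]; exact min_le_right _ _]
  have h1 : ∀ y, accept π x y * (min (W π s y) k - min (W π s x) k) ≤ W π s x := by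
    intro y
    refine le_trans ?_ (accept_mul_W_le hpos hs0 hs1 x y)
    refine mul_le_mul_of_nonneg_left ?_ (accept_nonneg hpos x y)
    linarith [hg0 x, min_le_left (W π s y) (k : ℝ)]
  have h2 : ∫ y, accept π x y * (min (W π s y) k - min (W π s x) k) ∂(proposal Γ x) ≤
      W π s x := by
    by_cases hi : Integrable (fun y => accept π x y * (min (W π s y) k - min (W π s x) k))
      (proposal Γ x)
    · refine (integral_mono hi (integrable_const (W π s x)) h1).trans ?_
      simp
    · rw [integral_undef hi]
      exact W_nonneg hpos x
  linarith [min_le_left (W π s x) (k : ℝ)]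

/-! ### Running mean and covariance recursions -/

/-- The running-mean and covariance recursions keep everything inside a ball. -/
theorem norm_mean_le {x m : ℕ → 𝔼} {n : ℕ} {r : ℝ} (h0 : m 0 = 0)
    (hm : ∀ n, m (n + 1) = m n + (1 / ((n : ℝ) + 1)) • (x (n + 1) - m n))
    (hx : ∀ k ≤ n, ‖x k‖ ≤ r) : ∀ k ≤ n, ‖m k‖ ≤ r := by
  intro k
  induction k with
  | zero => intro _; rw [h0, norm_zero]; exact (norm_nonneg _).trans (hx 0 (Nat.zero_le n))
  | succ k ih =>
    intro hk
    have hk1 : (0 : ℝ) < (k : ℝ) + 1 := by positivity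
    have h1 : m (k + 1) = ((k : ℝ) / (k + 1)) • m k + (1 / ((k : ℝ) + 1)) • x (k + 1) := by
      rw [hm, smul_sub]
      have : (k : ℝ) / (k + 1) = 1 - 1 / ((k : ℝ) + 1) := by field_simp; ring
      rw [this, sub_smul, one_smul]
      abel
    rw [h1]
    refine (norm_add_le _ _).trans ?_
    rw [norm_smul, norm_smul, Real.norm_of_nonneg (by positivity),
      Real.norm_of_nonneg (by positivity)]
    calc (k : ℝ) / (k + 1) * ‖m k‖ + 1 / ((k : ℝ) + 1) * ‖x (k + 1)‖
        ≤ (k : ℝ) / (k + 1) * r + 1 / ((k : ℝ) + 1) * r := by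
          gcongr
          · exact ih (by omega)
          · exact hx _ hk
      _ = r := by field_simp

/-- This is the Cauchy–Schwarz inequality (v·z)² ≤ ‖v‖²‖z‖². -/
theorem posSemidef_sq_norm_sub_vecMulVec (v : 𝔼) :
    ((‖v‖ ^ 2) • (1 : Matrix (Fin d) (Fin d) ℝ) - Matrix.vecMulVec v.ofLp v.ofLp).PosSemidef := by
  refine Matrix.PosSemidef.of_dotProduct_mulVec_nonneg ?_ fun z => ?_
  · refine Matrix.IsHermitian.sub ?_ ?_
    · ext i j; simp [Matrix.one_apply, eq_comm]
    · ext i j; simp [Matrix.vecMulVec_apply, mul_comm]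
  · have h1 : ‖v‖ ^ 2 = v.ofLp ⬝ᵥ v.ofLp := by
      rw [EuclideanSpace.norm_sq_eq, dotProduct]
      simp [sq]
    have h2 : Matrix.mulVec (Matrix.vecMulVec v.ofLp v.ofLp) z = (v.ofLp ⬝ᵥ z) • v.ofLp := by
      ext i
      simp [Matrix.mulVec, dotProduct, Matrix.vecMulVec_apply, Finset.sum_mul]
      refine Finset.sum_congr rfl fun j _ => by ring
    rw [Matrix.sub_mulVec, Matrix.smul_mulVec, Matrix.one_mulVec, h2, dotProduct_sub,
      dotProduct_smul, dotProduct_smul, h1]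
    have h3 : star z = z := by ext i; simp
    rw [h3, smul_eq_mul, smul_eq_mul, dotProduct_comm z v.ofLp]
    have := Finset.sum_mul_sq_le_sq_mul_sq Finset.univ v.ofLp z
    simp only [dotProduct]
    simp only [sq] at this
    linarith

theorem posSemidef_vecMulVec_self (v : 𝔼) :
    (Matrix.vecMulVec v.ofLp v.ofLp).PosSemidef := by
  have := Matrix.posSemidef_vecMulVec_self_star v.ofLp
  simpa using this

section Cov

variable {v : ℕ → EuclideanSpace ℝ (Fin d)} {Γ : ℕ → Matrix (Fin d) (Fin d) ℝ} {κ : ℝ}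

/-- Each update is a convex combination of the old covariance with vvᵀ + κI. At n = 0 the old one
has weight 0, so the initial covariance is forgotten after a single step. -/
theorem posSemidef_cov_sub
    (h : ∀ n, Γ (n + 1) = ((n : ℝ) / ((n : ℝ) + 1)) • Γ n + (1 / ((n : ℝ) + 1)) •
      (Matrix.vecMulVec (v n).ofLp (v n).ofLp + κ • (1 : Matrix (Fin d) (Fin d) ℝ))) (n : ℕ) :
    (Γ (n + 1) - κ • 1).PosSemidef := by
  induction n with
  | zero =>
    have h1 : Γ (0 + 1) - κ • 1 = Matrix.vecMulVec (v 0).ofLp (v 0).ofLp := by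
      rw [h]; simp
    rw [h1]
    exact posSemidef_vecMulVec_self _
  | succ n ih =>
    have h1 : Γ (n + 1 + 1) - κ • 1 = (((n + 1 : ℕ) : ℝ) / (((n + 1 : ℕ) : ℝ) + 1)) •
        (Γ (n + 1) - κ • 1) + (1 / (((n + 1 : ℕ) : ℝ) + 1)) •
          Matrix.vecMulVec (v (n + 1)).ofLp (v (n + 1)).ofLp := by
      rw [h]
      have : (0 : ℝ) < ((n + 1 : ℕ) : ℝ) + 1 := by positivity
      ext i j
      simp only [Matrix.add_apply, Matrix.sub_apply, Matrix.smul_apply, smul_eq_mul]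
      field_simp
      ring
    rw [h1]
    exact (ih.smul (by positivity)).add ((posSemidef_vecMulVec_self _).smul (by positivity))

theorem posSemidef_sub_cov
    (h : ∀ n, Γ (n + 1) = ((n : ℝ) / ((n : ℝ) + 1)) • Γ n + (1 / ((n : ℝ) + 1)) •
      (Matrix.vecMulVec (v n).ofLp (v n).ofLp + κ • (1 : Matrix (Fin d) (Fin d) ℝ)))
    {n : ℕ} {r : ℝ} (hv : ∀ k < n, ‖v k‖ ≤ r) (k : ℕ) (hk : k + 1 ≤ n) :
    ((r ^ 2 + κ) • 1 - Γ (k + 1)).PosSemidef := by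
  have key : ∀ w : 𝔼, ‖w‖ ≤ r →
      (r ^ 2 • (1 : Matrix (Fin d) (Fin d) ℝ) - Matrix.vecMulVec w.ofLp w.ofLp).PosSemidef := by
    intro w hw
    have h1 : r ^ 2 • (1 : Matrix (Fin d) (Fin d) ℝ) - Matrix.vecMulVec w.ofLp w.ofLp =
      (‖w‖ ^ 2 • (1 : Matrix (Fin d) (Fin d) ℝ) - Matrix.vecMulVec w.ofLp w.ofLp) +
        (r ^ 2 - ‖w‖ ^ 2) • 1 := by rw [sub_smul]; abel
    rw [h1]
    exact (posSemidef_sq_norm_sub_vecMulVec w).add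
      (Matrix.PosSemidef.one.smul (sub_nonneg.2 (pow_le_pow_left₀ (norm_nonneg _) hw 2)))
  induction k with
  | zero =>
    have h1 : (r ^ 2 + κ) • 1 - Γ (0 + 1) =
        r ^ 2 • (1 : Matrix (Fin d) (Fin d) ℝ) - Matrix.vecMulVec (v 0).ofLp (v 0).ofLp := by
      rw [h]; simp [add_smul]
    rw [h1]
    exact key _ (hv 0 (by omega))
  | succ k ih =>
    have h1 : (r ^ 2 + κ) • 1 - Γ (k + 1 + 1) = (((k + 1 : ℕ) : ℝ) / (((k + 1 : ℕ) : ℝ) + 1)) •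
        ((r ^ 2 + κ) • 1 - Γ (k + 1)) + (1 / (((k + 1 : ℕ) : ℝ) + 1)) •
          (r ^ 2 • (1 : Matrix (Fin d) (Fin d) ℝ) -
            Matrix.vecMulVec (v (k + 1)).ofLp (v (k + 1)).ofLp) := by
      rw [h]
      have : (0 : ℝ) < ((k + 1 : ℕ) : ℝ) + 1 := by positivity
      ext i j
      simp only [Matrix.add_apply, Matrix.sub_apply, Matrix.smul_apply, smul_eq_mul]
      field_simp
      ring
    rw [h1]
    exact ((ih (by omega)).smul (by positivity)).add
      ((key _ (hv _ (by omega))).smul (by positivity))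

/-- Two consecutive proposals are close in total variation. -/
theorem integral_abs_gaussDensity_succ_sub_le (hκ : 0 < κ)
    (h : ∀ n, Γ (n + 1) = ((n : ℝ) / ((n : ℝ) + 1)) • Γ n + (1 / ((n : ℝ) + 1)) •
      (Matrix.vecMulVec (v n).ofLp (v n).ofLp + κ • (1 : Matrix (Fin d) (Fin d) ℝ)))
    {c : ℝ} (hc : 0 < c) {n : ℕ} (hn : 1 ≤ n) :
    ∫ z, |gaussDensity (c • Γ (n + 1)) z - gaussDensity (c • Γ n) z| ≤
      4 * d * (1 / ((n : ℝ) + 1) * (2 + ‖v n‖ ^ 2 / κ)) := by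
  obtain ⟨n, rfl⟩ : ∃ k, n = k + 1 := ⟨n - 1, by omega⟩
  have hΓ := posSemidef_cov_sub h n
  have hn1 : (0 : ℝ) < ((n + 1 : ℕ) : ℝ) := by positivity
  have hS : (c • Γ (n + 1)).PosDef := (posDef_of_smul_one_le hκ hΓ).smul hc
  have hs := h (n + 1)
  generalize ((n + 1 : ℕ) : ℝ) = t at *
  -- η is the weight taken off the old covariance. The upper constant comes from vvᵀ ≤ ‖v‖²I and κI
  -- ≤ Γ: the update adds at most (1 + ‖v‖²/κ)Γ with weight 1/(t + 1).
  have key := integral_abs_gaussDensity_sub_le (S := c • Γ (n + 1)) (S' := c • Γ (n + 1 + 1))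
    (η := 1 / (t + 1)) (C := 1 + 1 / (t + 1) * (1 + ‖v (n + 1)‖ ^ 2 / κ)) hS (by positivity)
    (by rw [div_lt_one (by positivity)]; linarith) (le_add_of_nonneg_right (by positivity)) ?_ ?_
  · refine key.trans (le_of_eq ?_)
    ring
  · have h1 : c • Γ (n + 1 + 1) - (1 - 1 / (t + 1)) • c • Γ (n + 1) =
        (c * (1 / (t + 1))) • (Matrix.vecMulVec (v (n + 1)).ofLp (v (n + 1)).ofLp + κ • 1) := by
      rw [hs]
      ext i j
      simp only [Matrix.add_apply, Matrix.sub_apply, Matrix.smul_apply, smul_eq_mul]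
      field_simp
      ring
    rw [h1]
    exact ((posSemidef_vecMulVec_self _).add (Matrix.PosSemidef.one.smul hκ.le)).smul
      (by positivity)
  · have h1 : (1 + 1 / (t + 1) * (1 + ‖v (n + 1)‖ ^ 2 / κ)) • c • Γ (n + 1) -
        c • Γ (n + 1 + 1) = (c * (1 / (t + 1))) • (Γ (n + 1) +
          (((1 + ‖v (n + 1)‖ ^ 2 / κ)) • (Γ (n + 1) - κ • 1) +
          (‖v (n + 1)‖ ^ 2 • 1 - Matrix.vecMulVec (v (n + 1)).ofLp (v (n + 1)).ofLp))) := by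
      rw [hs]
      ext i j
      simp only [Matrix.add_apply, Matrix.sub_apply, Matrix.smul_apply, smul_eq_mul]
      field_simp
      ring
    rw [h1]
    exact ((posDef_of_smul_one_le hκ hΓ).posSemidef.add ((hΓ.smul (by positivity)).add
      (posSemidef_sq_norm_sub_vecMulVec _))).smul (by positivity)

theorem integral_abs_gaussDensity_add_sub_le (hκ : 0 < κ)
    (h : ∀ n, Γ (n + 1) = ((n : ℝ) / ((n : ℝ) + 1)) • Γ n + (1 / ((n : ℝ) + 1)) •
      (Matrix.vecMulVec (v n).ofLp (v n).ofLp + κ • (1 : Matrix (Fin d) (Fin d) ℝ)))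
    {c : ℝ} (hc : 0 < c) {n : ℕ} (hn : 1 ≤ n) {r : ℝ} (j : ℕ) (hv : ∀ k < n + j, ‖v k‖ ≤ r) :
    ∫ z, |gaussDensity (c • Γ (n + j)) z - gaussDensity (c • Γ n) z| ≤
      j * (4 * d * (1 / (n : ℝ) * (2 + r ^ 2 / κ))) := by
  have hpd : ∀ k, 1 ≤ k → (c • Γ k).PosDef := fun k hk => by
    obtain ⟨k, rfl⟩ : ∃ i, k = i + 1 := ⟨k - 1, by omega⟩
    exact (posDef_of_smul_one_le hκ (posSemidef_cov_sub h k)).smul hc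
  have hint : ∀ k, 1 ≤ k → Integrable (gaussDensity (c • Γ k)) := fun k hk =>
    integrable_gaussDensity (hpd k hk)
  induction j with
  | zero => simp
  | succ j ih =>
    have h1 := ih fun k hk => hv k (by omega)
    have h2 := integral_abs_gaussDensity_succ_sub_le hκ h hc (n := n + j) (by omega)
    have hn0 : (0 : ℝ) < n := by exact_mod_cast hn
    have h3 : 4 * (d : ℝ) * (1 / (((n + j : ℕ) : ℝ) + 1) * (2 + ‖v (n + j)‖ ^ 2 / κ)) ≤
        4 * d * (1 / (n : ℝ) * (2 + r ^ 2 / κ)) := by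
      have h4 : ‖v (n + j)‖ ≤ r := hv _ (by omega)
      have h5 : (n : ℝ) ≤ ((n + j : ℕ) : ℝ) + 1 := by push_cast; linarith [Nat.cast_nonneg (α := ℝ) j]
      gcongr
    have h4 : ∫ z, |gaussDensity (c • Γ (n + (j + 1))) z - gaussDensity (c • Γ n) z| ≤
        (∫ z, |gaussDensity (c • Γ (n + j + 1)) z - gaussDensity (c • Γ (n + j)) z|) +
        ∫ z, |gaussDensity (c • Γ (n + j)) z - gaussDensity (c • Γ n) z| := by
      have i1 : Integrable fun z => |gaussDensity (c • Γ (n + j + 1)) z -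
          gaussDensity (c • Γ (n + j)) z| := ((hint (n + j + 1) (by omega)).sub (hint (n + j) (by omega))).abs
      have i2 : Integrable fun z => |gaussDensity (c • Γ (n + j)) z - gaussDensity (c • Γ n) z| :=
        ((hint (n + j) (by omega)).sub (hint n hn)).abs
      rw [← integral_add i1 i2]
      refine integral_mono ((hint (n + (j + 1)) (by omega)).sub (hint n hn)).abs (i1.add i2)
        fun z => ?_
      exact abs_sub_le _ _ _
    push_cast
    linarith

end Cov

end Kernel

/-! ### One step of the process and growth of W -/

noncomputable section Trajectory

/-- Freezing lemma: since Z is known to F, conditioning identifies the joint law of (Z, Y) on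
rectangles with the one built from P and the kernel, and rectangles determine the law. -/
theorem integral_comp_of_condExp {Ω α Θ : Type*} {F : MeasurableSpace Ω}
    [mΩ : MeasurableSpace Ω] [MeasurableSpace α] [MeasurableSpace Θ] {P : Measure Ω}
    [IsProbabilityMeasure P] (hF : F ≤ mΩ) {Z : Ω → Θ} (hZ : Measurable[F] Z) {Y : Ω → α} (hY : Measurable Y)
    {η : Kernel Ω α} [IsMarkovKernel η]
    (hη : ∀ g : α → ℝ, Measurable g → (∃ C : ℝ, ∀ x, |g x| ≤ C) →
      P[fun ω => g (Y ω) | F] =ᵐ[P] fun ω => ∫ y, g y ∂(η ω))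
    {G : Θ → α → ℝ} (hG : Measurable fun p : Θ × α => G p.1 p.2) {C : ℝ}
    (hC : ∀ ω y, |G (Z ω) y| ≤ C) :
    ∫ ω, G (Z ω) (Y ω) ∂P = ∫ ω, ∫ y, G (Z ω) y ∂(η ω) ∂P := by
  have hZ' : Measurable Z := hZ.mono hF le_rfl
  have hm1 : Measurable fun ω => (Z ω, Y ω) := hZ'.prodMk hY
  have hm2 : Measurable fun p : Ω × α => (Z p.1, p.2) :=
    (hZ'.comp measurable_fst).prodMk measurable_snd
  have hmeas : P.map (fun ω => (Z ω, Y ω)) = (P ⊗ₘ η).map (fun p => (Z p.1, p.2)) := by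
    have := Measure.isProbabilityMeasure_map (μ := P) hm1.aemeasurable
    refine Measure.ext_prod fun {s t} hs ht => ?_
    rw [Measure.map_apply hm1 (hs.prod ht), Measure.map_apply hm2 (hs.prod ht)]
    have e1 : (fun ω => (Z ω, Y ω)) ⁻¹' s ×ˢ t = Z ⁻¹' s ∩ Y ⁻¹' t := rfl
    have e2 : (fun p : Ω × α => (Z p.1, p.2)) ⁻¹' s ×ˢ t = (Z ⁻¹' s) ×ˢ t := rfl
    rw [e1, e2, Measure.compProd_apply_prod (hZ' hs) ht]
    have hsF : MeasurableSet[F] (Z ⁻¹' s) := hZ hs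
    have hg : Measurable (t.indicator fun _ => (1 : ℝ)) := measurable_const.indicator ht
    have hgb : ∀ x, |t.indicator (fun _ => (1 : ℝ)) x| ≤ 1 := fun x => by
      by_cases hx : x ∈ t <;> simp [hx]
    have hi : Integrable (fun ω => t.indicator (fun _ => (1 : ℝ)) (Y ω)) P :=
      Integrable.of_bound (hg.comp hY).aestronglyMeasurable 1 (Eventually.of_forall fun ω => hgb _)
    have h1 := setIntegral_condExp hF hi hsF
    rw [setIntegral_congr_ae (hF _ hsF) ((hη _ hg ⟨1, hgb⟩).mono fun ω h _ => h)] at h1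
    have h2 : ∫ ω in Z ⁻¹' s, t.indicator (fun _ => (1 : ℝ)) (Y ω) ∂P =
        (P (Z ⁻¹' s ∩ Y ⁻¹' t)).toReal := by
      have : (fun ω => t.indicator (fun _ => (1 : ℝ)) (Y ω)) =
        (Y ⁻¹' t).indicator fun _ => (1 : ℝ) := rfl
      rw [this, setIntegral_indicator (hY ht), setIntegral_const, smul_eq_mul, mul_one]
      rfl
    have h3 : ∫ ω in Z ⁻¹' s, ∫ y, t.indicator (fun _ => (1 : ℝ)) y ∂(η ω) ∂P =
        (∫⁻ ω in Z ⁻¹' s, η ω t ∂P).toReal := by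
      rw [← integral_toReal (Kernel.measurable_coe η ht).aemeasurable
        (Eventually.of_forall fun ω => measure_lt_top _ _)]
      refine integral_congr_ae (Eventually.of_forall fun ω => ?_)
      simp only
      rw [integral_indicator ht, setIntegral_const, smul_eq_mul, mul_one]
      rfl
    rw [h2, h3] at h1
    refine ((ENNReal.toReal_eq_toReal_iff' ?_ (measure_ne_top _ _)).1 h1).symm
    refine ne_top_of_le_ne_top (measure_ne_top P (Z ⁻¹' s)) ?_
    refine (lintegral_mono fun ω => prob_le_one).trans ?_
    simp
  have hGm : StronglyMeasurable fun p : Θ × α => G p.1 p.2 := hG.stronglyMeasurable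
  have h1 : ∫ ω, G (Z ω) (Y ω) ∂P = ∫ p, G p.1 p.2 ∂(P.map fun ω => (Z ω, Y ω)) :=
    (integral_map hm1.aemeasurable hGm.aestronglyMeasurable).symm
  rw [h1, hmeas, integral_map hm2.aemeasurable hGm.aestronglyMeasurable]
  exact Measure.integral_compProd (Integrable.of_bound
    (hG.comp hm2).aestronglyMeasurable C (Eventually.of_forall fun p => hC p.1 p.2))

/-- Monotone convergence. Truncation is forced because the transition property only tests bounded
functions. -/
theorem integrable_of_forall_integral_min_le {Ω : Type*} [MeasurableSpace Ω] {P : Measure Ω}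
    [IsProbabilityMeasure P] {Y : Ω → ℝ} (hY : Measurable Y) (h0 : ∀ ω, 0 ≤ Y ω) {B : ℝ}
    (h : ∀ k : ℕ, ∫ ω, min (Y ω) k ∂P ≤ B) : Integrable Y P ∧ ∫ ω, Y ω ∂P ≤ B := by
  have hk0 : ∀ (k : ℕ) ω, 0 ≤ min (Y ω) (k : ℝ) := fun k ω => le_min (h0 ω) (Nat.cast_nonneg k)
  have hB : 0 ≤ B := (integral_nonneg (hk0 0)).trans (h 0)
  have hkm : ∀ k : ℕ, Measurable fun ω => min (Y ω) (k : ℝ) := fun k => hY.min measurable_const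
  have hki : ∀ k : ℕ, Integrable (fun ω => min (Y ω) (k : ℝ)) P := fun k =>
    Integrable.of_bound (hkm k).aestronglyMeasurable k (Eventually.of_forall fun ω => by
      rw [Real.norm_of_nonneg (hk0 k ω)]; exact min_le_right _ _)
  have h1 : ∫⁻ ω, ENNReal.ofReal (Y ω) ∂P ≤ ENNReal.ofReal B := by
    have e1 : ∀ ω, ENNReal.ofReal (Y ω) = ⨆ k : ℕ, ENNReal.ofReal (min (Y ω) k) := by
      intro ω
      apply le_antisymm
      · obtain ⟨k, hk⟩ := exists_nat_ge (Y ω)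
        refine le_trans (le_of_eq ?_) (le_iSup _ k)
        rw [min_eq_left hk]
      · exact iSup_le fun k => ENNReal.ofReal_le_ofReal (min_le_left _ _)
    simp_rw [e1]
    rw [lintegral_iSup (fun k => (hkm k).ennreal_ofReal) (fun i j hij ω =>
      ENNReal.ofReal_le_ofReal (min_le_min le_rfl (Nat.cast_le.2 hij)))]
    refine iSup_le fun k => ?_
    rw [← ofReal_integral_eq_lintegral_ofReal (hki k) (Eventually.of_forall (hk0 k))]
    exact ENNReal.ofReal_le_ofReal (h k)
  have hi : Integrable Y P := by
    refine ⟨hY.aestronglyMeasurable, ?_⟩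
    rw [hasFiniteIntegral_iff_ofReal (Eventually.of_forall h0)]
    exact h1.trans_lt ENNReal.ofReal_lt_top
  refine ⟨hi, ?_⟩
  rw [← ofReal_integral_eq_lintegral_ofReal hi (Eventually.of_forall h0)] at h1
  exact (ENNReal.ofReal_le_ofReal_iff hB).1 h1

variable {d : ℕ} {π : EuclideanSpace ℝ (Fin d) → ℝ} {s κ : ℝ} {Ω : Type*}
  [mΩ : MeasurableSpace Ω] {P : Measure Ω} {ℱ : Filtration ℕ mΩ}
  {X m : ℕ → Ω → EuclideanSpace ℝ (Fin d)} {Γ : ℕ → Ω → Matrix (Fin d) (Fin d) ℝ}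

local notation "𝔼" => EuclideanSpace ℝ (Fin d)

theorem IsAdaptiveMetropolis.measurable_state (h : IsAdaptiveMetropolis P ℱ π κ X m Γ) (n : ℕ) :
    Measurable (X n) := (h.adapted_state n).mono (ℱ.le n) le_rfl

/-- The covariance process with values in a space that carries a measurable structure. -/
theorem IsAdaptiveMetropolis.measurable_cov (h : IsAdaptiveMetropolis P ℱ π κ X m Γ) (n : ℕ) :
    Measurable[ℱ n] (fun ω => (fun i j => Γ n ω i j : Fin d → Fin d → ℝ)) :=
  @measurable_pi_lambda _ _ _ (ℱ n) _ _ fun i =>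
    @measurable_pi_lambda _ _ _ (ℱ n) _ _ fun j => h.adapted_cov n i j

theorem IsAdaptiveMetropolis.posSemidef_cov_sub (h : IsAdaptiveMetropolis P ℱ π κ X m Γ) {n : ℕ}
    (hn : 1 ≤ n) (ω : Ω) : (Γ n ω - κ • 1).PosSemidef := by
  obtain ⟨n, rfl⟩ : ∃ k, n = k + 1 := ⟨n - 1, by omega⟩
  exact AdaptiveMetropolis.posSemidef_cov_sub (v := fun n => X (n + 1) ω - m n ω)
    (Γ := fun n => Γ n ω) (fun n => h.cov_succ n ω) n

theorem posSemidef_smul_sub {Γ : Matrix (Fin d) (Fin d) ℝ} {c κ : ℝ} (hc : 0 ≤ c)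
    (h : (Γ - κ • 1).PosSemidef) : (c • Γ - (c * κ) • 1).PosSemidef := by
  have : c • Γ - (c * κ) • 1 = c • (Γ - κ • 1) := by rw [smul_sub, smul_smul]
  rw [this]
  exact h.smul hc

theorem IsAdaptiveMetropolis.posDef_smul_cov (h : IsAdaptiveMetropolis P ℱ π κ X m Γ)
    (hκ : 0 < κ) {c : ℝ} (hc : 0 < c) {n : ℕ} (hn : 1 ≤ n) (ω : Ω) : (c • Γ n ω).PosDef :=
  (posDef_of_smul_one_le hκ (h.posSemidef_cov_sub hn ω)).smul hc

theorem measurable_gaussDensity_smul (c : ℝ) : Measurable fun p : (Fin d → Fin d → ℝ) × 𝔼 =>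
    gaussDensity (c • Matrix.of p.1) p.2 := by
  have h1 : Measurable fun p : (Fin d → Fin d → ℝ) × 𝔼 =>
      ((fun i j => c * p.1 i j : Fin d → Fin d → ℝ), p.2) := by
    refine Measurable.prodMk ?_ measurable_snd
    refine measurable_pi_lambda _ fun i => measurable_pi_lambda _ fun j => ?_
    have : Measurable fun p : (Fin d → Fin d → ℝ) × 𝔼 => p.1 i j :=
      (measurable_pi_apply j).comp ((measurable_pi_apply i).comp measurable_fst)
    exact this.const_mul c
  have h2 : ∀ θ : Fin d → Fin d → ℝ, c • Matrix.of θ = Matrix.of fun i j => c * θ i j :=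
    fun θ => by ext i j; rfl
  have h3 : (fun p : (Fin d → Fin d → ℝ) × 𝔼 => gaussDensity (c • Matrix.of p.1) p.2) =
      (fun p : (Fin d → Fin d → ℝ) × 𝔼 => gaussDensity (Matrix.of p.1) p.2) ∘
        fun p => ((fun i j => c * p.1 i j : Fin d → Fin d → ℝ), p.2) := by
    funext p
    rw [h2]
    rfl
  rw [h3]
  exact Measurable.comp measurable_gaussDensity h1

theorem measurable_mhOp_gaussDensity_smul (hm : Measurable π) (c : ℝ)
    {g : (Fin d → Fin d → ℝ) → 𝔼 → ℝ}
    (hg : Measurable fun p : (Fin d → Fin d → ℝ) × 𝔼 => g p.1 p.2) :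
    Measurable fun p : (Fin d → Fin d → ℝ) × 𝔼 =>
      mhOp π (gaussDensity (c • Matrix.of p.1)) (g p.1) p.2 :=
  measurable_mhOp_param (Q := fun θ => gaussDensity (c • Matrix.of θ)) hm
    (measurable_gaussDensity_smul c) hg

/-- One step of the process, tested against a function depending on the past. -/
theorem IsAdaptiveMetropolis.integral_succ [IsProbabilityMeasure P]
    (h : IsAdaptiveMetropolis P ℱ π κ X m Γ) (hd : 1 ≤ d) (hpos : ∀ x, 0 < π x)
    (hm : Measurable π) (hκ : 0 < κ) {n : ℕ} (hn : 1 ≤ n) {Θ : Type*} [MeasurableSpace Θ]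
    {Z : Ω → Θ} (hZ : Measurable[ℱ n] Z) {G : Θ → 𝔼 → ℝ}
    (hG : Measurable fun p : Θ × 𝔼 => G p.1 p.2) {C : ℝ} (hC : ∀ ω y, |G (Z ω) y| ≤ C) :
    ∫ ω, G (Z ω) (X (n + 1) ω) ∂P =
      ∫ ω, mhOp π (gaussDensity (((2.38 : ℝ) ^ 2 / (d : ℝ)) • Γ n ω)) (G (Z ω)) (X n ω) ∂P := by
  have hc : 0 < (2.38 : ℝ) ^ 2 / (d : ℝ) := by
    have : (0 : ℝ) < d := by exact_mod_cast hd
    positivity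
  have hS := fun ω => h.posDef_smul_cov hκ hc hn ω
  have hprob : ∀ ω, IsProbabilityMeasure (metropolis π (Γ n ω) (X n ω)) := fun ω =>
    isProbabilityMeasure_metropolis hpos hm _ _
  have hΓm : Measurable (fun ω => (fun i j => Γ n ω i j : Fin d → Fin d → ℝ)) :=
    (h.measurable_cov n).mono (ℱ.le n) le_rfl
  -- The mass given to a set is the operator applied to its indicator, jointly measurable in
  -- covariance and state; this uses positive definiteness, hence n ≥ 1.
  have hker : Measurable fun ω => metropolis π (Γ n ω) (X n ω) := by
    refine Measure.measurable_of_measurable_coe _ fun t ht => ?_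
    have hg : Measurable (t.indicator fun _ => (1 : ℝ)) := measurable_const.indicator ht
    have hgb : ∀ x, |t.indicator (fun _ => (1 : ℝ)) x| ≤ 1 := fun x => by
      by_cases hx : x ∈ t <;> simp [hx]
    have h1 : ∀ ω, metropolis π (Γ n ω) (X n ω) t = ENNReal.ofReal
        (mhOp π (gaussDensity (((2.38 : ℝ) ^ 2 / (d : ℝ)) • Γ n ω))
          (t.indicator fun _ => (1 : ℝ)) (X n ω)) := by
      intro ω
      rw [← integral_metropolis_eq_mhOp hpos hm (hS ω) _ hg hgb, integral_indicator ht,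
        setIntegral_const, smul_eq_mul, mul_one, Measure.real, ENNReal.ofReal_toReal
          (measure_ne_top _ _)]
    simp_rw [h1]
    refine ENNReal.measurable_ofReal.comp ?_
    generalize (2.38 : ℝ) ^ 2 / (d : ℝ) = c
    have h2 : Measurable fun p : (Fin d → Fin d → ℝ) × 𝔼 =>
        mhOp π (gaussDensity (c • Matrix.of p.1)) (t.indicator fun _ => (1 : ℝ)) p.2 :=
      measurable_mhOp_gaussDensity_smul hm c (g := fun _ => t.indicator fun _ => (1 : ℝ))
        (hg.comp measurable_snd)
    exact Measurable.comp h2 (hΓm.prodMk (h.measurable_state n))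
  let η : Kernel Ω 𝔼 := ⟨fun ω => metropolis π (Γ n ω) (X n ω), hker⟩
  have : IsMarkovKernel η := ⟨hprob⟩
  rw [integral_comp_of_condExp (η := η) (ℱ.le n) hZ (h.measurable_state (n + 1))
    (fun g hg hgb => h.transition n g hg hgb) hG hC]
  refine integral_congr_ae (Eventually.of_forall fun ω => ?_)
  exact integral_metropolis_eq_mhOp hpos hm (hS ω) (X n ω)
    (hG.comp (measurable_const.prodMk measurable_id)) (hC ω)

theorem IsAdaptiveMetropolis.integral_min_W_le [IsProbabilityMeasure P]
    (h : IsAdaptiveMetropolis P ℱ π κ X m Γ) (hpos : ∀ x, 0 < π x) (hcont : Continuous π)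
    {n : ℕ} (k : ℕ) {φ : Ω → ℝ} (hφ : Integrable φ P)
    (hle : ∀ ω, ∫ y, min (W π s y) k ∂(metropolis π (Γ n ω) (X n ω)) ≤ φ ω) :
    ∫ ω, min (W π s (X (n + 1) ω)) k ∂P ≤ ∫ ω, φ ω ∂P := by
  have hg : Measurable fun y : 𝔼 => min (W π s y) (k : ℝ) :=
    (continuous_W hpos hcont).measurable.min measurable_const
  have hgb : ∀ y : 𝔼, |min (W π s y) (k : ℝ)| ≤ k := fun y => by
    rw [abs_of_nonneg (le_min (W_nonneg hpos y) (Nat.cast_nonneg k))]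
    exact min_le_right _ _
  have h1 := h.transition n _ hg ⟨k, hgb⟩
  rw [← integral_condExp (ℱ.le n), integral_congr_ae h1]
  exact integral_mono (integrable_condExp.congr h1) hφ hle

/-- The mean of `W` grows at most linearly along the process. -/
theorem IsAdaptiveMetropolis.exists_integral_W_le [IsProbabilityMeasure P]
    (h : IsAdaptiveMetropolis P ℱ π κ X m Γ) (hd : 1 ≤ d) {ρ β R : ℝ} (hT : IsTarget π ρ β R)
    (hs0 : 0 < s) (hs1 : s < 1) (hκ : 0 < κ)
    (hX0 : Integrable (fun ω => W π s (X 0 ω)) P) :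
    ∃ K : ℝ, 0 ≤ K ∧ ∀ n : ℕ, Integrable (fun ω => W π s (X n ω)) P ∧
      ∫ ω, W π s (X n ω) ∂P ≤ K * (n + 1) := by
  have hpos := hT.pos
  have hcont := hT.diff.continuous
  have hc : 0 < (2.38 : ℝ) ^ 2 / (d : ℝ) := by
    have : (0 : ℝ) < d := by exact_mod_cast hd
    positivity
  obtain ⟨c, b, hc0, hb, hdr⟩ := hT.exists_mhOp_W_le hd hs0 hs1 (mul_pos hc hκ)
  have hw0 : 0 ≤ ∫ ω, W π s (X 0 ω) ∂P := integral_nonneg fun ω => W_nonneg hpos _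
  have hstep : ∀ n (B : ℝ) (φ : Ω → ℝ), Integrable φ P → ∫ ω, φ ω ∂P ≤ B →
      (∀ (k : ℕ) ω, ∫ y, min (W π s y) k ∂(metropolis π (Γ n ω) (X n ω)) ≤ φ ω) →
      Integrable (fun ω => W π s (X (n + 1) ω)) P ∧ ∫ ω, W π s (X (n + 1) ω) ∂P ≤ B :=
    fun n B φ hφ hB hle => integrable_of_forall_integral_min_le
      ((continuous_W hpos hcont).measurable.comp (h.measurable_state (n + 1)))
      (fun ω => W_nonneg hpos _)
      fun k => (h.integral_min_W_le hpos hcont k hφ (hle k)).trans hB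
  refine ⟨2 * (∫ ω, W π s (X 0 ω) ∂P) + b, by positivity, fun n => ?_⟩
  induction n with
  | zero => exact ⟨hX0, by push_cast; linarith⟩
  | succ n ih =>
    -- At time 0 the covariance may be singular, so only the crude doubling bound is available;
    -- afterwards the drift applies and each step adds at most b.
    rcases Nat.eq_zero_or_pos n with rfl | hn
    · refine hstep 0 _ (fun ω => 2 * W π s (X 0 ω)) (hX0.const_mul 2) ?_ fun k ω =>
        integral_min_W_metropolis_le hpos hcont hs0 hs1 _ _ k
      rw [integral_const_mul]
      push_cast
      linarith
    · refine hstep n _ (fun ω => W π s (X n ω) + b) (ih.1.add (integrable_const b)) ?_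
        fun k ω => ?_
      · rw [integral_add ih.1 (integrable_const b)]
        simp only [integral_const, probReal_univ, one_smul]
        push_cast
        linarith [ih.2]
      · have hg : Measurable fun y : 𝔼 => min (W π s y) (k : ℝ) :=
          (continuous_W hpos hcont).measurable.min measurable_const
        have hg0 : ∀ y : 𝔼, |min (W π s y) (k : ℝ)| = min (W π s y) k := fun y =>
          abs_of_nonneg (le_min (W_nonneg hpos y) (Nat.cast_nonneg k))
        have hgb : ∀ y : 𝔼, |min (W π s y) (k : ℝ)| ≤ k := fun y => by
          rw [hg0 y]; exact min_le_right _ _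
        have hS := h.posDef_smul_cov hκ hc hn ω
        have hq := isProposal_gaussDensity hS
        rw [integral_metropolis_eq_mhOp hpos hcont.measurable hS _ hg hgb]
        obtain ⟨h1, h2⟩ := hdr _ (posSemidef_smul_sub hc.le (h.posSemidef_cov_sub hn ω))
        have h3 := abs_mhOp_le hpos hcont.measurable hq
          (mhIntegrable_of_bdd hpos hcont.measurable hq hg hgb (X n ω))
          (mhIntegrable_W hpos hcont hs0 hs1 hq (X n ω))
          (fun y => (hg0 y).le.trans (min_le_left _ _))
        have h4 := h2 (X n ω)
        have h5 : 0 ≤ c * (gaussMass (((2.38 : ℝ) ^ 2 / (d : ℝ)) • Γ n ω))⁻¹ * W π s (X n ω) :=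
          mul_nonneg (mul_nonneg hc0.le (inv_nonneg.2 (gaussMass_pos hS).le)) (W_nonneg hpos _)
        have h6 := le_abs_self (mhOp π (gaussDensity (((2.38 : ℝ) ^ 2 / (d : ℝ)) • Γ n ω))
          (fun y => min (W π s y) (k : ℝ)) (X n ω))
        linarith

end Trajectory

/-! ### Freezing the covariance over a window -/

noncomputable section Window

theorem abs_integral_le_of_le_on {Ω : Type*} [MeasurableSpace Ω] {P : Measure Ω}
    [IsProbabilityMeasure P] {Y : Ω → ℝ} {G : Set Ω} (hG : MeasurableSet G) {C ε : ℝ}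
    (hC : ∀ ω, |Y ω| ≤ C) (hε0 : 0 ≤ ε) (hε : ∀ ω ∈ G, |Y ω| ≤ ε) :
    |∫ ω, Y ω ∂P| ≤ C * P.real Gᶜ + ε := by
  have hi : Integrable (fun ω => Gᶜ.indicator (fun _ => C) ω + ε) P :=
    ((integrable_const C).indicator hG.compl).add (integrable_const ε)
  have h1 := norm_integral_le_of_norm_le hi (f := Y) (Eventually.of_forall fun ω => by
    by_cases hω : ω ∈ G
    · simpa [hω] using hε ω hω
    · have := hC ω
      simp only [Set.mem_compl_iff, hω, not_false_eq_true, Set.indicator_of_mem, Real.norm_eq_abs]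
      linarith)
  refine h1.trans (le_of_eq ?_)
  rw [integral_add ((integrable_const C).indicator hG.compl) (integrable_const ε),
    integral_indicator hG.compl, setIntegral_const]
  simp [mul_comm]

variable {d : ℕ} {π : EuclideanSpace ℝ (Fin d) → ℝ} {s κ : ℝ} {Ω : Type*}
  [mΩ : MeasurableSpace Ω] {P : Measure Ω} {ℱ : Filtration ℕ mΩ}
  {X m : ℕ → Ω → EuclideanSpace ℝ (Fin d)} {Γ : ℕ → Ω → Matrix (Fin d) (Fin d) ℝ}

local notation "𝔼" => EuclideanSpace ℝ (Fin d)

/-- Markov's inequality at each of the n + 1 times, each mean being at most K(n + 1), and a union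
bound. -/
theorem measureReal_exists_lt_W_le [IsProbabilityMeasure P] (hpos : ∀ x, 0 < π x) {K : ℝ}
    (hK : ∀ n : ℕ, Integrable (fun ω => W π s (X n ω)) P ∧
      ∫ ω, W π s (X n ω) ∂P ≤ K * (n + 1)) (hK0 : 0 ≤ K) {B : ℝ} (hB : 0 < B) (n : ℕ) :
    P.real {ω | ∀ k ≤ n, W π s (X k ω) ≤ B}ᶜ ≤ K * (n + 1) ^ 2 / B := by
  have hsub : {ω | ∀ k ≤ n, W π s (X k ω) ≤ B}ᶜ ⊆
      ⋃ k ∈ Finset.range (n + 1), {ω | B ≤ W π s (X k ω)} := by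
    intro ω hω
    simp only [Set.mem_compl_iff, Set.mem_ofPred_eq, not_forall, not_le] at hω
    obtain ⟨k, hk, hlt⟩ := hω
    simp only [Set.mem_iUnion, Finset.mem_range]
    exact ⟨k, by omega, hlt.le⟩
  refine (measureReal_mono hsub (measure_ne_top _ _)).trans ((measureReal_biUnion_finset_le _ _).trans ?_)
  have h1 : ∀ k ∈ Finset.range (n + 1), P.real {ω | B ≤ W π s (X k ω)} ≤ K * (n + 1) / B := by
    intro k hk
    rw [le_div_iff₀ hB, mul_comm]
    refine (mul_meas_ge_le_integral_of_nonneg (Eventually.of_forall fun ω => W_nonneg hpos _)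
      (hK k).1 B).trans ((hK k).2.trans ?_)
    have : (k : ℝ) ≤ n := by
      exact_mod_cast Nat.lt_succ_iff.1 (Finset.mem_range.1 hk)
    gcongr
  refine (Finset.sum_le_sum h1).trans (le_of_eq ?_)
  rw [Finset.sum_const, Finset.card_range, nsmul_eq_mul]
  push_cast
  ring

theorem iterate_mhOp_gaussDensity_measurable (hm : Measurable π) (c : ℝ) {f : 𝔼 → ℝ}
    (hf : Measurable f) (i : ℕ) : Measurable fun p : (Fin d → Fin d → ℝ) × 𝔼 =>
      (mhOp π (gaussDensity (c • Matrix.of p.1)))^[i] f p.2 := by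
  induction i with
  | zero => exact hf.comp measurable_snd
  | succ i ih =>
    simp_rw [Function.iterate_succ_apply']
    exact measurable_mhOp_gaussDensity_smul hm c
      (g := fun θ => (mhOp π (gaussDensity (c • Matrix.of θ)))^[i] f) ih

theorem measurable_mhOp_gaussDensity_smul₂ (hm : Measurable π) (c : ℝ)
    {g : (Fin d → Fin d → ℝ) → 𝔼 → ℝ}
    (hg : Measurable fun p : (Fin d → Fin d → ℝ) × 𝔼 => g p.1 p.2) :
    Measurable fun p : ((Fin d → Fin d → ℝ) × (Fin d → Fin d → ℝ)) × 𝔼 =>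
      mhOp π (gaussDensity (c • Matrix.of p.1.1)) (g p.1.2) p.2 := by
  have h1 : Measurable fun p : ((Fin d → Fin d → ℝ) × (Fin d → Fin d → ℝ)) × 𝔼 =>
      (p.1.1, p.2) := (measurable_fst.comp measurable_fst).prodMk measurable_snd
  have h2 : Measurable fun p : ((Fin d → Fin d → ℝ) × (Fin d → Fin d → ℝ)) × 𝔼 =>
      (p.1.2, p.2) := (measurable_snd.comp measurable_fst).prodMk measurable_snd
  have hQ : Measurable ((fun p : (Fin d → Fin d → ℝ) × 𝔼 =>
      gaussDensity (c • Matrix.of p.1) p.2) ∘ fun p :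
        ((Fin d → Fin d → ℝ) × (Fin d → Fin d → ℝ)) × 𝔼 => (p.1.1, p.2)) :=
    Measurable.comp (measurable_gaussDensity_smul c) h1
  have hg' : Measurable ((fun p : (Fin d → Fin d → ℝ) × 𝔼 => g p.1 p.2) ∘ fun p :
        ((Fin d → Fin d → ℝ) × (Fin d → Fin d → ℝ)) × 𝔼 => (p.1.2, p.2)) :=
    Measurable.comp hg h2
  exact measurable_mhOp_param (Θ := (Fin d → Fin d → ℝ) × (Fin d → Fin d → ℝ))
    (Q := fun θ => gaussDensity (c • Matrix.of θ.1)) (g := fun θ => g θ.2) hm hQ hg'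

/-- Replacing the current covariance by an older one costs the total variation distance. -/
theorem abs_integral_mhOp_sub_le [IsProbabilityMeasure P] (hpos : ∀ x, 0 < π x)
    (hm : Measurable π) {c : ℝ} {Γ₁ Γ₂ : Ω → Matrix (Fin d) (Fin d) ℝ}
    (hΓ₁ : Measurable fun ω => (fun i j => Γ₁ ω i j : Fin d → Fin d → ℝ))
    (hΓ₂ : Measurable fun ω => (fun i j => Γ₂ ω i j : Fin d → Fin d → ℝ))
    (hS₁ : ∀ ω, (c • Γ₁ ω).PosDef) (hS₂ : ∀ ω, (c • Γ₂ ω).PosDef) {Y : Ω → 𝔼}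
    (hY : Measurable Y) {g : (Fin d → Fin d → ℝ) → 𝔼 → ℝ}
    (hg : Measurable fun p : (Fin d → Fin d → ℝ) × 𝔼 => g p.1 p.2) {C : ℝ}
    (hC : ∀ ω y, |g (fun i j => Γ₂ ω i j) y| ≤ C) {G : Set Ω} (hG : MeasurableSet G) {t : ℝ}
    (ht0 : 0 ≤ t)
    (ht : ∀ ω ∈ G, ∫ z, |gaussDensity (c • Γ₁ ω) z - gaussDensity (c • Γ₂ ω) z| ≤ t) :
    |∫ ω, mhOp π (gaussDensity (c • Γ₁ ω)) (g fun i j => Γ₂ ω i j) (Y ω) ∂P -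
      ∫ ω, mhOp π (gaussDensity (c • Γ₂ ω)) (g fun i j => Γ₂ ω i j) (Y ω) ∂P| ≤
      2 * C * P.real Gᶜ + 2 * C * t := by
  have hgm : ∀ ω, Measurable (g fun i j => Γ₂ ω i j) := fun ω =>
    hg.comp (measurable_const.prodMk measurable_id :
      Measurable fun y : 𝔼 => ((fun i j => Γ₂ ω i j : Fin d → Fin d → ℝ), y))
  have hb₁ : ∀ ω, |mhOp π (gaussDensity (c • Γ₁ ω)) (g fun i j => Γ₂ ω i j) (Y ω)| ≤ C :=
    fun ω => abs_mhOp_le_of_bdd hpos hm (isProposal_gaussDensity (hS₁ ω)) (hgm ω) (hC ω) _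
  have hb₂ : ∀ ω, |mhOp π (gaussDensity (c • Γ₂ ω)) (g fun i j => Γ₂ ω i j) (Y ω)| ≤ C :=
    fun ω => abs_mhOp_le_of_bdd hpos hm (isProposal_gaussDensity (hS₂ ω)) (hgm ω) (hC ω) _
  have hmeas := measurable_mhOp_gaussDensity_smul₂ hm c hg
  have hi₁ : Integrable
      (fun ω => mhOp π (gaussDensity (c • Γ₁ ω)) (g fun i j => Γ₂ ω i j) (Y ω)) P :=
    Integrable.of_bound (Measurable.comp hmeas
      ((hΓ₁.prodMk hΓ₂).prodMk hY)).aestronglyMeasurable C (Eventually.of_forall hb₁)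
  have hi₂ : Integrable
      (fun ω => mhOp π (gaussDensity (c • Γ₂ ω)) (g fun i j => Γ₂ ω i j) (Y ω)) P :=
    Integrable.of_bound (Measurable.comp hmeas
      ((hΓ₂.prodMk hΓ₂).prodMk hY)).aestronglyMeasurable C (Eventually.of_forall hb₂)
  obtain ⟨ω0⟩ : Nonempty Ω := nonempty_of_isProbabilityMeasure P
  have hC0 : 0 ≤ C := (abs_nonneg _).trans (hb₁ ω0)
  rw [← integral_sub hi₁ hi₂]
  refine abs_integral_le_of_le_on hG (fun ω => ?_) (by positivity) fun ω hω => ?_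
  · refine (abs_sub _ _).trans ?_
    linarith [hb₁ ω, hb₂ ω]
  · exact (abs_mhOp_sub_mhOp_le hpos hm (isProposal_gaussDensity (hS₁ ω))
      (isProposal_gaussDensity (hS₂ ω)) (hgm ω) (hC ω) _).trans
      (mul_le_mul_of_nonneg_left (ht ω hω) (by positivity))

section Path

theorem IsAdaptiveMetropolis.norm_innovation_le (h : IsAdaptiveMetropolis P ℱ π κ X m Γ) {ω : Ω}
    {n : ℕ} {r : ℝ} (hX : ∀ k ≤ n, ‖X k ω‖ ≤ r) : ∀ k < n, ‖X (k + 1) ω - m k ω‖ ≤ 2 * r := by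
  intro k hk
  have h1 := norm_mean_le (x := fun k => X k ω) (m := fun k => m k ω) (h.mean_zero ω)
    (fun n => h.mean_succ n ω) hX k hk.le
  have h2 := hX (k + 1) hk
  exact (norm_sub_le _ _).trans (by linarith)

/-- Frozen-covariance comparison over a window of length `r` started at time `n`. -/
theorem IsAdaptiveMetropolis.abs_integral_window_sub_le [IsProbabilityMeasure P]
    (h : IsAdaptiveMetropolis P ℱ π κ X m Γ) (hd : 1 ≤ d) (hpos : ∀ x, 0 < π x)
    (hm : Measurable π) (hκ : 0 < κ) {f : 𝔼 → ℝ} (hf : Measurable f) {C : ℝ}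
    (hC : ∀ x, |f x| ≤ C) {n : ℕ} (hn : 1 ≤ n) (r : ℕ) {ρ : ℝ} {G : Set Ω}
    (hG : MeasurableSet G) (hGρ : ∀ ω ∈ G, ∀ k ≤ n + r, ‖X k ω‖ ≤ ρ) (j i : ℕ)
    (hij : i + j = r) :
    |∫ ω, (mhOp π (gaussDensity (((2.38 : ℝ) ^ 2 / (d : ℝ)) • Γ n ω)))^[i] f (X (n + j) ω) ∂P -
      ∫ ω, (mhOp π (gaussDensity (((2.38 : ℝ) ^ 2 / (d : ℝ)) • Γ n ω)))^[r] f (X n ω) ∂P| ≤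
      j * (2 * C * P.real Gᶜ +
        2 * C * (r * (4 * d * (1 / (n : ℝ) * (2 + (2 * ρ) ^ 2 / κ))))) := by
  have hc : 0 < (2.38 : ℝ) ^ 2 / (d : ℝ) := by
    have : (0 : ℝ) < d := by exact_mod_cast hd
    positivity
  have hsucc : ∀ k : ℕ, 1 ≤ k → ∀ Z : Ω → Fin d → Fin d → ℝ, Measurable[ℱ k] Z →
      ∀ g : (Fin d → Fin d → ℝ) → 𝔼 → ℝ,
      (Measurable fun p : (Fin d → Fin d → ℝ) × 𝔼 => g p.1 p.2) → (∀ ω y, |g (Z ω) y| ≤ C) →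
      ∫ ω, g (Z ω) (X (k + 1) ω) ∂P = ∫ ω, mhOp π
        (gaussDensity (((2.38 : ℝ) ^ 2 / (d : ℝ)) • Γ k ω)) (g (Z ω)) (X k ω) ∂P :=
    fun k hk Z hZ g hg hb => h.integral_succ hd hpos hm hκ hk hZ hg hb
  generalize (2.38 : ℝ) ^ 2 / (d : ℝ) = c at *
  -- Telescoping: the last true step becomes an operator with covariance at time n + j, is replaced
  -- by the frozen operator at the cost of one total variation term, and joins the i frozen steps.
  induction j generalizing i with
  | zero =>
    obtain rfl : i = r := by omega
    simp
  | succ j ih =>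
    have hS : ∀ k, 1 ≤ k → ∀ ω, (c • Γ k ω).PosDef := fun k hk ω =>
      h.posDef_smul_cov hκ hc hk ω
    have hcov : ∀ k, Measurable fun ω => (fun i j => Γ k ω i j : Fin d → Fin d → ℝ) := fun k =>
      (h.measurable_cov k).mono (ℱ.le k) le_rfl
    have hZ : Measurable[ℱ (n + j)] fun ω => (fun i j => Γ n ω i j : Fin d → Fin d → ℝ) :=
      (h.measurable_cov n).mono (ℱ.mono (by omega)) le_rfl
    have hit := iterate_mhOp_gaussDensity_measurable hm c hf i
    have hb : ∀ ω y, |(mhOp π (gaussDensity (c • Matrix.of fun i j => Γ n ω i j)))^[i] f y| ≤ C :=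
      fun ω y => (iterate_mhOp_bdd hpos hm (isProposal_gaussDensity (hS n hn ω))
        (measurable_gaussDensity_right _) hf hC i).2 y
    have e1 := hsucc (n + j) (by omega) _ hZ
      (fun θ => (mhOp π (gaussDensity (c • Matrix.of θ)))^[i] f) hit hb
    have e2 := ih (i + 1) (by omega)
    have e3 := abs_integral_mhOp_sub_le (P := P) (c := c) hpos hm (hcov (n + j)) (hcov n)
      (hS (n + j) (by omega)) (hS n hn) (h.measurable_state (n + j))
      (g := fun θ => (mhOp π (gaussDensity (c • Matrix.of θ)))^[i] f) hit hb hG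
      (t := r * (4 * d * (1 / (n : ℝ) * (2 + (2 * ρ) ^ 2 / κ)))) (by positivity)
      (fun ω hω => by
        refine (integral_abs_gaussDensity_add_sub_le (v := fun k => X (k + 1) ω - m k ω)
          (Γ := fun k => Γ k ω) hκ (fun k => h.cov_succ k ω) hc hn (r := 2 * ρ) j
          fun k hk => h.norm_innovation_le (hGρ ω hω) k (by omega)).trans ?_
        have : (j : ℝ) ≤ r := by exact_mod_cast (by omega : j ≤ r)
        gcongr)
    have e4 : ∀ ω, Matrix.of (fun i j => Γ n ω i j) = Γ n ω := fun ω => rfl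
    simp only [e4] at e1 e3
    simp only [Function.iterate_succ_apply'] at e2
    have e5 : n + (j + 1) = n + j + 1 := rfl
    rw [e5, e1]
    push_cast
    generalize (2 * C * P.real Gᶜ +
        2 * C * (r * (4 * d * (1 / (n : ℝ) * (2 + (2 * ρ) ^ 2 / κ))))) = e at *
    refine (abs_sub_le _ _ _).trans ((add_le_add e3 e2).trans (le_of_eq ?_))
    ring

end Path

/-- Quantitative convergence, in terms of a window length and a truncation level. -/
theorem IsAdaptiveMetropolis.abs_integral_sub_le [IsProbabilityMeasure P]
    (h : IsAdaptiveMetropolis P ℱ π κ X m Γ) (hd : 1 ≤ d) (hpos : ∀ x, 0 < π x)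
    (hcont : Continuous π) (hπ : Integrable π) (hπ1 : ∫ x, π x = 1) (hκ : 0 < κ)
    {A K₁ : ℝ} (hA : 0 ≤ A) (hK₁ : 0 ≤ K₁)
    (hrate : ∀ L : ℝ, 1 ≤ L → ∀ S : Matrix (Fin d) (Fin d) ℝ,
      (S - ((2.38 : ℝ) ^ 2 / (d : ℝ) * κ) • 1).PosSemidef → (L • 1 - S).PosSemidef →
      ∀ f : 𝔼 → ℝ, Measurable f → ∀ C : ℝ, (∀ x, |f x| ≤ C) → ∀ (n : ℕ) (x : 𝔼),
        |(mhOp π (gaussDensity S))^[n] f x - ∫ y, f y * π y| ≤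
          K₁ * C * (1 - Real.exp (-(A * (1 + Real.log L) ^ 2))) ^ n * W π s x)
    {K : ℝ} (hK0 : 0 ≤ K) (hK : ∀ n : ℕ, Integrable (fun ω => W π s (X n ω)) P ∧
      ∫ ω, W π s (X n ω) ∂P ≤ K * (n + 1))
    {f : 𝔼 → ℝ} (hf : Measurable f) {C : ℝ} (hC : ∀ x, |f x| ≤ C) {n : ℕ} (hn : 1 ≤ n) (r : ℕ)
    {B ρ : ℝ} (hB : 0 < B) (hρ : ∀ x, W π s x ≤ B → ‖x‖ ≤ ρ) :
    |∫ ω, f (X (n + r) ω) ∂P - ∫ y, f y * π y| ≤ C *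
      (2 * (r + 1) * (K * (((n + r : ℕ) : ℝ) + 1) ^ 2 / B) +
        2 * r * (r * (4 * d * (1 / (n : ℝ) * (2 + (2 * ρ) ^ 2 / κ)))) +
        K₁ * (1 - Real.exp (-(A * (1 + Real.log
          (1 + (2.38 : ℝ) ^ 2 / (d : ℝ) * ((2 * ρ) ^ 2 + κ))) ^ 2))) ^ r * B) := by
  have hm := hcont.measurable
  have hC0 : 0 ≤ C := (abs_nonneg _).trans (hC 0)
  have hc : 0 < (2.38 : ℝ) ^ 2 / (d : ℝ) := by
    have : (0 : ℝ) < d := by exact_mod_cast hd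
    positivity
  -- On G the whole trajectory up to the end of the window is bounded, so both the drift of the
  -- covariance and its size L are controlled; off G only boundedness of f is used.
  obtain ⟨G, hGdef⟩ : ∃ G : Set Ω, G = {ω | ∀ k ≤ n + r, W π s (X k ω) ≤ B} := ⟨_, rfl⟩
  have hG : MeasurableSet G := by
    have : G = ⋂ k ∈ Set.Iic (n + r), {ω | W π s (X k ω) ≤ B} := by
      rw [hGdef]; ext ω; simp
    rw [this]
    exact MeasurableSet.biInter (Set.to_countable _) fun k _ => measurableSet_le
      ((continuous_W hpos hcont).measurable.comp (h.measurable_state k)) measurable_const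
  have hGρ : ∀ ω ∈ G, ∀ k ≤ n + r, ‖X k ω‖ ≤ ρ := fun ω hω k hk => by
    rw [hGdef] at hω
    exact hρ _ (hω k hk)
  have hGW : ∀ ω ∈ G, W π s (X n ω) ≤ B := fun ω hω => by
    rw [hGdef] at hω
    exact hω n (by omega)
  have hp : P.real Gᶜ ≤ K * (((n + r : ℕ) : ℝ) + 1) ^ 2 / B := by
    rw [hGdef]
    exact measureReal_exists_lt_W_le hpos hK hK0 hB (n + r)
  have h1 := h.abs_integral_window_sub_le hd hpos hm hκ hf hC hn r hG hGρ r 0 (by omega)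
  have hS := h.posDef_smul_cov hκ hc hn
  have hΓm : Measurable fun ω => (fun i j => Γ n ω i j : Fin d → Fin d → ℝ) :=
    (h.measurable_cov n).mono (ℱ.le n) le_rfl
  have hlow : ∀ ω, ((((2.38 : ℝ) ^ 2 / (d : ℝ)) • Γ n ω) -
      ((2.38 : ℝ) ^ 2 / (d : ℝ) * κ) • 1).PosSemidef := fun ω =>
    posSemidef_smul_sub hc.le (h.posSemidef_cov_sub hn ω)
  generalize (2.38 : ℝ) ^ 2 / (d : ℝ) = c at *
  obtain ⟨L, hL⟩ : ∃ L, L = 1 + c * ((2 * ρ) ^ 2 + κ) := ⟨_, rfl⟩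
  rw [← hL]
  have hL1 : 1 ≤ L := by
    rw [hL]
    have : 0 ≤ c * ((2 * ρ) ^ 2 + κ) := by positivity
    linarith
  have hup : ∀ ω ∈ G, (L • 1 - c • Γ n ω).PosSemidef := by
    intro ω hω
    obtain ⟨k, rfl⟩ : ∃ k, n = k + 1 := ⟨n - 1, by omega⟩
    have h2 := posSemidef_sub_cov (v := fun k => X (k + 1) ω - m k ω) (Γ := fun k => Γ k ω)
      (fun k => h.cov_succ k ω) (n := k + 1 + r) (r := 2 * ρ)
      (h.norm_innovation_le (hGρ ω hω)) k (by omega)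
    have h3 : L • 1 - c • Γ (k + 1) ω =
        1 + c • (((2 * ρ) ^ 2 + κ) • (1 : Matrix (Fin d) (Fin d) ℝ) - Γ (k + 1) ω) := by
      rw [hL, add_smul, one_smul, smul_sub, smul_smul]
      abel
    rw [h3]
    exact Matrix.PosSemidef.one.add (h2.smul hc.le)
  have hτ : 0 ≤ 1 - Real.exp (-(A * (1 + Real.log L) ^ 2)) := by
    have : Real.exp (-(A * (1 + Real.log L) ^ 2)) ≤ 1 := Real.exp_le_one_iff.2 (by
      have : 0 ≤ A * (1 + Real.log L) ^ 2 := by positivity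
      linarith)
    linarith
  have hb : ∀ ω, |(mhOp π (gaussDensity (c • Γ n ω)))^[r] f (X n ω)| ≤ C :=
    fun ω => (iterate_mhOp_bdd hpos hm (isProposal_gaussDensity (hS ω))
      (measurable_gaussDensity_right _) hf hC r).2 _
  have hπf : |∫ y, f y * π y| ≤ C := by
    have := norm_integral_le_of_norm_le (hπ.const_mul C) (f := fun y => f y * π y)
      (Eventually.of_forall fun y => by
        rw [norm_mul, Real.norm_of_nonneg (hpos y).le]
        exact mul_le_mul_of_nonneg_right (hC y) (hpos y).le)
    rwa [integral_const_mul, hπ1, mul_one, Real.norm_eq_abs] at this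
  have hi : Integrable (fun ω => (mhOp π (gaussDensity (c • Γ n ω)))^[r] f (X n ω)) P :=
    Integrable.of_bound (Measurable.comp (iterate_mhOp_gaussDensity_measurable hm c hf r)
      (hΓm.prodMk (h.measurable_state n))).aestronglyMeasurable C (Eventually.of_forall hb)
  -- The frozen chain started from X_n is close to equilibrium on G. Its 2C P(Gᶜ) adds to the r
  -- copies from the window, whence the factor r + 1.
  have h2 : |∫ ω, (mhOp π (gaussDensity (c • Γ n ω)))^[r] f (X n ω) ∂P - ∫ y, f y * π y| ≤
      2 * C * P.real Gᶜ +
        K₁ * C * (1 - Real.exp (-(A * (1 + Real.log L) ^ 2))) ^ r * B := by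
    have e1 : ∫ ω, (mhOp π (gaussDensity (c • Γ n ω)))^[r] f (X n ω) ∂P - ∫ y, f y * π y =
        ∫ ω, ((mhOp π (gaussDensity (c • Γ n ω)))^[r] f (X n ω) - ∫ y, f y * π y) ∂P := by
      rw [integral_sub hi (integrable_const _)]
      simp
    rw [e1]
    refine abs_integral_le_of_le_on hG (fun ω => ?_) (by positivity) fun ω hω => ?_
    · exact (abs_sub _ _).trans (by linarith [hb ω])
    · refine (hrate L hL1 _ (hlow ω) (hup ω hω) f hf C hC r _).trans ?_
      exact mul_le_mul_of_nonneg_left (hGW ω hω) (by positivity)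
  have h3 : |∫ ω, f (X (n + r) ω) ∂P - ∫ y, f y * π y| ≤ _ :=
    (abs_sub_le _ _ _).trans (add_le_add h1 h2)
  refine h3.trans ?_
  have h4 := mul_le_mul_of_nonneg_left hp (by positivity : 0 ≤ 2 * C * ((r : ℝ) + 1))
  linarith

end Window

/-! ### Choice of window and truncation -/

noncomputable section Asymptotics

/-- Used with x = log n. The argument of the logarithm is at most x³ for large x, so the left side
is at most 16A(log x)² = o(x). The bound x/8 makes the minorization constant at least n^(-1/8). -/
theorem eventually_log_poly_sq_le {A : ℝ} (hA : 0 ≤ A) (a b : ℝ) {c κ : ℝ} (hc : 0 ≤ c)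
    (hκ : 0 ≤ κ) : ∀ᶠ x : ℝ in atTop,
      A * (1 + Real.log (1 + c * ((2 * (a + b * x)) ^ 2 + κ))) ^ 2 ≤ x / 8 := by
  have hε : 0 < 1 / (128 * (A + 1)) := by positivity
  filter_upwards [eventually_ge_atTop (1 + c * (8 * a ^ 2 + 8 * b ^ 2 + κ)),
    eventually_ge_atTop (Real.exp 1),
    (Real.isLittleO_pow_log_id_atTop (n := 2)).bound hε] with x h1 h2 h3
  have hx1 : 1 ≤ x := (Real.one_le_exp zero_le_one).trans h2
  have hx0 : 0 < x := by linarith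
  have hlog : 1 ≤ Real.log x := (Real.le_log_iff_exp_le hx0).2 h2
  have h0 : 0 ≤ c * ((2 * (a + b * x)) ^ 2 + κ) := by positivity
  have hx2 : 1 ≤ x ^ 2 := one_le_pow₀ hx1
  have h4 : 1 + c * ((2 * (a + b * x)) ^ 2 + κ) ≤ x ^ 3 := by
    have e1 : (2 * (a + b * x)) ^ 2 + κ ≤ (8 * a ^ 2 + 8 * b ^ 2 + κ) * x ^ 2 := by
      nlinarith [sq_nonneg (a - b * x), mul_le_mul_of_nonneg_left hx2 (sq_nonneg a),
        mul_le_mul_of_nonneg_left hx2 hκ]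
    calc 1 + c * ((2 * (a + b * x)) ^ 2 + κ)
        ≤ x ^ 2 + c * ((8 * a ^ 2 + 8 * b ^ 2 + κ) * x ^ 2) := by gcongr
      _ = (1 + c * (8 * a ^ 2 + 8 * b ^ 2 + κ)) * x ^ 2 := by ring
      _ ≤ x * x ^ 2 := by gcongr
      _ = x ^ 3 := by ring
  have h5 := Real.log_le_log (by linarith) h4
  rw [Real.log_pow] at h5
  have h6 : 0 ≤ Real.log (1 + c * ((2 * (a + b * x)) ^ 2 + κ)) := Real.log_nonneg (by linarith)
  push_cast at h5
  generalize Real.log (1 + c * ((2 * (a + b * x)) ^ 2 + κ)) = t at *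
  have h7 : (1 + t) ^ 2 ≤ (4 * Real.log x) ^ 2 := pow_le_pow_left₀ (by linarith) (by linarith) 2
  rw [Real.norm_of_nonneg (by positivity), id, Real.norm_of_nonneg hx0.le, div_mul_eq_mul_div,
    one_mul, le_div_iff₀ (by positivity)] at h3
  have h8 := mul_le_mul_of_nonneg_left h7 hA
  nlinarith [sq_nonneg (Real.log x)]

/-- Here u = n^(1/8), q = ⌊u²⌋ is the window length, l = log n and the truncation level is n⁴ =
u^32. The exceptional event contributes O(u^(-8)), the total variation terms u⁴·u²·u^(-8), and the
mixing term (1 - 1/u)^q u^32, which is O(u^32 e^(-u)). -/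
theorem window_bound_le {A a b c κ K K₁ D u l : ℝ} {q : ℕ} (hA : 0 ≤ A) (hκ : 0 < κ)
    (hK : 0 ≤ K) (hK₁ : 0 ≤ K₁) (hD : 0 ≤ D) (hu : 2 ≤ u) (hq1 : u ^ 2 - 1 ≤ q)
    (hq2 : q ≤ u ^ 2) (hl0 : 0 ≤ l) (hlu : l ≤ u) (hl : l = 8 * Real.log u)
    (hτ : A * (1 + Real.log (1 + c * ((2 * (a + b * l)) ^ 2 + κ))) ^ 2 ≤ l / 8) :
    2 * ((q : ℝ) + 1) * (K * (u ^ 8 + 1) ^ 2 / (u ^ 8) ^ 4) +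
      2 * q * (q * (4 * D * (1 / (u ^ 8 - q) * (2 + (2 * (a + b * l)) ^ 2 / κ)))) +
      K₁ * (1 - Real.exp (-(A * (1 + Real.log (1 + c * ((2 * (a + b * l)) ^ 2 + κ))) ^ 2))) ^ q *
        (u ^ 8) ^ 4 ≤
      (16 * K + 16 * D * (2 + (8 * a ^ 2 + 8 * b ^ 2) / κ)) * u⁻¹ +
        K₁ * Real.exp 1 * (u ^ 32 * Real.exp (-u)) := by
  have hu0 : 0 < u := by linarith
  have hu1 : 1 ≤ u := by linarith
  have p2 : 1 ≤ u ^ 2 := one_le_pow₀ hu1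
  have p6 : (2 : ℝ) ^ 6 ≤ u ^ 6 := pow_le_pow_left₀ (by norm_num) hu 6
  have p8 : 1 ≤ u ^ 8 := one_le_pow₀ hu1
  have p28 : u ^ 2 ≤ u ^ 8 := pow_le_pow_right₀ hu1 (by norm_num)
  have hq0 : (0 : ℝ) ≤ q := Nat.cast_nonneg q
  have t1 : 2 * ((q : ℝ) + 1) * (K * (u ^ 8 + 1) ^ 2 / (u ^ 8) ^ 4) ≤ 16 * K * u⁻¹ := by
    calc 2 * ((q : ℝ) + 1) * (K * (u ^ 8 + 1) ^ 2 / (u ^ 8) ^ 4)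
        ≤ 2 * (u ^ 8 + u ^ 8) * (K * (u ^ 8 + u ^ 8) ^ 2 / (u ^ 8) ^ 4) := by
          gcongr
          linarith
      _ = 16 * K * (u ^ 8)⁻¹ := by field_simp; ring
      _ ≤ 16 * K * u⁻¹ := by
          gcongr
          exact le_self_pow₀ hu1 (by norm_num)
  have t2 : 2 * q * (q * (4 * D * (1 / (u ^ 8 - q) * (2 + (2 * (a + b * l)) ^ 2 / κ)))) ≤
      16 * D * (2 + (8 * a ^ 2 + 8 * b ^ 2) / κ) * u⁻¹ := by
    have e1 : u ^ 8 / 2 ≤ u ^ 8 - q := by nlinarith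
    have e2 : (2 * (a + b * l)) ^ 2 ≤ (8 * a ^ 2 + 8 * b ^ 2) * u ^ 2 := by
      have : l ^ 2 ≤ u ^ 2 := pow_le_pow_left₀ hl0 hlu 2
      nlinarith [sq_nonneg (a - b * l), mul_le_mul_of_nonneg_left p2 (sq_nonneg a),
        mul_le_mul_of_nonneg_left this (sq_nonneg b)]
    calc 2 * q * (q * (4 * D * (1 / (u ^ 8 - q) * (2 + (2 * (a + b * l)) ^ 2 / κ))))
        ≤ 2 * u ^ 2 * (u ^ 2 * (4 * D * (1 / (u ^ 8 / 2) *
          (2 * u ^ 2 + (8 * a ^ 2 + 8 * b ^ 2) * u ^ 2 / κ)))) := by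
          have e3 : 0 < u ^ 8 / 2 := by positivity
          have e4 : 0 < u ^ 8 - q := e3.trans_le e1
          gcongr
          linarith
      _ = 16 * D * (2 + (8 * a ^ 2 + 8 * b ^ 2) / κ) * (u ^ 2)⁻¹ := by field_simp; ring
      _ ≤ 16 * D * (2 + (8 * a ^ 2 + 8 * b ^ 2) / κ) * u⁻¹ := by
          gcongr
          exact le_self_pow₀ hu1 (by norm_num)
  have t3 : (1 - Real.exp (-(A * (1 + Real.log
      (1 + c * ((2 * (a + b * l)) ^ 2 + κ))) ^ 2))) ^ q ≤ Real.exp 1 * Real.exp (-u) := by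
    have h0 : 0 ≤ A * (1 + Real.log (1 + c * ((2 * (a + b * l)) ^ 2 + κ))) ^ 2 := by positivity
    generalize A * (1 + Real.log (1 + c * ((2 * (a + b * l)) ^ 2 + κ))) ^ 2 = w at *
    have e1 : u⁻¹ ≤ Real.exp (-w) := by
      have : u⁻¹ = Real.exp (-(l / 8)) := by
        rw [hl, mul_div_cancel_left₀ _ (by norm_num), Real.exp_neg, Real.exp_log hu0]
      rw [this]
      exact Real.exp_le_exp.2 (by linarith)
    have e2 : Real.exp (-w) ≤ 1 := Real.exp_le_one_iff.2 (by linarith)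
    have e3 : 1 - Real.exp (-w) ≤ Real.exp (-u⁻¹) := by
      have := Real.add_one_le_exp (-u⁻¹)
      linarith
    refine (pow_le_pow_left₀ (by linarith) e3 q).trans ?_
    rw [← Real.exp_nat_mul, ← Real.exp_add]
    apply Real.exp_le_exp.2
    have e4 : (u ^ 2 - 1) * u⁻¹ ≤ q * u⁻¹ := mul_le_mul_of_nonneg_right hq1 (by positivity)
    have e5 : (u ^ 2 - 1) * u⁻¹ = u - u⁻¹ := by field_simp
    have e6 : u⁻¹ ≤ 1 := inv_le_one_of_one_le₀ hu1
    linarith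
  have t4 := mul_le_mul_of_nonneg_right (mul_le_mul_of_nonneg_left t3 hK₁)
    (by positivity : 0 ≤ (u ^ 8) ^ 4)
  have t5 : K₁ * (Real.exp 1 * Real.exp (-u)) * (u ^ 8) ^ 4 =
      K₁ * Real.exp 1 * (u ^ 32 * Real.exp (-u)) := by ring
  rw [t5] at t4
  linarith

theorem tendsto_window_bound {A : ℝ} (hA : 0 ≤ A) (a b : ℝ) {c κ K K₁ D : ℝ} (hc : 0 ≤ c)
    (hκ : 0 < κ) (hK : 0 ≤ K) (hK₁ : 0 ≤ K₁) (hD : 0 ≤ D) :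
    Tendsto (fun n : ℕ =>
      2 * ((⌊(n : ℝ) ^ (1 / 4 : ℝ)⌋₊ : ℝ) + 1) * (K * ((n : ℝ) + 1) ^ 2 / (n : ℝ) ^ 4) +
      2 * (⌊(n : ℝ) ^ (1 / 4 : ℝ)⌋₊ : ℝ) * ((⌊(n : ℝ) ^ (1 / 4 : ℝ)⌋₊ : ℝ) *
        (4 * D * (1 / ((n : ℝ) - (⌊(n : ℝ) ^ (1 / 4 : ℝ)⌋₊ : ℝ)) *
          (2 + (2 * (a + b * Real.log n)) ^ 2 / κ)))) +
      K₁ * (1 - Real.exp (-(A * (1 + Real.log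
        (1 + c * ((2 * (a + b * Real.log n)) ^ 2 + κ))) ^ 2))) ^
          ⌊(n : ℝ) ^ (1 / 4 : ℝ)⌋₊ * (n : ℝ) ^ 4) atTop (𝓝 0) := by
  have hu : Tendsto (fun n : ℕ => (n : ℝ) ^ (1 / 8 : ℝ)) atTop atTop :=
    (tendsto_rpow_atTop (by norm_num)).comp tendsto_natCast_atTop_atTop
  have hlog : Tendsto (fun n : ℕ => Real.log (n : ℝ)) atTop atTop :=
    Real.tendsto_log_atTop.comp tendsto_natCast_atTop_atTop
  have hlim : Tendsto (fun u : ℝ =>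
      (16 * K + 16 * D * (2 + (8 * a ^ 2 + 8 * b ^ 2) / κ)) * u⁻¹ +
        K₁ * Real.exp 1 * (u ^ 32 * Real.exp (-u))) atTop (𝓝 0) := by
    simpa using (tendsto_inv_atTop_zero.const_mul
      (16 * K + 16 * D * (2 + (8 * a ^ 2 + 8 * b ^ 2) / κ))).add
      ((Real.tendsto_pow_mul_exp_neg_atTop_nhds_zero 32).const_mul (K₁ * Real.exp 1))
  refine squeeze_zero' ?_ ?_ (hlim.comp hu)
  · filter_upwards [eventually_ge_atTop 1] with n hn
    have hn1 : (1 : ℝ) ≤ n := by exact_mod_cast hn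
    have h1 : (⌊(n : ℝ) ^ (1 / 4 : ℝ)⌋₊ : ℝ) ≤ n := by
      refine (Nat.floor_le (by positivity)).trans ?_
      exact (Real.rpow_le_rpow_of_exponent_le hn1 (by norm_num)).trans (Real.rpow_one _).le
    have h2 : 0 ≤ (n : ℝ) - (⌊(n : ℝ) ^ (1 / 4 : ℝ)⌋₊ : ℝ) := sub_nonneg.2 h1
    have h3 : 0 ≤ 1 - Real.exp (-(A * (1 + Real.log
        (1 + c * ((2 * (a + b * Real.log n)) ^ 2 + κ))) ^ 2)) :=
      sub_nonneg.2 (Real.exp_le_one_iff.2 (neg_nonpos.2 (by positivity)))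
    positivity
  · have hlogu : ∀ᶠ u : ℝ in atTop, 8 * Real.log u ≤ u := by
      filter_upwards [Real.isLittleO_log_id_atTop.bound (by norm_num : (0 : ℝ) < 1 / 8),
        eventually_ge_atTop 0] with u h1 h2
      rw [id, Real.norm_of_nonneg h2] at h1
      linarith [le_abs_self (Real.log u), Real.norm_eq_abs (Real.log u)]
    filter_upwards [hu.eventually (eventually_ge_atTop 2), hu.eventually hlogu,
      hlog.eventually (eventually_log_poly_sq_le hA a b hc hκ.le), eventually_ge_atTop 1]
      with n h1 h2 h3 hn
    have hn0 : (0 : ℝ) < n := by exact_mod_cast hn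
    have e8 : (n : ℝ) = ((n : ℝ) ^ (1 / 8 : ℝ)) ^ 8 := by
      rw [← Real.rpow_natCast, ← Real.rpow_mul hn0.le]
      norm_num
    have e2 : (n : ℝ) ^ (1 / 4 : ℝ) = ((n : ℝ) ^ (1 / 8 : ℝ)) ^ 2 := by
      rw [← Real.rpow_natCast, ← Real.rpow_mul hn0.le]
      norm_num
    have el : Real.log n = 8 * Real.log ((n : ℝ) ^ (1 / 8 : ℝ)) := by
      rw [Real.log_rpow hn0]; ring
    have hl0 : 0 ≤ Real.log n := Real.log_nonneg (by exact_mod_cast hn)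
    have f1 : (n : ℝ) ^ (1 / 4 : ℝ) - 1 ≤ (⌊(n : ℝ) ^ (1 / 4 : ℝ)⌋₊ : ℝ) :=
      (Nat.sub_one_lt_floor _).le
    have f2 : (⌊(n : ℝ) ^ (1 / 4 : ℝ)⌋₊ : ℝ) ≤ (n : ℝ) ^ (1 / 4 : ℝ) :=
      Nat.floor_le (by positivity)
    have key := window_bound_le (a := a) (b := b) (c := c) (q := ⌊(n : ℝ) ^ (1 / 4 : ℝ)⌋₊)
      hA hκ hK hK₁ hD h1 (e2 ▸ f1) (e2 ▸ f2) hl0 (el ▸ h2) el h3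
    rw [← e8] at key
    exact key

end Asymptotics

end AdaptiveMetropolis

/-! ### Conclusion -/

theorem theorem2p6 {d : ℕ} (hd : 1 ≤ d)
    (π : EuclideanSpace ℝ (Fin d) → ℝ)
    (hπ : AdaptiveMetropolis.SuperExponentialRegular π) (hπ1 : ∫ x, π x = 1)
    (s : ℝ) (hs0 : 0 < s) (hs1 : s < 1) (κ : ℝ) (hκ : 0 < κ)
    {Ω : Type*} [mΩ : MeasurableSpace Ω] (P : Measure Ω) [IsProbabilityMeasure P]
    (ℱ : Filtration ℕ mΩ)
    (X m : ℕ → Ω → EuclideanSpace ℝ (Fin d)) (Γ : ℕ → Ω → Matrix (Fin d) (Fin d) ℝ)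
    (hAM : AdaptiveMetropolis.IsAdaptiveMetropolis P ℱ π κ X m Γ)
    (hX0 : Integrable (fun ω => AdaptiveMetropolis.W π s (X 0 ω)) P)
    (f : EuclideanSpace ℝ (Fin d) → ℝ) (hf : Measurable f) (hfb : ∃ C : ℝ, ∀ x, |f x| ≤ C) :
    Tendsto (fun n : ℕ => ∫ ω, f (X n ω) ∂P) atTop (𝓝 (∫ x, f x * π x)) := by
  obtain ⟨C, hC⟩ := hfb
  obtain ⟨M, hM⟩ := hπ.bounded
  obtain ⟨ρ, β, R, hT⟩ := hπ.exists_isTarget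
  -- A non-integrable function would have integral 0, contradicting the normalization.
  have hπi : Integrable π := by
    by_contra hni
    rw [integral_undef hni] at hπ1
    exact zero_ne_one hπ1
  have hc : 0 < (2.38 : ℝ) ^ 2 / (d : ℝ) := by
    have : (0 : ℝ) < d := by exact_mod_cast hd
    positivity
  obtain ⟨A, K₁, hA, hK₁, hrate⟩ :=
    hT.exists_rate hd hs0 hs1 hM hπi hπ1 (mul_pos hc hκ)
  obtain ⟨K, hK0, hK⟩ := hAM.exists_integral_W_le hd hT hs0 hs1 hκ hX0
  obtain ⟨Ce, hCe0, hCe⟩ := hT.exists_le_exp_neg_norm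
  obtain ⟨a, ha, hnorm⟩ := AdaptiveMetropolis.exists_norm_le_log_W hT.pos hM hs0 hCe0 hCe
  have hlim := AdaptiveMetropolis.tendsto_window_bound hA a (s⁻¹ * 4) (D := d) hc.le
    hκ hK0 hK₁ (Nat.cast_nonneg d)
  have hlim' := hlim.const_mul C
  rw [mul_zero] at hlim'
  rw [tendsto_iff_norm_sub_tendsto_zero]
  refine squeeze_zero' (Eventually.of_forall fun n => norm_nonneg _) ?_
    hlim'
  filter_upwards [eventually_ge_atTop 2] with n hn
  have hn1 : (1 : ℝ) < n := by exact_mod_cast hn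
  have hr : ⌊(n : ℝ) ^ (1 / 4 : ℝ)⌋₊ < n := by
    rw [Nat.floor_lt (by positivity)]
    calc (n : ℝ) ^ (1 / 4 : ℝ) < (n : ℝ) ^ (1 : ℝ) :=
          Real.rpow_lt_rpow_of_exponent_lt hn1 (by norm_num)
      _ = n := Real.rpow_one _
  -- Truncating W at n⁴ confines the state to a ball of radius O(log n).
  have hB : ∀ x, AdaptiveMetropolis.W π s x ≤ (n : ℝ) ^ 4 → ‖x‖ ≤ a + s⁻¹ * 4 * Real.log n := fun x hx => by
    have h1 := Real.log_le_log (zero_lt_one.trans_le (AdaptiveMetropolis.one_le_W hT.pos hM hs0 x)) hx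
    rw [Real.log_pow] at h1
    have h2 := mul_le_mul_of_nonneg_left h1 (inv_pos.2 hs0).le
    push_cast at h2
    linarith [hnorm x]
  -- The window starts at n - ⌊n^(1/4)⌋, so that it ends exactly at n.
  have key := hAM.abs_integral_sub_le hd hT.pos hT.diff.continuous hπi hπ1 hκ hA hK₁ hrate
    hK0 hK hf hC (n := n - ⌊(n : ℝ) ^ (1 / 4 : ℝ)⌋₊) (by omega) ⌊(n : ℝ) ^ (1 / 4 : ℝ)⌋₊
    (by positivity) hB
  rwa [Nat.sub_add_cancel hr.le, Nat.cast_sub hr.le] at key
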